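/- **Setting.** Let $n\ge1$, $m_0,\mu,m_1,\dots,m_n>0$, $\mathfrak m_i=\frac{m_0m_i}{m_0+\mu m_i}$, $\mathfrak M_i=m_0+\mu m_i$. On the phase space of $(y,x)=(y^{(1)},\dots,y^{(n)},x^{(1)},\dots,x^{(n)})\in(\mathbb R^3)^n\times(\mathbb R^3)^n$ consider the heliocentric planetary Hamiltonian $$H_{\rm hel}=\sum_{i=1}^n h^{(i)}_{2B}+\mu f_{\rm hel},\qquad h^{(i)}_{2B}=\frac{|y^{(i)}|^2}{2\mathfrak m_i}-\frac{\mathfrak m_i\mathfrak M_i}{|x^{(i)}|},\qquad f_{\rm hel}=\sum_{i<j}\Big(\frac{y^{(i)}\cdot y^{(j)}}{m_0}-\frac{m_im_j}{|x^{(i)}-x^{(j)}|}\Big),$$ with equations of motion $\dot y=-\partial_xH_{\rm hel}$, $\dot x=\partial_yH_{\rm hel}$. For each $i$ let $C^{(i)}=x^{(i)}\times y^{(i)}$ and, when $x^{(i)}\ne0$, $h_{2B}^{(i)}<0$ and $C^{(i)}\neq0$, let $a^{(i)}$, $e^{(i)}$, $P^{(i)}$ be the semi-major axis, the eccentricity and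 (if $e^{(i)}\ne0$) the unit vector towards the perihelion of the instantaneous ellipse, i.e. of the orbit of $h^{(i)}_{2B}$ through $(y^{(i)},x^{(i)})$; let $\mathcal A^{(i)}$ be the area swept on it from the perihelion to $x^{(i)}$, positively with respect to $C^{(i)}$, and $\mathcal A^{(i)}_{\rm tot}=\pi (a^{(i)})^2\sqrt{1-(e^{(i)})^2}$. For $w\neq 0$ and non-zero $u,v\perp w$, let $\alpha_w(u,v)\in\mathbb T=\mathbb R/2\pi\mathbb Z$ be the angle from $u$ to $v$, counter-clockwise with respect to $w$. Let $k^{(1)},k^{(2)},k^{(3)}$ be the standard basis of $\mathbb R^3$ and put $$S^{(j)}=\sum_{k=j}^nC^{(k)},\quad \tilde\nu_1=k^{(3)}\times S^{(1)},\quad \tilde\nu_{j+1}=P^{(j)}\times S^{(j+1)},\quad \tilde{\rm n}_j=S^{(j)}\times P^{(j)}\ (1\le j\le n-1),\quad \tilde{\rm n}_n=P^{(n)}.$$ Let $\mathcal D$ be the set of $(y,x)$ such that, for all $i$, $x^{(i)}\ne0$, $h^{(i)}_{2B}<0$, $C^{(i)}\ne0$, $e^{(i)}\neq0$, and all the vectors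 $\tilde\nu_j,\tilde{\rm n}_j$ are non-zero. On $\mathcal D$ define $P_*=(\Lambda,\chi,\Theta,\ell,\kappa,\vartheta)\in\mathbb R^{3n}\times\mathbb T^{3n}$ by $$\Lambda_i=\mathfrak m_i\sqrt{\mathfrak M_ia^{(i)}},\qquad \ell_i=2\pi\,\mathcal A^{(i)}/\mathcal A^{(i)}_{\rm tot}\ \ (\text{mean anomaly}),\qquad 1\le i\le n,$$ $$\chi_{j-1}=|S^{(j)}|,\qquad \kappa_{j-1}=\alpha_{S^{(j)}}(\tilde\nu_j,\tilde{\rm n}_j),\qquad 1\le j\le n,$$ $$\Theta_0=S^{(1)}\cdot k^{(3)},\quad \vartheta_0=\alpha_{k^{(3)}}(k^{(1)},\tilde\nu_1),\qquad \Theta_{j-1}=S^{(j)}\cdot P^{(j-1)},\quad \vartheta_{j-1}=\alpha_{P^{(j-1)}}(\tilde{\rm n}_{j-1},\tilde\nu_j),\quad 2\le j\le n.$$ A bar denotes removal of the component of index $0$. **Proposition.** 1. *$P_*$ are canonical coordinates.* $\mathcal D$ is open, $P_*$ is injective on $\mathcal D$, its image (lifted to $\mathbb R^{3n}\times\mathbb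 R^{3n}$) is open, and the inverse map $\phi:(\Lambda,\chi,\Theta,\ell,\kappa,\vartheta)\mapsto(y,x)$ ($2\pi$-periodic in the angles) is of class $C^\infty$ and satisfies $$\phi^*\Big(\sum_{i=1}^n\sum_{j=1}^3dy^{(i)}_j\wedge dx^{(i)}_j\Big)=\sum_{i=1}^n d\Lambda_i\wedge d\ell_i+\sum_{j=0}^{n-1}\big(d\chi_j\wedge d\kappa_j+d\Theta_j\wedge d\vartheta_j\big).$$ 2. *Integrals.* Where $\phi$ has no collisions ($x^{(i)}\ne x^{(j)}$ for $i\neq j$), let $H_{\chi_0}=H_{\rm hel}\circ\phi$. Then $\Theta_0$, $\vartheta_0$, $\chi_0$ are constant along every solution of the Hamilton equations of $H_{\chi_0}$, and there is a function $f_{\chi_0}$, which does not depend on $(\Theta_0,\vartheta_0,\kappa_0)$ and depends on $\chi_0$ only as a parameter, such that $f_{\rm hel}\circ\phi=f_{\chi_0}$ and $$H_{\chi_0}=h_K(\Lambda)+\mu f_{\chi_0}(\Lambda,\bar\chi,\bar\Theta,\ell,\bar\kappa,\bar\vartheta),\qquad h_K(\Lambda)=-\sum_{i=1}^n\frac{\mathfrak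 m_i^3\mathfrak M_i^2}{2\Lambda_i^2}.$$ 3. *Reflection.* The transformation $(y_2^{(i)},x_2^{(i)})\to(-y_2^{(i)},-x_2^{(i)})$, for all $i$, with the other components fixed, maps $\mathcal D$ into itself and in the coordinates $P_*$ is $(\Lambda,\chi,\Theta,\ell,\kappa,\vartheta)\to(\Lambda,\chi,-\Theta,\ell,\kappa,-\vartheta)$ (angles mod $2\pi$). 4. *Planar configurations and equilibria.* A point of $\mathcal D$ is planar (all $x^{(i)},y^{(i)}$ in one plane through the origin) if and only if $(\bar\Theta,\bar\vartheta)=(0,\pi k)$ mod $2\pi$ in the angles, for some $k\in\{0,1\}^{n-1}$; if all the $C^{(i)}$ are parallel and in the same verse, then $\bar\Theta=0$ and $\bar\vartheta=(\pi,\dots,\pi)$. At every collision-free point of the domain with $(\bar\Theta,\bar\vartheta)=(0,\pi k)$ mod $2\pi$, $k\in\{0,1\}^{n-1}$ (in particular at those with $(\Theta,\vartheta)=(0,\pi k)$, $k\in\{0,1\}^n$), the function $(\bar\Theta,\bar\vartheta)\mapsto f_{\chi_0}(\Lambda,\bar\chi,\bar\Theta,\ell,\bar\kappa,\bar\vartheta)$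 has zero differential. -/

import Mathlib

open scoped Matrix ContDiff

noncomputable section

namespace Planetary

/-- Vectors of `ℝ³`; the orthonormal frame `(k⁽¹⁾, k⁽²⁾, k⁽³⁾)` is the standard basis. -/
abbrev Vec3 : Type := Fin 3 → ℝ

/-- Euclidean length of a vector of `ℝ³`. -/
def len (v : Vec3) : ℝ := √(v ⬝ᵥ v)

/-- The oriented angle `α_w(u, v)`: for non-zero `u, v` in the plane orthogonal to `w`, the angle
(mod `2π`) by which `u` has to be rotated, counter-clockwise with respect to `w` (right-hand rule),
in order to have the direction of `v`. It is the `θ` with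
`|u| |v| cos θ = u · v` and `|u| |v| sin θ = (w / |w|) · (u × v)`. -/
def orientedAngle (w u v : Vec3) : Real.Angle :=
  ((Complex.arg ⟨u ⬝ᵥ v, (w ⬝ᵥ (u ⨯₃ v)) / len w⟩ : ℝ) : Real.Angle)

/-- Phase space `(y, x)` of `n` planets: momenta first, heliocentric positions second. -/
abbrev Phase (n : ℕ) : Type := (Fin n → Vec3) × (Fin n → Vec3)

/-- Action-angle coordinates with the angles lifted to `ℝ`: `w.1 = (Λ, χ, Θ)` and
`w.2 = (ℓ, κ, ϑ)`. -/
abbrev Coord (n : ℕ) : Type := (Fin 3 → Fin n → ℝ) × (Fin 3 → Fin n → ℝ)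

/-- Action-angle coordinates with the angles in the torus. -/
abbrev TorusCoord (n : ℕ) : Type := (Fin 3 → Fin n → ℝ) × (Fin 3 → Fin n → Real.Angle)

/-- Reduction of the angles mod `2π`. -/
def toTorus {n : ℕ} (w : Coord n) : TorusCoord n :=
  (w.1, fun a i => (w.2 a i : Real.Angle))

/-- The standard 2-form `∑ dp ∧ dq` evaluated at two tangent vectors `u = (u_p, u_q)`,
`v = (v_p, v_q)`. It is `∑ dy ∧ dx` on `Phase n` and `∑ dΛ ∧ dℓ + ∑ dχ ∧ dκ + ∑ dΘ ∧ dϑ` on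
`Coord n`. -/
def stdForm {α β : Type} [Fintype α] [Fintype β] (u v : (α → β → ℝ) × (α → β → ℝ)) : ℝ :=
  ∑ a, ∑ b, (u.1 a b * v.2 a b - v.1 a b * u.2 a b)

/-- `γ` solves on `(s₀, s₁)` the Hamilton equations of `H` in the coordinates `(I, φ)`, namely
`dI/dt = -∂H/∂φ`, `dφ/dt = ∂H/∂I`. -/
def IsHamiltonianMotion {n : ℕ} (H : Coord n → ℝ) (γ : ℝ → Coord n) (s₀ s₁ : ℝ) : Prop :=
  ∀ t ∈ Set.Ioo s₀ s₁, HasDerivAt γ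
    ((fun a i => - fderiv ℝ H (γ t) (0, Pi.single a (Pi.single i 1))),
      (fun a i => fderiv ℝ H (γ t) (Pi.single a (Pi.single i 1), 0))) t

/-- Reflection `(y₁, y₂, y₃) ↦ (y₁, -y₂, y₃)`, `(x₁, x₂, x₃) ↦ (x₁, -x₂, x₃)` of all planets. -/
def reflect {n : ℕ} (z : Phase n) : Phase n :=
  (fun i => ![z.1 i 0, - z.1 i 1, z.1 i 2], fun i => ![z.2 i 0, - z.2 i 1, z.2 i 2])

/-- All positions and momenta lie in one plane through the origin. -/
def IsPlanar {n : ℕ} (z : Phase n) : Prop :=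
  ∃ ν : Vec3, ν ≠ 0 ∧ ∀ i, z.1 i ⬝ᵥ ν = 0 ∧ z.2 i ⬝ᵥ ν = 0

/-- No two planets collide with each other. -/
def CollisionFree {n : ℕ} (z : Phase n) : Prop := ∀ i j, i ≠ j → z.2 i ≠ z.2 j

/-- Signed area swept by the segment from the focus (the origin) to the point
`(ξ, η) = (a (cos s - e), a √(1 - e²) sin s)` of an ellipse with semi-major axis `a` and
eccentricity `e`, when `s` goes from the perihelion value `0` to `u`; the integrand is
`(ξ η' - η ξ') / 2`. -/
def sweptArea (a e u : ℝ) : ℝ :=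
  ∫ s in (0 : ℝ)..u,
    ((a * (Real.cos s - e)) * (a * √(1 - e ^ 2) * Real.cos s)
      - (a * √(1 - e ^ 2) * Real.sin s) * (- (a * Real.sin s))) / 2

/-- The area enclosed by the ellipse. -/
def totalArea (a e : ℝ) : ℝ := Real.pi * a ^ 2 * √(1 - e ^ 2)

/-- The masses of a star (`m₀`) and of `N + 1` planets (`μ m i`). Planets are numbered from `0`
to `N`. -/
structure PlanetarySystem (N : ℕ) where
  m₀ : ℝ
  μ : ℝ
  m : Fin (N + 1) → ℝ
  m₀_pos : 0 < m₀
  μ_pos : 0 < μ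
  m_pos : ∀ i, 0 < m i

namespace PlanetarySystem

variable {N : ℕ} (σ : PlanetarySystem N)

/-- The reduced mass `𝔪ᵢ`. -/
def redMass (i : Fin (N + 1)) : ℝ := σ.m₀ * σ.m i / (σ.m₀ + σ.μ * σ.m i)

/-- The mass `𝔐ᵢ`. -/
def totMass (i : Fin (N + 1)) : ℝ := σ.m₀ + σ.μ * σ.m i

/-- The two-body Hamiltonian of planet `i`. -/
def twoBody (i : Fin (N + 1)) (z : Phase (N + 1)) : ℝ :=
  (z.1 i ⬝ᵥ z.1 i) / (2 * σ.redMass i) - σ.redMass i * σ.totMass i / len (z.2 i)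

/-- The perturbing function in heliocentric coordinates. -/
def fHel (z : Phase (N + 1)) : ℝ :=
  ∑ i, ∑ j ∈ Finset.Ioi i,
    ((z.1 i ⬝ᵥ z.1 j) / σ.m₀ - σ.m i * σ.m j / len (z.2 i - z.2 j))

/-- The planetary Hamiltonian in heliocentric coordinates. -/
def hHel (z : Phase (N + 1)) : ℝ := ∑ i, σ.twoBody i z + σ.μ * σ.fHel z

/-- The Keplerian part `h_K(Λ)`. -/
def hKep (Λ : Fin (N + 1) → ℝ) : ℝ :=
  ∑ i, - (σ.redMass i ^ 3 * σ.totMass i ^ 2 / (2 * Λ i ^ 2))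

/-- Angular momentum `C⁽ⁱ⁾ = x⁽ⁱ⁾ × y⁽ⁱ⁾`. -/
def angMom (z : Phase (N + 1)) (i : Fin (N + 1)) : Vec3 := z.2 i ⨯₃ z.1 i

/-! The instantaneous ellipse of planet `i` is the orbit through `(y⁽ⁱ⁾, x⁽ⁱ⁾)` of the two-body
Hamiltonian; its elements are the usual ones. -/

/-- Semi-major axis of the instantaneous ellipse. -/
def semiMajor (z : Phase (N + 1)) (i : Fin (N + 1)) : ℝ :=
  - (σ.redMass i * σ.totMass i) / (2 * σ.twoBody i z)

/-- Eccentricity (Laplace) vector of the instantaneous ellipse: it points from the focus to the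
perihelion and its length is the eccentricity. -/
def eccVec (z : Phase (N + 1)) (i : Fin (N + 1)) : Vec3 :=
  (σ.redMass i ^ 2 * σ.totMass i)⁻¹ • (z.1 i ⨯₃ angMom z i) - (len (z.2 i))⁻¹ • z.2 i

/-- Eccentricity of the instantaneous ellipse. -/
def ecc (z : Phase (N + 1)) (i : Fin (N + 1)) : ℝ := len (σ.eccVec z i)

/-- Direction `P⁽ⁱ⁾` of the perihelion. -/
def peri (z : Phase (N + 1)) (i : Fin (N + 1)) : Vec3 := (σ.ecc z i)⁻¹ • σ.eccVec z i

/-- Eccentric anomaly `u` of `x⁽ⁱ⁾` on the instantaneous ellipse: in the orthonormal basis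
`(P, (C / |C|) × P)` of the plane of the ellipse, oriented by `C`, the planet has coordinates
`(a (cos u - e), a √(1 - e²) sin u)`. -/
def eccAnomaly (z : Phase (N + 1)) (i : Fin (N + 1)) : ℝ :=
  Complex.arg
    ⟨(z.2 i ⬝ᵥ σ.peri z i) / σ.semiMajor z i + σ.ecc z i,
      (z.2 i ⬝ᵥ ((len (angMom z i))⁻¹ • (angMom z i ⨯₃ σ.peri z i)))
        / (σ.semiMajor z i * √(1 - σ.ecc z i ^ 2))⟩

/-- Mean anomaly: `2π` times the ratio between the area swept from the perihelion and the total
area. Counting the area mod the total area is the same as counting the angle mod `2π`. -/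
def meanAnomaly (z : Phase (N + 1)) (i : Fin (N + 1)) : Real.Angle :=
  ((2 * Real.pi * (sweptArea (σ.semiMajor z i) (σ.ecc z i) (σ.eccAnomaly z i)
    / totalArea (σ.semiMajor z i) (σ.ecc z i)) : ℝ) : Real.Angle)

/-- Partial sums of the angular momenta, from planet `j` to the last one; `partialSum z 0` is the
total angular momentum. -/
def partialSum (z : Phase (N + 1)) (j : Fin (N + 1)) : Vec3 := ∑ k ∈ Finset.Ici j, angMom z k

/-- The nodes `ν̃`: the first is `k⁽³⁾ × C`, the next ones are the products of the perihelion
of a planet with the partial sum that starts from the following planet. -/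
def nodeNu (z : Phase (N + 1)) (j : Fin (N + 1)) : Vec3 :=
  Fin.cases (![0, 0, 1] ⨯₃ partialSum z 0)
    (fun i : Fin N => σ.peri z i.castSucc ⨯₃ partialSum z i.succ) j

/-- The nodes `ñ`: `S × P` for all planets but the last one, and `P` for the last one. -/
def nodeN (z : Phase (N + 1)) (j : Fin (N + 1)) : Vec3 :=
  if j = Fin.last N then σ.peri z j else partialSum z j ⨯₃ σ.peri z j

/-- `Λᵢ = 𝔪ᵢ √(𝔐ᵢ aᵢ)`. -/
def Lam (z : Phase (N + 1)) (i : Fin (N + 1)) : ℝ :=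
  σ.redMass i * √(σ.totMass i * σ.semiMajor z i)

/-- `χⱼ`, the length of the partial sum of the angular momenta. -/
def chi (z : Phase (N + 1)) (j : Fin (N + 1)) : ℝ := len (partialSum z j)

/-- `Θ₀` is the third component of the total angular momentum; the next ones are projections of
the partial sums over the perihelion of the previous planet. -/
def Theta (z : Phase (N + 1)) (j : Fin (N + 1)) : ℝ :=
  Fin.cases (partialSum z 0 ⬝ᵥ ![0, 0, 1])
    (fun i : Fin N => partialSum z i.succ ⬝ᵥ σ.peri z i.castSucc) j

/-- `κⱼ`, the angle between the nodes `ν̃` and `ñ` in the plane orthogonal to the partial sum. -/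
def kappa (z : Phase (N + 1)) (j : Fin (N + 1)) : Real.Angle :=
  orientedAngle (partialSum z j) (σ.nodeNu z j) (σ.nodeN z j)

/-- `ϑ₀` is the angle of the node `ν̃` with `k⁽¹⁾` in the horizontal plane; the next ones are the
angles between the nodes `ñ` and `ν̃` in the plane orthogonal to the perihelion. -/
def vartheta (z : Phase (N + 1)) (j : Fin (N + 1)) : Real.Angle :=
  Fin.cases (orientedAngle ![0, 0, 1] ![1, 0, 0] (σ.nodeNu z 0))
    (fun i : Fin N =>
      orientedAngle (σ.peri z i.castSucc) (σ.nodeN z i.castSucc) (σ.nodeNu z i.succ)) j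

/-- The coordinates `P_* = (Λ, χ, Θ, ℓ, κ, ϑ)`. -/
def pStar (z : Phase (N + 1)) : TorusCoord (N + 1) :=
  (![σ.Lam z, chi z, σ.Theta z], ![σ.meanAnomaly z, σ.kappa z, σ.vartheta z])

/-- The set where the coordinates are defined: every planet is on an instantaneous ellipse (negative
energy, non-zero angular momentum) which is not a circle, and no node vanishes. -/
def domain : Set (Phase (N + 1)) :=
  {z | (∀ i, z.2 i ≠ 0 ∧ σ.twoBody i z < 0 ∧ angMom z i ≠ 0 ∧ σ.eccVec z i ≠ 0) ∧
    ∀ j, σ.nodeNu z j ≠ 0 ∧ σ.nodeN z j ≠ 0}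

/-- The values of the coordinates, with the angles lifted to `ℝ`. -/
def range : Set (Coord (N + 1)) := toTorus ⁻¹' (σ.pStar '' σ.domain)

/-- The map `φ_{P_*}` from the coordinates to `(y, x)`: the inverse of `pStar` on `domain`,
`2π`-periodic in the angles. -/
def phi (w : Coord (N + 1)) : Phase (N + 1) := Function.invFunOn σ.pStar σ.domain (toTorus w)

/-- The values of the coordinates that correspond to configurations without collisions, where the
planetary Hamiltonian is defined. -/
def freeRange : Set (Coord (N + 1)) := {w | w ∈ σ.range ∧ CollisionFree (σ.phi w)}

/-- The planetary Hamiltonian in the coordinates `P_*`. -/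
def hStar (w : Coord (N + 1)) : ℝ := σ.hHel (σ.phi w)

end PlanetarySystem

end Planetary

end

/-! The coordinates describe a chain of vectors `S⁽¹⁾, P⁽¹⁾, S⁽²⁾, P⁽²⁾, …` in which each vector is
located with respect to the previous ones by its length, a projection and an angle about an axis.
Since `C⁽ʲ⁾ ⊥ P⁽ʲ⁾`, the products `S⁽ʲ⁾ · P⁽ʲ⁾` and `S⁽ʲ⁺¹⁾ · P⁽ʲ⁾` are the same number `Θⱼ`, which
therefore serves both to find `P⁽ʲ⁾` from `S⁽ʲ⁾` and to find `S⁽ʲ⁺¹⁾` from `P⁽ʲ⁾`. Differences of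
the `S` give the `C`, and `C`, `P`, `Λ`, `ℓ` determine position and momentum through Kepler's
equation. This is injectivity (`SameShape.eq`, `pStar_injOn`).

Canonicity comes from the one-form identity `y · dx = Λ dℓ + χ dκ + Θ dϑ + d(2 x · y)`
(`liouville_form`). On a single ellipse, `y · dx = Λ dℓ + d(2 x · y) + C · (P × dP)`
(`kepler_form`). The sum of the terms `C · (P × dP)` equals `χ dκ + Θ dϑ` (`node_form`): the
differential of an angle between two nodes is the rotation rate of the second minus that of the
first (`angle_deriv`), and the rates of the nodes `ν̃` telescope along the chain. The exterior
derivative shows that smooth local lifts of `P_*` are symplectic, hence have invertible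
differential. The inverse function theorem and injectivity then give an open image and a smooth
symplectic inverse (`phi_local`).

The coordinates other than `Θ₀, κ₀, ϑ₀` fix a configuration up to a rotation, because they fix the
Gram matrix of the independent vectors `S⁽¹⁾, P⁽¹⁾` (`SameShape.exists_rotation`). As `f_hel` is
rotation invariant, `H` does not involve these three variables, and Hamilton's equations make `ϑ₀,
χ₀, Θ₀` constant.

Under a reflection `P` and the nodes are vectors while `C` and `S` are pseudo-vectors, so angles
about `S` are kept and `Θ` and the angles about `P` change sign. Since `f_hel` is also reflection
invariant and `-πk = πk` mod `2π`, the reduced perturbation is even about `(Θ̄, ϑ̄) = (0, πk)`. A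
differentiable function that is even about a point has zero differential there (`equilibrium`). -/

namespace Planetary

/-! ### Dot and cross products in `ℝ³` -/

theorem vec3_ext {u v : Vec3} (h0 : u 0 = v 0) (h1 : u 1 = v 1) (h2 : u 2 = v 2) : u = v := by
  ext i; fin_cases i <;> assumption

theorem dot3 (u v : Vec3) : u ⬝ᵥ v = u 0 * v 0 + u 1 * v 1 + u 2 * v 2 := by
  simp [dotProduct, Fin.sum_univ_three]

theorem cross_zero (u v : Vec3) : (u ⨯₃ v) 0 = u 1 * v 2 - u 2 * v 1 := by simp [cross_apply]

theorem cross_one (u v : Vec3) : (u ⨯₃ v) 1 = u 2 * v 0 - u 0 * v 2 := by simp [cross_apply]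

theorem cross_two (u v : Vec3) : (u ⨯₃ v) 2 = u 0 * v 1 - u 1 * v 0 := by simp [cross_apply]

theorem dot_self_nonneg (v : Vec3) : 0 ≤ v ⬝ᵥ v := by
  rw [dot3]; nlinarith [sq_nonneg (v 0), sq_nonneg (v 1), sq_nonneg (v 2)]

theorem dot_self_eq_zero {v : Vec3} : v ⬝ᵥ v = 0 ↔ v = 0 := by
  refine ⟨fun h => ?_, fun h => by simp [h]⟩
  rw [dot3] at h
  refine vec3_ext ?_ ?_ ?_ <;> simp <;>
    nlinarith [sq_nonneg (v 0), sq_nonneg (v 1), sq_nonneg (v 2)]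

theorem dot_self_pos {v : Vec3} (hv : v ≠ 0) : 0 < v ⬝ᵥ v :=
  lt_of_le_of_ne (dot_self_nonneg v) fun h => hv (dot_self_eq_zero.1 h.symm)

theorem len_sq (v : Vec3) : len v ^ 2 = v ⬝ᵥ v := Real.sq_sqrt (dot_self_nonneg v)

theorem len_nonneg (v : Vec3) : 0 ≤ len v := Real.sqrt_nonneg _

theorem len_pos {v : Vec3} (hv : v ≠ 0) : 0 < len v := Real.sqrt_pos.2 (dot_self_pos hv)

theorem len_ne_zero {v : Vec3} (hv : v ≠ 0) : len v ≠ 0 := (len_pos hv).ne'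

theorem dot_eq_of_len_eq {u v : Vec3} (h : len u = len v) : u ⬝ᵥ u = v ⬝ᵥ v := by
  rw [← len_sq, ← len_sq, h]

theorem cross_smul_left (c : ℝ) (u v : Vec3) : (c • u) ⨯₃ v = c • (u ⨯₃ v) := by simp

theorem cross_smul_right (c : ℝ) (u v : Vec3) : u ⨯₃ (c • v) = c • (u ⨯₃ v) := by simp

theorem dot_cross_cross (a b c d : Vec3) :
    (a ⨯₃ b) ⬝ᵥ (c ⨯₃ d) = (a ⬝ᵥ c) * (b ⬝ᵥ d) - (a ⬝ᵥ d) * (b ⬝ᵥ c) := by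
  simp only [dot3, cross_zero, cross_one, cross_two]; ring

theorem cross_cross_right (a b c : Vec3) :
    a ⨯₃ (b ⨯₃ c) = (a ⬝ᵥ c) • b - (a ⬝ᵥ b) • c := by
  apply vec3_ext <;>
    simp only [dot3, cross_zero, cross_one, cross_two, Pi.sub_apply, Pi.smul_apply, smul_eq_mul] <;>
    ring

theorem dot_cross_self_left (a b : Vec3) : a ⬝ᵥ (a ⨯₃ b) = 0 := by
  simp only [dot3, cross_zero, cross_one, cross_two]; ring

theorem dot_cross_self_right (a b : Vec3) : b ⬝ᵥ (a ⨯₃ b) = 0 := by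
  simp only [dot3, cross_zero, cross_one, cross_two]; ring

theorem cross_dot_self_left (a b : Vec3) : (a ⨯₃ b) ⬝ᵥ a = 0 := by
  simp only [dot3, cross_zero, cross_one, cross_two]; ring

theorem cross_dot_self_right (a b : Vec3) : (a ⨯₃ b) ⬝ᵥ b = 0 := by
  simp only [dot3, cross_zero, cross_one, cross_two]; ring

theorem triple_rotate (a b c : Vec3) : a ⬝ᵥ (b ⨯₃ c) = b ⬝ᵥ (c ⨯₃ a) := by
  simp only [dot3, cross_zero, cross_one, cross_two]; ring

/-- The square of the triple product of `w` with two vectors orthogonal to it. -/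
theorem sq_triple_of_orthogonal {w u v : Vec3} (hu : u ⬝ᵥ w = 0) (hv : v ⬝ᵥ w = 0) :
    (w ⬝ᵥ (u ⨯₃ v)) ^ 2 + (w ⬝ᵥ w) * (u ⬝ᵥ v) ^ 2 = (w ⬝ᵥ w) * ((u ⬝ᵥ u) * (v ⬝ᵥ v)) := by
  -- `u × v` is parallel to `w`, so Cauchy–Schwarz for this pair is an equality; Lagrange's identity
  -- turns that into the claim.
  have h1 : w ⨯₃ (u ⨯₃ v) = 0 := by
    rw [cross_cross_right, dotProduct_comm w v, dotProduct_comm w u, hu, hv]; simp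
  have h2 := dot_cross_cross w (u ⨯₃ v) w (u ⨯₃ v)
  rw [h1, dot_cross_cross u v u v, dotProduct_comm (u ⨯₃ v) w, dotProduct_comm v u] at h2
  simp only [dotProduct_zero] at h2
  linear_combination h2

/-- A vector is determined by its dot and cross products with a non-zero one. -/
theorem eq_of_dot_cross {w u v : Vec3} (hw : w ≠ 0) (hd : u ⬝ᵥ w = v ⬝ᵥ w)
    (hc : w ⨯₃ u = w ⨯₃ v) : u = v := by
  have h1 : w ⬝ᵥ (u - v) = 0 := by
    rw [dotProduct_sub, dotProduct_comm w u, dotProduct_comm w v, hd, sub_self]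
  have h2 : w ⨯₃ (u - v) = 0 := by rw [map_sub, hc, sub_self]
  have h3 := dot_cross_cross w (u - v) w (u - v)
  rw [h2, h1] at h3
  simp only [dotProduct_zero, zero_mul, sub_zero] at h3
  have h4 := (mul_eq_zero.1 h3.symm).resolve_left (dot_self_pos hw).ne'
  exact sub_eq_zero.1 (dot_self_eq_zero.1 h4)

/-- Two vectors with zero cross product are parallel. -/
theorem eq_smul_of_cross_eq_zero {u v : Vec3} (hu : u ≠ 0) (h : u ⨯₃ v = 0) :
    v = ((u ⬝ᵥ v) / (u ⬝ᵥ u)) • u := by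
  apply eq_of_dot_cross hu
  · rw [smul_dotProduct, smul_eq_mul, div_mul_cancel₀ _ (dot_self_pos hu).ne', dotProduct_comm]
  · rw [h, cross_smul_right, cross_self, smul_zero]

/-! ### Oriented angles -/

/-- The complex number whose argument is the oriented angle. -/
noncomputable def angleNum (w u v : Vec3) : ℂ := ⟨u ⬝ᵥ v, (w ⬝ᵥ (u ⨯₃ v)) / len w⟩

theorem orientedAngle_eq (w u v : Vec3) :
    orientedAngle w u v = ((Complex.arg (angleNum w u v) : ℝ) : Real.Angle) := rfl

theorem norm_angleNum {w u v : Vec3} (hw : w ≠ 0) (hu : u ⬝ᵥ w = 0) (hv : v ⬝ᵥ w = 0) :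
    ‖angleNum w u v‖ = len u * len v := by
  have h := sq_triple_of_orthogonal hu hv
  have hl := len_sq w
  have hp := len_pos hw
  rw [← sq_eq_sq₀ (norm_nonneg _) (mul_nonneg (len_nonneg u) (len_nonneg v)), mul_pow, len_sq,
    len_sq, ← Complex.normSq_eq_norm_sq, Complex.normSq_apply]
  simp only [angleNum]
  rw [← hl] at h
  field_simp
  linear_combination h

theorem angleNum_ne_zero {w u v : Vec3} (hw : w ≠ 0) (hu : u ⬝ᵥ w = 0) (hv : v ⬝ᵥ w = 0)
    (hu0 : u ≠ 0) (hv0 : v ≠ 0) : angleNum w u v ≠ 0 := by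
  rw [← norm_ne_zero_iff, norm_angleNum hw hu hv]
  exact mul_ne_zero (len_ne_zero hu0) (len_ne_zero hv0)

theorem cos_of_coe_eq_arg {c : ℂ} (hc : c ≠ 0) {θ : ℝ}
    (h : (θ : Real.Angle) = ((Complex.arg c : ℝ) : Real.Angle)) : ‖c‖ * Real.cos θ = c.re := by
  rw [← Real.Angle.cos_coe, h, Real.Angle.cos_coe, Complex.cos_arg hc,
    mul_div_cancel₀ _ (norm_ne_zero_iff.2 hc)]

theorem sin_of_coe_eq_arg {c : ℂ} {θ : ℝ}
    (h : (θ : Real.Angle) = ((Complex.arg c : ℝ) : Real.Angle)) : ‖c‖ * Real.sin θ = c.im := by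
  rw [← Real.Angle.sin_coe, h, Real.Angle.sin_coe, Complex.sin_arg]
  rcases eq_or_ne c 0 with rfl | hc
  · simp
  · rw [mul_div_cancel₀ _ (norm_ne_zero_iff.2 hc)]

theorem arg_eq_of_coe_eq {c d : ℂ}
    (h : ((Complex.arg c : ℝ) : Real.Angle) = ((Complex.arg d : ℝ) : Real.Angle)) :
    Complex.arg c = Complex.arg d := by
  have := congrArg Real.Angle.toReal h
  rwa [Real.Angle.toReal_coe_eq_self_iff.2 (Complex.arg_mem_Ioc c),
    Real.Angle.toReal_coe_eq_self_iff.2 (Complex.arg_mem_Ioc d)] at this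

/-- A vector of the plane orthogonal to `w` is determined by its length and its oriented angle. -/
theorem eq_of_orientedAngle_eq {w u v v' : Vec3} (hw : w ≠ 0) (hu0 : u ≠ 0)
    (hu : u ⬝ᵥ w = 0) (hv : v ⬝ᵥ w = 0) (hv' : v' ⬝ᵥ w = 0)
    (hl : v ⬝ᵥ v = v' ⬝ᵥ v') (h : orientedAngle w u v = orientedAngle w u v') : v = v' := by
  have hl' : len v = len v' := by rw [len, len, hl]
  -- Equal modulus and argument give equal complex numbers, hence equal products `u · v` and `w · (u
  -- × v)`.
  have hc : angleNum w u v = angleNum w u v' := by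
    refine Complex.ext_norm_arg ?_ (arg_eq_of_coe_eq h)
    rw [norm_angleNum hw hu hv, norm_angleNum hw hu hv', hl']
  have h1 : u ⬝ᵥ v = u ⬝ᵥ v' := congrArg Complex.re hc
  have h2 : (w ⬝ᵥ (u ⨯₃ v)) / len w = (w ⬝ᵥ (u ⨯₃ v')) / len w := congrArg Complex.im hc
  rw [div_left_inj' (len_ne_zero hw)] at h2
  refine eq_of_dot_cross hu0 (by rw [dotProduct_comm v, dotProduct_comm v', h1]) ?_
  refine eq_of_dot_cross hw (by rw [dotProduct_comm _ w, h2, dotProduct_comm]) ?_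
  rw [cross_cross_right, cross_cross_right, dotProduct_comm w v, dotProduct_comm w v',
    dotProduct_comm w u, hu, hv, hv']
  simp

/-- `a` is determined by its length, by its projection on `w` and by the angle of `w × a`. -/
theorem eq_of_orientedAngle_cross_eq {w u a a' : Vec3} (hw : w ≠ 0) (hu0 : u ≠ 0)
    (hu : u ⬝ᵥ w = 0) (hd : a ⬝ᵥ w = a' ⬝ᵥ w)
    (hl : a ⬝ᵥ a = a' ⬝ᵥ a') (h : orientedAngle w u (w ⨯₃ a) = orientedAngle w u (w ⨯₃ a')) :
    a = a' := by
  refine eq_of_dot_cross hw hd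
    (eq_of_orientedAngle_eq hw hu0 hu (cross_dot_self_left _ _) (cross_dot_self_left _ _)
      ?_ h)
  rw [dot_cross_cross, dot_cross_cross, hl, hd, dotProduct_comm w a, hd, dotProduct_comm w a']

/-- The number whose argument is taken is real, and its sign decides between `0` and `π`. If it
vanishes, the convention `arg 0 = 0` gives `k = 0`. -/
theorem orientedAngle_eq_coe_pi_mul {w u v : Vec3} (h : u ⨯₃ v = 0) :
    ∃ k : Fin 2, orientedAngle w u v = ((Real.pi * ((k : ℕ) : ℝ) : ℝ) : Real.Angle) := by
  have him : (angleNum w u v).im = 0 := by simp [angleNum, h]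
  rcases le_or_gt 0 (u ⬝ᵥ v) with h0 | h0
  · refine ⟨0, ?_⟩
    rw [orientedAngle_eq, Complex.arg_eq_zero_iff.2 ⟨h0, him⟩]; simp
  · refine ⟨1, ?_⟩
    rw [orientedAngle_eq, Complex.arg_eq_pi_iff.2 ⟨h0, him⟩]; simp

theorem orientedAngle_eq_pi {w u v : Vec3} (h : u ⨯₃ v = 0) (h0 : u ⬝ᵥ v < 0) :
    orientedAngle w u v = (Real.pi : Real.Angle) := by
  have him : (angleNum w u v).im = 0 := by simp [angleNum, h]
  rw [orientedAngle_eq, Complex.arg_eq_pi_iff.2 ⟨h0, him⟩]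

theorem triple_eq_zero_of_orientedAngle {w u v : Vec3} (hw : w ≠ 0) {k : Fin 2}
    (h : orientedAngle w u v = ((Real.pi * ((k : ℕ) : ℝ) : ℝ) : Real.Angle)) :
    w ⬝ᵥ (u ⨯₃ v) = 0 := by
  have h1 := sin_of_coe_eq_arg (c := angleNum w u v) h.symm
  have h2 : Real.sin (Real.pi * ((k : ℕ) : ℝ)) = 0 := by rw [mul_comm]; exact Real.sin_nat_mul_pi _
  rw [h2, mul_zero] at h1
  have h3 : (w ⬝ᵥ (u ⨯₃ v)) / len w = 0 := h1.symm
  exact (div_eq_zero_iff.1 h3).resolve_right (len_ne_zero hw)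

/-! ### Linear isometries of `ℝ³` -/

/-- `R` preserves the dot product and multiplies the cross product by the sign `ε`. -/
structure IsOrthogonal (ε : ℝ) (R : Vec3 →ₗ[ℝ] Vec3) : Prop where
  sign : ε * ε = 1
  dot : ∀ u v, R u ⬝ᵥ R v = u ⬝ᵥ v
  cross : ∀ u v, R u ⨯₃ R v = ε • R (u ⨯₃ v)

theorem IsOrthogonal.len {ε : ℝ} {R : Vec3 →ₗ[ℝ] Vec3} (hR : IsOrthogonal ε R) (v : Vec3) :
    len (R v) = len v := by rw [Planetary.len, hR.dot, Planetary.len]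

theorem IsOrthogonal.eq_zero_iff {ε : ℝ} {R : Vec3 →ₗ[ℝ] Vec3} (hR : IsOrthogonal ε R) {v : Vec3} :
    R v = 0 ↔ v = 0 := by
  rw [← dot_self_eq_zero, hR.dot, dot_self_eq_zero]

theorem len_smul_sign {ε : ℝ} (hε : ε * ε = 1) (v : Vec3) : len (ε • v) = len v := by
  rw [len, len, smul_dotProduct, dotProduct_smul, smul_smul, hε, one_smul]

/-- The axis `ε • R w` is how an angular momentum transforms. The sign of the pseudo-vector cancels
that of the cross product, so angles about `S` survive reflections too. -/
theorem IsOrthogonal.angleNum_smul {ε : ℝ} {R : Vec3 →ₗ[ℝ] Vec3} (hR : IsOrthogonal ε R)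
    (w u v : Vec3) : angleNum (ε • R w) (R u) (R v) = angleNum w u v := by
  simp only [angleNum, hR.cross, hR.dot, smul_dotProduct, dotProduct_smul, smul_smul, hR.sign,
    one_smul, len_smul_sign hR.sign, hR.len]

theorem IsOrthogonal.orientedAngle_smul {ε : ℝ} {R : Vec3 →ₗ[ℝ] Vec3} (hR : IsOrthogonal ε R)
    (w u v : Vec3) : orientedAngle (ε • R w) (R u) (R v) = orientedAngle w u v := by
  rw [orientedAngle_eq, orientedAngle_eq, hR.angleNum_smul]

theorem IsOrthogonal.orientedAngle_one {R : Vec3 →ₗ[ℝ] Vec3} (hR : IsOrthogonal 1 R)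
    (w u v : Vec3) : orientedAngle (R w) (R u) (R v) = orientedAngle w u v := by
  simpa using hR.orientedAngle_smul w u v

/-- When the axis is a true vector, such as a perihelion, only the triple product changes sign,
which is complex conjugation. -/
theorem IsOrthogonal.orientedAngle_neg_one {R : Vec3 →ₗ[ℝ] Vec3} (hR : IsOrthogonal (-1) R)
    (w u v : Vec3) : orientedAngle (R w) (R u) (R v) = - orientedAngle w u v := by
  have h : angleNum (R w) (R u) (R v) = (starRingEnd ℂ) (angleNum w u v) := by
    apply Complex.ext <;> simp [angleNum, hR.cross, hR.dot, hR.len, neg_div]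
  rw [orientedAngle_eq, orientedAngle_eq, h, Complex.arg_conj_coe_angle]

theorem ne_zero_of_cross {a b : Vec3} (h : a ⨯₃ b ≠ 0) : a ≠ 0 ∧ b ≠ 0 := by
  constructor <;> rintro rfl <;> simp at h

/-! ### Rotations from Gram matrices. -/

/-- Coordinates of a vector with respect to `a, b, a × b`. -/
theorem cross_frame_expansion (a b v : Vec3) :
    ((a ⨯₃ b) ⬝ᵥ (a ⨯₃ b)) • v = (v ⬝ᵥ (b ⨯₃ (a ⨯₃ b))) • a + (v ⬝ᵥ ((a ⨯₃ b) ⨯₃ a)) • b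
      + (v ⬝ᵥ (a ⨯₃ b)) • (a ⨯₃ b) := by
  apply vec3_ext <;>
    simp only [dot3, cross_zero, cross_one, cross_two, Pi.add_apply, Pi.smul_apply, smul_eq_mul] <;>
    ring

/-- Two pairs of independent vectors with the same Gram matrix are related by a rotation. -/
theorem exists_rotation {a b a' b' : Vec3} (h : a ⨯₃ b ≠ 0) (haa : a' ⬝ᵥ a' = a ⬝ᵥ a)
    (hab : a' ⬝ᵥ b' = a ⬝ᵥ b) (hbb : b' ⬝ᵥ b' = b ⬝ᵥ b) :
    ∃ R : Vec3 →ₗ[ℝ] Vec3, IsOrthogonal 1 R ∧ R a = a' ∧ R b = b' := by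
  set n := a ⨯₃ b with hn
  set n' := a' ⨯₃ b' with hn'
  have hnn : n' ⬝ᵥ n' = n ⬝ᵥ n := by
    rw [hn, hn', dot_cross_cross, dot_cross_cross, haa, hbb, hab, dotProduct_comm b' a', hab,
      dotProduct_comm b a]
  have hD := (dot_self_pos h).ne'
  set D := n ⬝ᵥ n with hDdef
  -- The coordinates of `v` in the frame `a, b, a × b`, read off from `cross_frame_expansion`, are
  -- transported to the primed frame.
  let R : Vec3 →ₗ[ℝ] Vec3 :=
    { toFun := fun v => D⁻¹ • ((v ⬝ᵥ (b ⨯₃ n)) • a' + (v ⬝ᵥ (n ⨯₃ a)) • b' + (v ⬝ᵥ n) • n')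
      map_add' := fun u v => by simp only [add_dotProduct]; module
      map_smul' := fun c v => by
        simp only [smul_dotProduct, smul_eq_mul, RingHom.id_apply]; module }
  have hRv : ∀ v, R v =
      D⁻¹ • ((v ⬝ᵥ (b ⨯₃ n)) • a' + (v ⬝ᵥ (n ⨯₃ a)) • b' + (v ⬝ᵥ n) • n') := fun v => rfl
  have hRa : R a = a' := by
    have h1 : a ⬝ᵥ (b ⨯₃ n) = D := by rw [triple_rotate, triple_rotate]
    have h2 : a ⬝ᵥ (n ⨯₃ a) = 0 := dot_cross_self_right _ _
    have h3 : a ⬝ᵥ n = 0 := dot_cross_self_left _ _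
    rw [hRv, h1, h2, h3, zero_smul, zero_smul, add_zero, add_zero, smul_smul, inv_mul_cancel₀ hD,
      one_smul]
  have hRb : R b = b' := by
    have h1 : b ⬝ᵥ (b ⨯₃ n) = 0 := dot_cross_self_left _ _
    have h2 : b ⬝ᵥ (n ⨯₃ a) = D := by rw [triple_rotate]
    have h3 : b ⬝ᵥ n = 0 := dot_cross_self_right _ _
    rw [hRv, h1, h2, h3, zero_smul, zero_smul, add_zero, zero_add, smul_smul, inv_mul_cancel₀ hD,
      one_smul]
  have hRn : R n = n' := by
    have h1 : n ⬝ᵥ (b ⨯₃ n) = 0 := dot_cross_self_right _ _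
    have h2 : n ⬝ᵥ (n ⨯₃ a) = 0 := dot_cross_self_left _ _
    rw [hRv, h1, h2, zero_smul, zero_smul, zero_add, zero_add, smul_smul, inv_mul_cancel₀ hD,
      one_smul]
  -- With this expansion, preservation of the two products reduces to their tables on the frames,
  -- which depend only on the common Gram matrix.
  have hexp : ∀ v, ∃ p q r : ℝ, v = p • a + q • b + r • n := fun v => by
    refine ⟨D⁻¹ * (v ⬝ᵥ (b ⨯₃ n)), D⁻¹ * (v ⬝ᵥ (n ⨯₃ a)), D⁻¹ * (v ⬝ᵥ n), ?_⟩
    rw [mul_smul, mul_smul, mul_smul, ← smul_add, ← smul_add, ← cross_frame_expansion, smul_smul,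
      inv_mul_cancel₀ hD, one_smul]
  refine ⟨R, ⟨by norm_num, ?_, ?_⟩, hRa, hRb⟩
  · intro u v
    obtain ⟨p, q, r, rfl⟩ := hexp u
    obtain ⟨s, t, w, rfl⟩ := hexp v
    have e1 : a ⬝ᵥ n = 0 := dot_cross_self_left _ _
    have e2 : b ⬝ᵥ n = 0 := dot_cross_self_right _ _
    have e1' : a' ⬝ᵥ n' = 0 := dot_cross_self_left _ _
    have e2' : b' ⬝ᵥ n' = 0 := dot_cross_self_right _ _
    simp only [map_add, map_smul, hRa, hRb, hRn, add_dotProduct, dotProduct_add, smul_dotProduct,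
      dotProduct_smul, smul_eq_mul, haa, hab, hbb, hnn, dotProduct_comm b' a', dotProduct_comm b a,
      dotProduct_comm n a, dotProduct_comm n b, dotProduct_comm n' a', dotProduct_comm n' b', e1,
      e2, e1', e2', hDdef]
  · intro u v
    obtain ⟨p, q, r, rfl⟩ := hexp u
    obtain ⟨s, t, w, rfl⟩ := hexp v
    have c1 : a ⨯₃ n = (a ⬝ᵥ b) • a - (a ⬝ᵥ a) • b := cross_cross_right _ _ _
    have c2 : b ⨯₃ n = (b ⬝ᵥ b) • a - (a ⬝ᵥ b) • b := by
      rw [hn, cross_cross_right, dotProduct_comm b a]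
    have c1' : a' ⨯₃ n' = (a ⬝ᵥ b) • a' - (a ⬝ᵥ a) • b' := by
      rw [hn', cross_cross_right, haa, hab]
    have c2' : b' ⨯₃ n' = (b ⬝ᵥ b) • a' - (a ⬝ᵥ b) • b' := by
      rw [hn', cross_cross_right, dotProduct_comm b' a', hbb, hab]
    have c3 : b ⨯₃ a = -n := by rw [hn, cross_anticomm]
    have c3' : b' ⨯₃ a' = -n' := by rw [hn', cross_anticomm]
    have c4 : n ⨯₃ a = -(a ⨯₃ n) := by rw [cross_anticomm]
    have c4' : n' ⨯₃ a' = -(a' ⨯₃ n') := by rw [cross_anticomm]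
    have c5 : n ⨯₃ b = -(b ⨯₃ n) := by rw [cross_anticomm]
    have c5' : n' ⨯₃ b' = -(b' ⨯₃ n') := by rw [cross_anticomm]
    simp only [map_add, map_smul, hRa, hRb, hRn, LinearMap.add_apply, LinearMap.smul_apply,
      cross_self, ← hn, ← hn', c3, c3', c4, c4', c5, c5', c1, c1', c2, c2', map_neg, map_sub,
      one_smul, map_zero]

end Planetary

namespace Planetary

/-! ### Kepler's equation -/

/-- The integrand is a multiple of `1 - e cos s`, so area and eccentric anomaly are related by
Kepler's equation. -/
theorem sweptArea_eq (a e u : ℝ) :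
    sweptArea a e u = a ^ 2 * √(1 - e ^ 2) / 2 * (u - e * Real.sin u) := by
  have h : ∀ s : ℝ, ((a * (Real.cos s - e)) * (a * √(1 - e ^ 2) * Real.cos s)
      - (a * √(1 - e ^ 2) * Real.sin s) * (- (a * Real.sin s))) / 2
      = a ^ 2 * √(1 - e ^ 2) / 2 * (1 - e * Real.cos s) := fun s => by
    linear_combination a ^ 2 * √(1 - e ^ 2) / 2 * (Real.sin_sq_add_cos_sq s)
  simp only [sweptArea, h]
  rw [intervalIntegral.integral_const_mul, intervalIntegral.integral_sub, 
    intervalIntegral.integral_const_mul, integral_cos, intervalIntegral.integral_const]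
  · simp
  · exact intervalIntegrable_const
  · exact (continuous_const.mul Real.continuous_cos).intervalIntegrable _ _

theorem two_pi_mul_sweptArea_div {a e : ℝ} (ha : 0 < a) (he : e ^ 2 < 1) (u : ℝ) :
    2 * Real.pi * (sweptArea a e u / totalArea a e) = u - e * Real.sin u := by
  have h1 : 0 < √(1 - e ^ 2) := Real.sqrt_pos.2 (by linarith)
  have h2 := Real.pi_pos
  rw [sweptArea_eq, totalArea]
  field_simp

/-- The sine is 1-Lipschitz, so `|u - v| ≤ e |u - v|` with `e < 1`. -/
theorem kepler_sub_eq_zero {e u v : ℝ} (he0 : 0 ≤ e) (he : e < 1)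
    (h : u - e * Real.sin u = v - e * Real.sin v) : u = v := by
  have h1 : u - v = e * (Real.sin u - Real.sin v) := by linarith
  have h2 : |Real.sin u - Real.sin v| ≤ |u - v| := by
    have := Real.lipschitzWith_sin.dist_le_mul u v
    simpa [Real.dist_eq] using this
  have h3 : |u - v| = e * |Real.sin u - Real.sin v| := by rw [h1, abs_mul, abs_of_nonneg he0]
  have h4 : |u - v| = 0 := by nlinarith [abs_nonneg (u - v)]
  exact sub_eq_zero.1 (abs_eq_zero.1 h4)

theorem cos_sin_eq_of_kepler {e u v : ℝ} (he0 : 0 ≤ e) (he : e < 1)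
    (h : ((u - e * Real.sin u : ℝ) : Real.Angle) = ((v - e * Real.sin v : ℝ) : Real.Angle)) :
    Real.cos u = Real.cos v ∧ Real.sin u = Real.sin v := by
  obtain ⟨k, hk⟩ := Real.Angle.angle_eq_iff_two_pi_dvd_sub.1 h
  have hs : Real.sin (v + k * (2 * Real.pi)) = Real.sin v := Real.sin_add_int_mul_two_pi v k
  have hu : u = v + k * (2 * Real.pi) :=
    kepler_sub_eq_zero he0 he (by rw [hs]; linarith)
  rw [hu, hs, Real.cos_add_int_mul_two_pi]
  exact ⟨rfl, rfl⟩

namespace PlanetarySystem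

variable {N : ℕ} (σ : PlanetarySystem N)

theorem totMass_pos (i : Fin (N + 1)) : 0 < σ.totMass i :=
  add_pos σ.m₀_pos (mul_pos σ.μ_pos (σ.m_pos i))

theorem redMass_pos (i : Fin (N + 1)) : 0 < σ.redMass i :=
  div_pos (mul_pos σ.m₀_pos (σ.m_pos i)) (σ.totMass_pos i)

/-- Planet `i` moves on a non-degenerate ellipse which is not a circle. -/
def Elliptic (z : Phase (N + 1)) (i : Fin (N + 1)) : Prop :=
  z.2 i ≠ 0 ∧ σ.twoBody i z < 0 ∧ angMom z i ≠ 0 ∧ σ.eccVec z i ≠ 0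

/-- The second vector of the basis of the plane of the ellipse. -/
noncomputable def periOrth (z : Phase (N + 1)) (i : Fin (N + 1)) : Vec3 :=
  (len (angMom z i))⁻¹ • (angMom z i ⨯₃ σ.peri z i)

/-- The complex number `cos u + i sin u`, where `u` is the eccentric anomaly. -/
noncomputable def eccNum (z : Phase (N + 1)) (i : Fin (N + 1)) : ℂ :=
  ⟨(z.2 i ⬝ᵥ σ.peri z i) / σ.semiMajor z i + σ.ecc z i,
    (z.2 i ⬝ᵥ σ.periOrth z i) / (σ.semiMajor z i * √(1 - σ.ecc z i ^ 2))⟩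

theorem eccAnomaly_eq (z : Phase (N + 1)) (i : Fin (N + 1)) :
    σ.eccAnomaly z i = Complex.arg (σ.eccNum z i) := rfl

/-! ### Elements of the ellipse of one planet. -/

section Kepler

variable {σ} {z : Phase (N + 1)} {i : Fin (N + 1)}

theorem Elliptic.semiMajor_pos (h : σ.Elliptic z i) : 0 < σ.semiMajor z i := by
  have := mul_pos (σ.redMass_pos i) (σ.totMass_pos i)
  have h1 := h.2.1
  rw [semiMajor]
  exact div_pos_of_neg_of_neg (by linarith) (by linarith)

theorem Elliptic.ecc_pos (h : σ.Elliptic z i) : 0 < σ.ecc z i := len_pos h.2.2.2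

theorem angMom_dot_pos (z : Phase (N + 1)) (i : Fin (N + 1)) : z.2 i ⬝ᵥ angMom z i = 0 :=
  dot_cross_self_left _ _

theorem angMom_dot_mom (z : Phase (N + 1)) (i : Fin (N + 1)) : z.1 i ⬝ᵥ angMom z i = 0 :=
  dot_cross_self_right _ _

theorem eccVec_dot_angMom (σ : PlanetarySystem N) (z : Phase (N + 1)) (i : Fin (N + 1)) :
    σ.eccVec z i ⬝ᵥ angMom z i = 0 := by
  rw [eccVec, sub_dotProduct, smul_dotProduct, smul_dotProduct, angMom_dot_pos,
    cross_dot_self_right]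
  simp

theorem peri_dot_angMom (σ : PlanetarySystem N) (z : Phase (N + 1)) (i : Fin (N + 1)) :
    σ.peri z i ⬝ᵥ angMom z i = 0 := by
  rw [peri, smul_dotProduct, eccVec_dot_angMom, smul_zero]

theorem Elliptic.eccVec_eq (h : σ.Elliptic z i) : σ.eccVec z i = σ.ecc z i • σ.peri z i := by
  rw [peri, smul_smul, mul_inv_cancel₀ h.ecc_pos.ne', one_smul]

theorem Elliptic.peri_dot_self (h : σ.Elliptic z i) : σ.peri z i ⬝ᵥ σ.peri z i = 1 := by
  have h1 := h.ecc_pos.ne'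
  rw [peri, smul_dotProduct, dotProduct_smul, smul_eq_mul, smul_eq_mul, ← len_sq, ← ecc]
  field_simp

theorem Elliptic.peri_ne_zero (h : σ.Elliptic z i) : σ.peri z i ≠ 0 := fun h0 => by
  have := h.peri_dot_self
  simp [h0] at this

/-- `|C|² = 𝔪² 𝔐 a (1 - e²)`. -/
theorem Elliptic.angMom_dot_self (h : σ.Elliptic z i) :
    angMom z i ⬝ᵥ angMom z i =
      σ.redMass i ^ 2 * σ.totMass i * σ.semiMajor z i * (1 - σ.ecc z i ^ 2) := by
  have hm := (σ.redMass_pos i).ne'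
  have hM := (σ.totMass_pos i).ne'
  have hr := len_ne_zero h.1
  have hr2 := len_sq (z.2 i)
  have hh := h.2.1.ne
  -- The classical relation between eccentricity, energy and angular momentum; it is the squared
  -- length of the Laplace vector, expanded with `(y × C) · x = |C|²`.
  have hE : σ.ecc z i ^ 2 = 1 + 2 * σ.twoBody i z * (angMom z i ⬝ᵥ angMom z i)
      / (σ.redMass i ^ 3 * σ.totMass i ^ 2) := by
    have h1 : (z.1 i ⨯₃ angMom z i) ⬝ᵥ (z.1 i ⨯₃ angMom z i)
        = (z.1 i ⬝ᵥ z.1 i) * (angMom z i ⬝ᵥ angMom z i) := by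
      rw [dot_cross_cross, angMom_dot_mom]; simp
    have h2 : (z.1 i ⨯₃ angMom z i) ⬝ᵥ z.2 i = angMom z i ⬝ᵥ angMom z i := by
      rw [dotProduct_comm, triple_rotate, triple_rotate]; rfl
    have h3 : z.2 i ⬝ᵥ (z.1 i ⨯₃ angMom z i) = angMom z i ⬝ᵥ angMom z i := by
      rw [dotProduct_comm, h2]
    rw [ecc, len_sq, eccVec, twoBody]
    simp only [sub_dotProduct, dotProduct_sub, smul_dotProduct, dotProduct_smul, smul_eq_mul, h1,
      h2, h3, ← hr2]
    field_simp
    ring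
  rw [hE, semiMajor]
  field_simp
  ring

theorem Elliptic.ecc_sq_lt_one (h : σ.Elliptic z i) : σ.ecc z i ^ 2 < 1 := by
  have h1 := dot_self_pos h.2.2.1
  rw [h.angMom_dot_self] at h1
  have h2 : 0 < σ.redMass i ^ 2 * σ.totMass i * σ.semiMajor z i :=
    mul_pos (mul_pos (pow_pos (σ.redMass_pos i) 2) (σ.totMass_pos i)) h.semiMajor_pos
  have := (mul_pos_iff_of_pos_left h2).1 h1
  linarith

theorem Elliptic.ecc_lt_one (h : σ.Elliptic z i) : σ.ecc z i < 1 := by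
  nlinarith [h.ecc_sq_lt_one, h.ecc_pos]

theorem Elliptic.sqrt_pos (h : σ.Elliptic z i) : 0 < √(1 - σ.ecc z i ^ 2) :=
  Real.sqrt_pos.2 (by linarith [h.ecc_sq_lt_one])

theorem Elliptic.sqrt_sq (h : σ.Elliptic z i) : √(1 - σ.ecc z i ^ 2) ^ 2 = 1 - σ.ecc z i ^ 2 :=
  Real.sq_sqrt (by linarith [h.ecc_sq_lt_one])

theorem Elliptic.lam_sq (h : σ.Elliptic z i) :
    σ.Lam z i ^ 2 = σ.redMass i ^ 2 * σ.totMass i * σ.semiMajor z i := by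
  rw [Lam, mul_pow, Real.sq_sqrt (mul_pos (σ.totMass_pos i) h.semiMajor_pos).le, mul_assoc]

theorem Elliptic.lam_pos (h : σ.Elliptic z i) : 0 < σ.Lam z i :=
  mul_pos (σ.redMass_pos i) (Real.sqrt_pos.2 (mul_pos (σ.totMass_pos i) h.semiMajor_pos))

theorem Elliptic.len_angMom (h : σ.Elliptic z i) :
    len (angMom z i) = σ.Lam z i * √(1 - σ.ecc z i ^ 2) := by
  rw [← sq_eq_sq₀ (len_nonneg _) (mul_pos h.lam_pos h.sqrt_pos).le, len_sq, mul_pow, h.lam_sq,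
    h.sqrt_sq, h.angMom_dot_self]

/-- The equation of the ellipse in polar coordinates. -/
theorem Elliptic.len_pos_eq (h : σ.Elliptic z i) :
    len (z.2 i) = σ.semiMajor z i * (1 - σ.ecc z i ^ 2) - σ.ecc z i * (z.2 i ⬝ᵥ σ.peri z i) := by
  have hm := (σ.redMass_pos i).ne'
  have hM := (σ.totMass_pos i).ne'
  have hr := len_ne_zero h.1
  have hr2 := len_sq (z.2 i)
  -- The polar equation is the product of the Laplace vector with `x`, which equals `|C|² / (𝔪² 𝔐) -
  -- |x|`.
  have h1 : z.2 i ⬝ᵥ σ.eccVec z i = σ.ecc z i * (z.2 i ⬝ᵥ σ.peri z i) := by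
    rw [h.eccVec_eq, dotProduct_smul, smul_eq_mul]
  have h3 : z.2 i ⬝ᵥ (z.1 i ⨯₃ angMom z i) = angMom z i ⬝ᵥ angMom z i := by
    rw [triple_rotate, triple_rotate]; rfl
  rw [eccVec, dotProduct_sub, dotProduct_smul, dotProduct_smul, h3, ← hr2, h.angMom_dot_self] at h1
  rw [← h1]
  simp only [smul_eq_mul]
  field_simp
  ring

theorem Elliptic.periOrth_dot_self (h : σ.Elliptic z i) :
    σ.periOrth z i ⬝ᵥ σ.periOrth z i = 1 := by
  have h1 := len_ne_zero h.2.2.1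
  rw [periOrth, smul_dotProduct, dotProduct_smul, dot_cross_cross, h.peri_dot_self,
    peri_dot_angMom, ← len_sq]
  simp only [smul_eq_mul]
  field_simp
  ring

theorem peri_dot_periOrth (σ : PlanetarySystem N) (z : Phase (N + 1)) (i : Fin (N + 1)) :
    σ.peri z i ⬝ᵥ σ.periOrth z i = 0 := by
  rw [periOrth, dotProduct_smul, dot_cross_self_right, smul_zero]

theorem angMom_cross_peri (h : σ.Elliptic z i) :
    angMom z i ⨯₃ σ.peri z i = len (angMom z i) • σ.periOrth z i := by
  rw [periOrth, smul_smul, mul_inv_cancel₀ (len_ne_zero h.2.2.1), one_smul]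

theorem angMom_cross_periOrth (h : σ.Elliptic z i) :
    angMom z i ⨯₃ σ.periOrth z i = -(len (angMom z i) • σ.peri z i) := by
  have h1 := len_ne_zero h.2.2.1
  rw [periOrth, cross_smul_right, cross_cross_right, dotProduct_comm (angMom z i) (σ.peri z i),
    peri_dot_angMom, ← len_sq, zero_smul, zero_sub, smul_neg, smul_smul]
  congr 2
  field_simp

theorem Elliptic.peri_cross_periOrth (h : σ.Elliptic z i) :
    len (angMom z i) • (σ.peri z i ⨯₃ σ.periOrth z i) = angMom z i := by
  have h1 := len_ne_zero h.2.2.1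
  rw [periOrth, cross_smul_right, smul_smul, mul_inv_cancel₀ h1, one_smul, cross_cross_right,
    h.peri_dot_self, peri_dot_angMom, one_smul, zero_smul, sub_zero]

/-- Expansion of a vector of the plane of the ellipse. -/
theorem Elliptic.expansion (h : σ.Elliptic z i) {v : Vec3} (hv : v ⬝ᵥ angMom z i = 0) :
    v = (v ⬝ᵥ σ.peri z i) • σ.peri z i + (v ⬝ᵥ σ.periOrth z i) • σ.periOrth z i := by
  have h1 := len_ne_zero h.2.2.1
  have hC : σ.peri z i ⨯₃ σ.periOrth z i = (len (angMom z i))⁻¹ • angMom z i := by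
    conv_rhs => rw [← congrArg ((len (angMom z i))⁻¹ • ·) h.peri_cross_periOrth]
    simp only [smul_smul]
    rw [inv_mul_cancel₀ h1, one_smul]
  -- The two sides are compared through their product with `P` and their cross product with `P`; the
  -- latter, being along `C`, is compared through its products with `C`.
  refine eq_of_dot_cross h.peri_ne_zero ?_ (eq_of_dot_cross h.2.2.1 ?_ ?_)
  · rw [add_dotProduct, smul_dotProduct, smul_dotProduct, h.peri_dot_self,
      dotProduct_comm (σ.periOrth z i), peri_dot_periOrth]
    simp
  · rw [map_add, cross_smul_right, cross_self, cross_smul_right, hC, smul_zero, zero_add,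
      dotProduct_comm, triple_rotate, triple_rotate, angMom_cross_peri h, dotProduct_smul,
      smul_dotProduct, smul_dotProduct, ← len_sq]
    simp only [smul_eq_mul]
    field_simp
  · rw [map_add, cross_smul_right, cross_self, cross_smul_right, hC, smul_zero, zero_add,
      cross_cross_right, dotProduct_comm _ v, hv, dotProduct_comm _ (σ.peri z i), peri_dot_angMom]
    simp

theorem Elliptic.re_eccNum (h : σ.Elliptic z i) :
    z.2 i ⬝ᵥ σ.peri z i = σ.semiMajor z i * ((σ.eccNum z i).re - σ.ecc z i) := by
  have := h.semiMajor_pos.ne'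
  simp only [eccNum]
  field_simp
  ring

theorem Elliptic.im_eccNum (h : σ.Elliptic z i) :
    z.2 i ⬝ᵥ σ.periOrth z i =
      σ.semiMajor z i * √(1 - σ.ecc z i ^ 2) * (σ.eccNum z i).im := by
  have := h.semiMajor_pos.ne'
  have := h.sqrt_pos.ne'
  simp only [eccNum]
  field_simp

/-- The distance from the focus in terms of the eccentric anomaly. -/
theorem Elliptic.len_pos_eq_eccNum (h : σ.Elliptic z i) :
    len (z.2 i) = σ.semiMajor z i * (1 - σ.ecc z i * (σ.eccNum z i).re) := by
  rw [h.len_pos_eq, h.re_eccNum]; ring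

/-- Comparing the polar equation with `|x|² = (x · P)² + (x · Q)²`, where `Q` is the unit vector
orthogonal to `P` in the orbital plane, gives `a² (1 - e²) (re² + im² - 1) = 0`. This is what allows
real and imaginary part to be replaced by `cos u` and `sin u`. -/
theorem Elliptic.norm_eccNum (h : σ.Elliptic z i) : ‖σ.eccNum z i‖ = 1 := by
  have ha := h.semiMajor_pos.ne'
  have hs := h.sqrt_pos.ne'
  have h1 := len_sq (z.2 i)
  have h2 : z.2 i ⬝ᵥ z.2 i = (z.2 i ⬝ᵥ σ.peri z i) ^ 2 + (z.2 i ⬝ᵥ σ.periOrth z i) ^ 2 := by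
    conv_lhs => rw [h.expansion (angMom_dot_pos z i)]
    rw [add_dotProduct, dotProduct_add, dotProduct_add]
    simp only [smul_dotProduct, dotProduct_smul, h.peri_dot_self, h.periOrth_dot_self,
      peri_dot_periOrth, dotProduct_comm (σ.periOrth z i) (σ.peri z i), smul_eq_mul]
    ring
  rw [h2, h.len_pos_eq_eccNum, h.re_eccNum, h.im_eccNum] at h1
  have hss := h.sqrt_sq
  have h3 : (σ.semiMajor z i ^ 2 * (1 - σ.ecc z i ^ 2)) *
      ((σ.eccNum z i).re ^ 2 + (σ.eccNum z i).im ^ 2 - 1) = 0 := by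
    rw [mul_pow, mul_pow, mul_pow, mul_pow, hss] at h1
    linear_combination -h1
  have h4 : 1 - σ.ecc z i ^ 2 ≠ 0 := by linarith [h.ecc_sq_lt_one]
  have h5 := (mul_eq_zero.1 h3).resolve_left (mul_ne_zero (pow_ne_zero 2 ha) h4)
  rw [← sq_eq_sq₀ (norm_nonneg _) zero_le_one, ← Complex.normSq_eq_norm_sq, Complex.normSq_apply]
  linarith

theorem Elliptic.eccNum_ne_zero (h : σ.Elliptic z i) : σ.eccNum z i ≠ 0 := by
  rw [← norm_ne_zero_iff, h.norm_eccNum]; exact one_ne_zero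

/-- Any real lift `u` of the anomaly is allowed: the principal argument jumps at `π`, while the
differential computations need a smooth `u`. -/
theorem Elliptic.cos_eccNum (h : σ.Elliptic z i) {u : ℝ}
    (hu : (u : Real.Angle) = (Complex.arg (σ.eccNum z i) : ℝ)) :
    (σ.eccNum z i).re = Real.cos u := by
  rw [← cos_of_coe_eq_arg h.eccNum_ne_zero hu, h.norm_eccNum, one_mul]

theorem Elliptic.sin_eccNum (h : σ.Elliptic z i) {u : ℝ}
    (hu : (u : Real.Angle) = (Complex.arg (σ.eccNum z i) : ℝ)) :
    (σ.eccNum z i).im = Real.sin u := by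
  rw [← sin_of_coe_eq_arg hu, h.norm_eccNum, one_mul]

/-- The position in terms of the eccentric anomaly. -/
theorem Elliptic.position_eq (h : σ.Elliptic z i) {u : ℝ}
    (hu : (u : Real.Angle) = (Complex.arg (σ.eccNum z i) : ℝ)) :
    z.2 i = (σ.semiMajor z i * (Real.cos u - σ.ecc z i)) • σ.peri z i +
      (σ.semiMajor z i * √(1 - σ.ecc z i ^ 2) * Real.sin u) • σ.periOrth z i := by
  conv_lhs => rw [h.expansion (angMom_dot_pos z i)]
  rw [h.re_eccNum, h.im_eccNum, h.cos_eccNum hu, h.sin_eccNum hu]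

/-- The momentum as a function of the position, the angular momentum and the eccentricity. -/
theorem momentum_eq (σ : PlanetarySystem N) (z : Phase (N + 1)) (i : Fin (N + 1)) :
    (angMom z i ⬝ᵥ angMom z i) • z.1 i = (σ.redMass i ^ 2 * σ.totMass i) •
      (angMom z i ⨯₃ (σ.eccVec z i + (len (z.2 i))⁻¹ • z.2 i)) := by
  have hm := (σ.redMass_pos i).ne'
  have hM := (σ.totMass_pos i).ne'
  -- Adding `x / |x|` back leaves a multiple of `y × C`, and `C × (y × C) = |C|² y` because `y ⊥ C`.
  rw [eccVec, sub_add_cancel, cross_smul_right, smul_smul, mul_inv_cancel₀ (by positivity),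
    one_smul, cross_cross_right, dotProduct_comm (angMom z i) (z.1 i), angMom_dot_mom]
  simp

theorem Elliptic.mom_dot_peri (h : σ.Elliptic z i) :
    len (z.2 i) * len (angMom z i) * (z.1 i ⬝ᵥ σ.peri z i) =
      -(σ.redMass i ^ 2 * σ.totMass i) * (z.2 i ⬝ᵥ σ.periOrth z i) := by
  have hr := len_ne_zero h.1
  have hc := len_ne_zero h.2.2.1
  have e := congrArg (· ⬝ᵥ σ.peri z i) (momentum_eq σ z i)
  have e1 : (angMom z i ⨯₃ z.2 i) ⬝ᵥ σ.peri z i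
      = - (len (angMom z i) * (z.2 i ⬝ᵥ σ.periOrth z i)) := by
    rw [dotProduct_comm, triple_rotate, triple_rotate, ← cross_anticomm, angMom_cross_peri h]
    simp
  simp only [smul_dotProduct, map_add, cross_smul_right, h.eccVec_eq, add_dotProduct, e1,
    cross_dot_self_right, smul_eq_mul, ← len_sq] at e
  field_simp at e
  have : len (angMom z i) * (len (z.2 i) * len (angMom z i) * (z.1 i ⬝ᵥ σ.peri z i)) =
      len (angMom z i) * (-(σ.redMass i ^ 2 * σ.totMass i) * (z.2 i ⬝ᵥ σ.periOrth z i)) := by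
    linear_combination e
  exact mul_left_cancel₀ hc this

theorem Elliptic.mom_dot_periOrth (h : σ.Elliptic z i) :
    len (z.2 i) * len (angMom z i) * (z.1 i ⬝ᵥ σ.periOrth z i) =
      (σ.redMass i ^ 2 * σ.totMass i) *
        (σ.ecc z i * len (z.2 i) + (z.2 i ⬝ᵥ σ.peri z i)) := by
  have hr := len_ne_zero h.1
  have hc := len_ne_zero h.2.2.1
  have e := congrArg (· ⬝ᵥ σ.periOrth z i) (momentum_eq σ z i)
  have e1 : (angMom z i ⨯₃ z.2 i) ⬝ᵥ σ.periOrth z i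
      = len (angMom z i) * (z.2 i ⬝ᵥ σ.peri z i) := by
    rw [dotProduct_comm, triple_rotate, triple_rotate, ← cross_anticomm, angMom_cross_periOrth h]
    simp
  have e2 : (angMom z i ⨯₃ σ.peri z i) ⬝ᵥ σ.periOrth z i = len (angMom z i) := by
    rw [angMom_cross_peri h, smul_dotProduct, h.periOrth_dot_self]; simp
  simp only [smul_dotProduct, map_add, cross_smul_right, h.eccVec_eq, add_dotProduct, e1, e2,
    smul_eq_mul, ← len_sq] at e
  field_simp at e
  linear_combination e

/-- The area is defined with the principal value, but `e sin u` depends only on `u` mod `2π`, so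
every lift gives the same angle. -/
theorem Elliptic.meanAnomaly_eq (h : σ.Elliptic z i) {u : ℝ}
    (hu : (u : Real.Angle) = (Complex.arg (σ.eccNum z i) : ℝ)) :
    σ.meanAnomaly z i = ((u - σ.ecc z i * Real.sin u : ℝ) : Real.Angle) := by
  rw [meanAnomaly, two_pi_mul_sweptArea_div h.semiMajor_pos h.ecc_sq_lt_one, eccAnomaly_eq,
    ← h.sin_eccNum rfl, ← h.sin_eccNum hu]
  rw [Real.Angle.coe_sub, Real.Angle.coe_sub, hu]

/-- Position and momentum are determined by `C`, `P`, `Λ` and the mean anomaly. -/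
theorem Elliptic.eq_of_elements {z' : Phase (N + 1)} (h : σ.Elliptic z i) (h' : σ.Elliptic z' i)
    (hC : angMom z i = angMom z' i) (hP : σ.peri z i = σ.peri z' i)
    (hL : σ.Lam z i = σ.Lam z' i) (hl : σ.meanAnomaly z i = σ.meanAnomaly z' i) :
    z.1 i = z'.1 i ∧ z.2 i = z'.2 i := by
  have hm := (σ.redMass_pos i).ne'
  have hM := (σ.totMass_pos i).ne'
  -- `Λ` determines `a`; then `|C|² = 𝔪² 𝔐 a (1 - e²)` determines `e`.
  have ha : σ.semiMajor z i = σ.semiMajor z' i := by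
    have := h.lam_sq
    rw [hL, h'.lam_sq] at this
    exact (mul_left_cancel₀ (by positivity) this).symm
  have he : σ.ecc z i = σ.ecc z' i := by
    have h1 := h.angMom_dot_self
    rw [hC, h'.angMom_dot_self, ha] at h1
    have ha' := h'.semiMajor_pos.ne'
    have := mul_left_cancel₀ (by positivity) h1
    rw [← sq_eq_sq₀ h.ecc_pos.le h'.ecc_pos.le]
    linarith
  have hQ : σ.periOrth z i = σ.periOrth z' i := by rw [periOrth, hC, hP, periOrth]
  rw [h.meanAnomaly_eq rfl, h'.meanAnomaly_eq rfl, he] at hl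
  obtain ⟨h1, h2⟩ := cos_sin_eq_of_kepler h'.ecc_pos.le h'.ecc_lt_one hl
  have hx : z.2 i = z'.2 i := by
    rw [h.position_eq rfl, h'.position_eq rfl, ha, he, hP, hQ, h1, h2]
  refine ⟨?_, hx⟩
  have h3 := (momentum_eq σ z i)
  rw [hC, h.eccVec_eq, he, hP, ← h'.eccVec_eq, hx, ← momentum_eq σ z' i] at h3
  exact smul_right_injective _ (dot_self_pos h'.2.2.1).ne' h3

/-- The Keplerian energy in terms of `Λ`. -/
theorem Elliptic.twoBody_eq (h : σ.Elliptic z i) :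
    σ.twoBody i z = - (σ.redMass i ^ 3 * σ.totMass i ^ 2 / (2 * σ.Lam z i ^ 2)) := by
  have hm := (σ.redMass_pos i).ne'
  have hM := (σ.totMass_pos i).ne'
  have hh := h.2.1.ne
  rw [h.lam_sq, semiMajor]
  field_simp

end Kepler

end PlanetarySystem
end Planetary

namespace Planetary

theorem fin_cases_castSucc_or_last {N : ℕ} (j : Fin (N + 1)) :
    (∃ i : Fin N, j = i.castSucc) ∨ j = Fin.last N := by
  rcases Fin.eq_castSucc_or_eq_last j with h | h
  · exact Or.inl h
  · exact Or.inr h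

namespace PlanetarySystem

variable {N : ℕ} {σ : PlanetarySystem N} {z z' : Phase (N + 1)}

/-! ### Recursions for the partial sums and the nodes. -/

theorem partialSum_castSucc (z : Phase (N + 1)) (i : Fin N) :
    partialSum z i.castSucc = angMom z i.castSucc + partialSum z i.succ := by
  have h : Finset.Ici i.castSucc = insert i.castSucc (Finset.Ici i.succ) := by
    ext j
    simp only [Finset.mem_Ici, Finset.mem_insert, Fin.le_def, Fin.ext_iff, Fin.val_castSucc,
      Fin.val_succ]
    omega
  rw [partialSum, h, Finset.sum_insert, ← partialSum]
  simp [Fin.le_def]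

theorem partialSum_last (z : Phase (N + 1)) :
    partialSum z (Fin.last N) = angMom z (Fin.last N) := by
  have h : Finset.Ici (Fin.last N) = {Fin.last N} := by
    ext j; simp [Fin.last_le_iff]
  rw [partialSum, h, Finset.sum_singleton]

theorem nodeNu_zero (σ : PlanetarySystem N) (z : Phase (N + 1)) :
    σ.nodeNu z 0 = ![0, 0, 1] ⨯₃ partialSum z 0 := rfl

theorem nodeNu_succ (σ : PlanetarySystem N) (z : Phase (N + 1)) (i : Fin N) :
    σ.nodeNu z i.succ = σ.peri z i.castSucc ⨯₃ partialSum z i.succ := rfl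

theorem nodeN_last (σ : PlanetarySystem N) (z : Phase (N + 1)) :
    σ.nodeN z (Fin.last N) = σ.peri z (Fin.last N) := if_pos rfl

theorem nodeN_castSucc (σ : PlanetarySystem N) (z : Phase (N + 1)) (i : Fin N) :
    σ.nodeN z i.castSucc = partialSum z i.castSucc ⨯₃ σ.peri z i.castSucc :=
  if_neg (Fin.castSucc_lt_last i).ne

theorem Theta_zero (σ : PlanetarySystem N) (z : Phase (N + 1)) :
    σ.Theta z 0 = partialSum z 0 ⬝ᵥ ![0, 0, 1] := rfl

theorem Theta_succ (σ : PlanetarySystem N) (z : Phase (N + 1)) (i : Fin N) :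
    σ.Theta z i.succ = partialSum z i.succ ⬝ᵥ σ.peri z i.castSucc := rfl

/-- Two consecutive partial sums differ by an angular momentum orthogonal to the perihelion, so the
same `Θ` also measures the perihelion against its own partial sum. -/
theorem Theta_succ' (σ : PlanetarySystem N) (z : Phase (N + 1)) (i : Fin N) :
    σ.Theta z i.succ = partialSum z i.castSucc ⬝ᵥ σ.peri z i.castSucc := by
  rw [Theta_succ, partialSum_castSucc, add_dotProduct, dotProduct_comm (angMom z _),
    peri_dot_angMom, zero_add]

theorem vartheta_zero (σ : PlanetarySystem N) (z : Phase (N + 1)) :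
    σ.vartheta z 0 = orientedAngle ![0, 0, 1] ![1, 0, 0] (σ.nodeNu z 0) := rfl

theorem vartheta_succ (σ : PlanetarySystem N) (z : Phase (N + 1)) (i : Fin N) :
    σ.vartheta z i.succ = orientedAngle (σ.peri z i.castSucc) (σ.nodeN z i.castSucc)
      (σ.nodeNu z i.succ) := rfl

theorem nodeNu_dot_partialSum (σ : PlanetarySystem N) (z : Phase (N + 1)) (j : Fin (N + 1)) :
    σ.nodeNu z j ⬝ᵥ partialSum z j = 0 := by
  refine Fin.cases ?_ (fun i => ?_) j
  · exact cross_dot_self_right _ _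
  · exact cross_dot_self_right _ _

theorem nodeN_dot_partialSum (σ : PlanetarySystem N) (z : Phase (N + 1)) (j : Fin (N + 1)) :
    σ.nodeN z j ⬝ᵥ partialSum z j = 0 := by
  rcases fin_cases_castSucc_or_last j with ⟨i, rfl⟩ | rfl
  · rw [nodeN_castSucc]; exact cross_dot_self_left _ _
  · rw [nodeN_last, partialSum_last, peri_dot_angMom]

theorem nodeNu_succ_dot_peri (σ : PlanetarySystem N) (z : Phase (N + 1)) (i : Fin N) :
    σ.nodeNu z i.succ ⬝ᵥ σ.peri z i.castSucc = 0 := cross_dot_self_left _ _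

theorem nodeN_castSucc_dot_peri (σ : PlanetarySystem N) (z : Phase (N + 1)) (i : Fin N) :
    σ.nodeN z i.castSucc ⬝ᵥ σ.peri z i.castSucc = 0 := by
  rw [nodeN_castSucc]; exact cross_dot_self_right _ _

/-- The open conditions on the internal configuration of the system: `domain` without the
condition on the node in the horizontal plane. -/
structure Regular (σ : PlanetarySystem N) (z : Phase (N + 1)) : Prop where
  elliptic : ∀ i, σ.Elliptic z i
  nodeN_ne_zero : ∀ j, σ.nodeN z j ≠ 0
  nodeNu_ne_zero : ∀ j : Fin N, σ.nodeNu z j.succ ≠ 0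

theorem mem_domain_iff :
    z ∈ σ.domain ↔ σ.Regular z ∧ σ.nodeNu z 0 ≠ 0 := by
  constructor
  · rintro ⟨h1, h2⟩
    exact ⟨⟨h1, fun j => (h2 j).2, fun j => (h2 j.succ).1⟩, (h2 0).1⟩
  · rintro ⟨⟨h1, h2, h3⟩, h4⟩
    exact ⟨h1, fun j => ⟨Fin.cases h4 h3 j, h2 j⟩⟩

theorem Regular.partialSum_ne_zero (h : σ.Regular z) (j : Fin (N + 1)) : partialSum z j ≠ 0 := by
  rcases fin_cases_castSucc_or_last j with ⟨i, rfl⟩ | rfl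
  · have := h.nodeN_ne_zero i.castSucc
    rw [nodeN_castSucc] at this
    exact (ne_zero_of_cross this).1
  · rw [partialSum_last]; exact (h.elliptic _).2.2.1

/-! ### The coordinates determine the configuration -/

/-- The unit vector `P` is found from its projection `Θ` on `S` and from the angle `κ` of `S × P`.
For the last planet `P ⊥ S`, and `κ` is the angle of `P` itself. -/
theorem peri_eq_of_kappa_eq (h : σ.Regular z) (h' : σ.Regular z') (j : Fin (N + 1))
    (hS : partialSum z j = partialSum z' j) (hν : σ.nodeNu z j = σ.nodeNu z' j)
    (hν0 : σ.nodeNu z j ≠ 0) (hκ : σ.kappa z j = σ.kappa z' j)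
    (hΘ : ∀ i : Fin N, σ.Theta z i.succ = σ.Theta z' i.succ) : σ.peri z j = σ.peri z' j := by
  have hP := (h.elliptic j).peri_dot_self
  have hP' := (h'.elliptic j).peri_dot_self
  rw [kappa, kappa, ← hS, ← hν] at hκ
  have hd := σ.nodeNu_dot_partialSum z j
  have hS0 := h.partialSum_ne_zero j
  rcases fin_cases_castSucc_or_last j with ⟨i, rfl⟩ | rfl
  · have hT := hΘ i
    rw [Theta_succ', Theta_succ', ← hS, dotProduct_comm, dotProduct_comm _ (σ.peri z' _)] at hT
    rw [nodeN_castSucc, nodeN_castSucc, ← hS] at hκ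
    exact eq_of_orientedAngle_cross_eq hS0 hν0 hd hT (hP.trans hP'.symm) hκ
  · have e1 := σ.nodeN_dot_partialSum z (Fin.last N)
    have e2 := σ.nodeN_dot_partialSum z' (Fin.last N)
    rw [nodeN_last] at e1 e2
    rw [← hS] at e2
    rw [nodeN_last, nodeN_last] at hκ
    exact eq_of_orientedAngle_eq hS0 hν0 hd e1 e2 (hP.trans hP'.symm) hκ

theorem angMom_eq_of_partialSum_eq (hS : ∀ j, partialSum z j = partialSum z' j)
    (j : Fin (N + 1)) : angMom z j = angMom z' j := by
  rcases fin_cases_castSucc_or_last j with ⟨i, rfl⟩ | rfl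
  · have h1 := hS i.castSucc
    rw [partialSum_castSucc, partialSum_castSucc, hS i.succ] at h1
    exact add_right_cancel h1
  · rw [← partialSum_last, hS, partialSum_last]

/-- Equality of all the coordinates that are invariant under rotations. -/
structure SameShape (σ : PlanetarySystem N) (z z' : Phase (N + 1)) : Prop where
  lam : σ.Lam z = σ.Lam z'
  mean : σ.meanAnomaly z = σ.meanAnomaly z'
  chi : chi z = chi z'
  theta : ∀ i : Fin N, σ.Theta z i.succ = σ.Theta z' i.succ
  kappa : ∀ i : Fin N, σ.kappa z i.succ = σ.kappa z' i.succ
  vartheta : ∀ i : Fin N, σ.vartheta z i.succ = σ.vartheta z' i.succ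

/-- Once the first partial sum and perihelion agree, the rest of the chain follows: `χ, Θ, ϑ` give
the next partial sum from the previous perihelion, and `κ` with the following `Θ` gives the next
perihelion. -/
theorem SameShape.eq (hs : σ.SameShape z z') (h : σ.Regular z) (h' : σ.Regular z')
    (hS0 : partialSum z 0 = partialSum z' 0) (hP0 : σ.peri z 0 = σ.peri z' 0) : z = z' := by
  have key : ∀ j, partialSum z j = partialSum z' j ∧ σ.peri z j = σ.peri z' j := by
    intro j
    induction j using Fin.induction with
    | zero => exact ⟨hS0, hP0⟩
    | succ i ih =>
      obtain ⟨ih1, ih2⟩ := ih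
      have hT := hs.theta i
      rw [Theta_succ, Theta_succ, ← ih2] at hT
      have hc : partialSum z i.succ ⬝ᵥ partialSum z i.succ
          = partialSum z' i.succ ⬝ᵥ partialSum z' i.succ :=
        dot_eq_of_len_eq (congrFun hs.chi i.succ)
      have hv := hs.vartheta i
      have hn : σ.nodeN z' i.castSucc = σ.nodeN z i.castSucc := by
        rw [nodeN_castSucc, nodeN_castSucc, ih1, ih2]
      rw [vartheta_succ, vartheta_succ, hn, ← ih2, nodeNu_succ, nodeNu_succ, ← ih2] at hv
      have hS : partialSum z i.succ = partialSum z' i.succ :=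
        eq_of_orientedAngle_cross_eq (h.elliptic i.castSucc).peri_ne_zero
          (h.nodeN_ne_zero i.castSucc) (σ.nodeN_castSucc_dot_peri z i) hT hc hv
      refine ⟨hS, peri_eq_of_kappa_eq h h' i.succ hS ?_ (h.nodeNu_ne_zero i) (hs.kappa i) hs.theta⟩
      rw [nodeNu_succ, nodeNu_succ, ih2, hS]
  have hC := angMom_eq_of_partialSum_eq fun j => (key j).1
  have hj : ∀ j, z.1 j = z'.1 j ∧ z.2 j = z'.2 j := fun j =>
    (h.elliptic j).eq_of_elements (h'.elliptic j) (hC j) (key j).2 (congrFun hs.lam j)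
      (congrFun hs.mean j)
  exact Prod.ext (funext fun j => (hj j).1) (funext fun j => (hj j).2)

theorem pStar_eq_iff : σ.pStar z = σ.pStar z' ↔
    σ.SameShape z z' ∧ σ.Theta z 0 = σ.Theta z' 0 ∧ σ.kappa z 0 = σ.kappa z' 0 ∧
      σ.vartheta z 0 = σ.vartheta z' 0 := by
  constructor
  · intro h
    have h1 := congrArg Prod.fst h
    have h2 := congrArg Prod.snd h
    have a0 : σ.Lam z = σ.Lam z' := congrFun h1 0
    have a1 : chi z = chi z' := congrFun h1 1
    have a2 : σ.Theta z = σ.Theta z' := congrFun h1 2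
    have b0 : σ.meanAnomaly z = σ.meanAnomaly z' := congrFun h2 0
    have b1 : σ.kappa z = σ.kappa z' := congrFun h2 1
    have b2 : σ.vartheta z = σ.vartheta z' := congrFun h2 2
    exact ⟨⟨a0, b0, a1, fun i => congrFun a2 _, fun i => congrFun b1 _, fun i => congrFun b2 _⟩,
      congrFun a2 _, congrFun b1 _, congrFun b2 _⟩
  · rintro ⟨⟨a0, b0, a1, a2, b1, b2⟩, c1, c2, c3⟩
    have a2' : σ.Theta z = σ.Theta z' := funext fun j => Fin.cases c1 a2 j
    have b1' : σ.kappa z = σ.kappa z' := funext fun j => Fin.cases c2 b1 j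
    have b2' : σ.vartheta z = σ.vartheta z' := funext fun j => Fin.cases c3 b2 j
    rw [pStar, pStar, a0, a1, a2', b0, b1', b2']

/-- The coordinates `χ₀, Θ₀, ϑ₀` place the total angular momentum in the fixed frame and `κ₀` places
the first perihelion; this starts the chain. -/
theorem pStar_injOn (σ : PlanetarySystem N) : Set.InjOn σ.pStar σ.domain := by
  intro z hz z' hz' h
  obtain ⟨hr, hν⟩ := mem_domain_iff.1 hz
  obtain ⟨hr', -⟩ := mem_domain_iff.1 hz'
  obtain ⟨hs, hT, hk, hv⟩ := pStar_eq_iff.1 h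
  have hS : partialSum z 0 = partialSum z' 0 :=
    eq_of_orientedAngle_cross_eq (w := ![0, 0, 1]) (u := ![1, 0, 0])
      (fun h => by simpa using congrFun h 2) (fun h => by simpa using congrFun h 0)
      (by simp) hT (dot_eq_of_len_eq (congrFun hs.chi 0)) hv
  exact hs.eq hr hr' hS
    (peri_eq_of_kappa_eq hr hr' 0 hS (by rw [nodeNu_zero, nodeNu_zero, hS]) hν hk hs.theta)

/-! ### Action of the isometries -/

/-- The action of a linear map of `ℝ³` on the phase space. -/
def act (R : Vec3 →ₗ[ℝ] Vec3) (z : Phase (N + 1)) : Phase (N + 1) :=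
  (fun i => R (z.1 i), fun i => R (z.2 i))

section Act

variable {ε : ℝ} {R : Vec3 →ₗ[ℝ] Vec3} (hR : IsOrthogonal ε R)
include hR

/-- Angular momentum is a pseudo-vector, hence the sign. In the Laplace vector and in the nodes of
positive index the sign occurs twice or not at all. -/
theorem angMom_act (z : Phase (N + 1)) (i : Fin (N + 1)) :
    angMom (act R z) i = ε • R (angMom z i) := hR.cross _ _

theorem twoBody_act (z : Phase (N + 1)) (i : Fin (N + 1)) :
    σ.twoBody i (act R z) = σ.twoBody i z := by
  simp only [twoBody, act, hR.dot, hR.len]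

theorem semiMajor_act (z : Phase (N + 1)) : σ.semiMajor (act R z) = σ.semiMajor z := by
  funext i; rw [semiMajor, semiMajor, twoBody_act hR]

theorem eccVec_act (z : Phase (N + 1)) (i : Fin (N + 1)) :
    σ.eccVec (act R z) i = R (σ.eccVec z i) := by
  rw [eccVec, angMom_act hR, cross_smul_right]
  simp only [act, hR.cross, hR.len, smul_smul, hR.sign, one_smul, eccVec, map_sub, map_smul]

theorem ecc_act (z : Phase (N + 1)) : σ.ecc (act R z) = σ.ecc z := by
  funext i; rw [ecc, eccVec_act hR, hR.len, ecc]

theorem peri_act (z : Phase (N + 1)) (i : Fin (N + 1)) :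
    σ.peri (act R z) i = R (σ.peri z i) := by
  rw [peri, eccVec_act hR, ecc_act hR, peri, map_smul]

theorem Elliptic.map_act {i : Fin (N + 1)} (h : σ.Elliptic z i) : σ.Elliptic (act R z) i := by
  refine ⟨?_, ?_, ?_, ?_⟩
  · exact fun h0 => h.1 (hR.eq_zero_iff.1 h0)
  · rw [twoBody_act hR]; exact h.2.1
  · rw [ne_eq, ← dot_self_eq_zero, angMom_act hR, smul_dotProduct, dotProduct_smul, smul_smul,
      hR.sign, one_smul, hR.dot, dot_self_eq_zero]
    exact h.2.2.1
  · rw [eccVec_act hR]; exact fun h0 => h.2.2.2 (hR.eq_zero_iff.1 h0)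

theorem eccNum_act (z : Phase (N + 1)) (i : Fin (N + 1)) :
    σ.eccNum (act R z) i = σ.eccNum z i := by
  have h1 : σ.periOrth (act R z) i = R (σ.periOrth z i) := by
    rw [periOrth, angMom_act hR, peri_act hR, len_smul_sign hR.sign, hR.len, cross_smul_left,
      hR.cross, smul_smul ε, hR.sign, one_smul, periOrth, map_smul]
  simp only [eccNum, peri_act hR, h1, semiMajor_act hR, ecc_act hR]
  simp only [act, hR.dot]

theorem meanAnomaly_act (z : Phase (N + 1)) : σ.meanAnomaly (act R z) = σ.meanAnomaly z := by
  funext i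
  rw [meanAnomaly, eccAnomaly_eq, semiMajor_act hR, ecc_act hR, eccNum_act hR, ← eccAnomaly_eq,
    meanAnomaly]

theorem Lam_act (z : Phase (N + 1)) : σ.Lam (act R z) = σ.Lam z := by
  funext i; rw [Lam, semiMajor_act hR, Lam]

theorem partialSum_act (z : Phase (N + 1)) (j : Fin (N + 1)) :
    partialSum (act R z) j = ε • R (partialSum z j) := by
  simp only [partialSum, angMom_act hR, map_sum, Finset.smul_sum]

theorem chi_act (z : Phase (N + 1)) : chi (act R z) = chi z := by
  funext j; rw [chi, partialSum_act hR, len_smul_sign hR.sign, hR.len, chi]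

theorem nodeN_act (z : Phase (N + 1)) (j : Fin (N + 1)) :
    σ.nodeN (act R z) j = R (σ.nodeN z j) := by
  rcases fin_cases_castSucc_or_last j with ⟨i, rfl⟩ | rfl
  · rw [nodeN_castSucc, nodeN_castSucc, partialSum_act hR, peri_act hR, cross_smul_left, hR.cross,
      smul_smul, hR.sign, one_smul]
  · rw [nodeN_last, nodeN_last, peri_act hR]

theorem nodeNu_succ_act (z : Phase (N + 1)) (i : Fin N) :
    σ.nodeNu (act R z) i.succ = R (σ.nodeNu z i.succ) := by
  rw [nodeNu_succ, nodeNu_succ, partialSum_act hR, peri_act hR, cross_smul_right, hR.cross,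
    smul_smul, hR.sign, one_smul]

theorem Regular.map_act (h : σ.Regular z) : σ.Regular (act R z) where
  elliptic i := (h.elliptic i).map_act hR
  nodeN_ne_zero j := by
    rw [nodeN_act hR]; exact fun h0 => h.nodeN_ne_zero j (hR.eq_zero_iff.1 h0)
  nodeNu_ne_zero j := by
    rw [nodeNu_succ_act hR]; exact fun h0 => h.nodeNu_ne_zero j (hR.eq_zero_iff.1 h0)

theorem Theta_succ_act (z : Phase (N + 1)) (i : Fin N) :
    σ.Theta (act R z) i.succ = ε * σ.Theta z i.succ := by
  rw [Theta_succ, Theta_succ, partialSum_act hR, peri_act hR, smul_dotProduct, hR.dot, smul_eq_mul]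

theorem kappa_succ_act (z : Phase (N + 1)) (i : Fin N) :
    σ.kappa (act R z) i.succ = σ.kappa z i.succ := by
  rw [kappa, partialSum_act hR, nodeNu_succ_act hR, nodeN_act hR, hR.orientedAngle_smul, kappa]

theorem fHel_act (z : Phase (N + 1)) : σ.fHel (act R z) = σ.fHel z := by
  simp only [fHel, act, ← map_sub, hR.dot, hR.len]

end Act

theorem SameShape.act_left {R : Vec3 →ₗ[ℝ] Vec3} (hR : IsOrthogonal 1 R) (hs : σ.SameShape z z') :
    σ.SameShape (act R z) z' where
  lam := by rw [Lam_act hR, hs.lam]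
  mean := by rw [meanAnomaly_act hR, hs.mean]
  chi := by rw [chi_act hR, hs.chi]
  theta i := by rw [Theta_succ_act hR, one_mul, hs.theta]
  kappa i := by rw [kappa_succ_act hR, hs.kappa]
  vartheta i := by
    rw [vartheta_succ, nodeNu_succ_act hR, nodeN_act hR, peri_act hR, hR.orientedAngle_one,
      ← hs.vartheta, vartheta_succ]

/-- Two configurations with the same rotation-invariant coordinates differ by a rotation. -/
theorem SameShape.exists_rotation (hs : σ.SameShape z z') (h : σ.Regular z) (h' : σ.Regular z') :
    ∃ R, IsOrthogonal 1 R ∧ act R z = z' := by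
  have hP := (h.elliptic 0).peri_dot_self
  have hP' := (h'.elliptic 0).peri_dot_self
  have hSS : partialSum z' 0 ⬝ᵥ partialSum z' 0 = partialSum z 0 ⬝ᵥ partialSum z 0 :=
    dot_eq_of_len_eq (congrFun hs.chi 0).symm
  -- With at least two planets this product is the first `Θ` of positive index; with a single planet
  -- it is zero.
  have hSP : partialSum z' 0 ⬝ᵥ σ.peri z' 0 = partialSum z 0 ⬝ᵥ σ.peri z 0 := by
    rcases fin_cases_castSucc_or_last (0 : Fin (N + 1)) with ⟨i, hi⟩ | hi
    · rw [hi, ← Theta_succ', ← Theta_succ', hs.theta]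
    · rw [hi, partialSum_last, partialSum_last, dotProduct_comm, peri_dot_angMom, dotProduct_comm,
        peri_dot_angMom]
  -- Independence of the two vectors is non-vanishing of the first node `ñ`; with a single planet it
  -- is automatic, since `C ⊥ P`.
  have hn : partialSum z 0 ⨯₃ σ.peri z 0 ≠ 0 := by
    rcases fin_cases_castSucc_or_last (0 : Fin (N + 1)) with ⟨i, hi⟩ | hi
    · rw [hi, ← nodeN_castSucc]; exact h.nodeN_ne_zero _
    · rw [hi, partialSum_last, angMom_cross_peri (h.elliptic _)]
      intro h0
      have := congrArg (· ⬝ᵥ σ.periOrth z (Fin.last N)) h0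
      simp only [smul_dotProduct, (h.elliptic _).periOrth_dot_self] at this
      simp [len_ne_zero (h.elliptic (Fin.last N)).2.2.1] at this
  obtain ⟨R, hR, h1, h2⟩ := Planetary.exists_rotation hn hSS hSP (hP'.trans hP.symm)
  refine ⟨R, hR, (hs.act_left hR).eq (h.map_act hR) h' ?_ ?_⟩
  · rw [partialSum_act hR, one_smul, h1]
  · rw [peri_act hR, h2]

theorem SameShape.fHel_eq (hs : σ.SameShape z z') (h : σ.Regular z) (h' : σ.Regular z') :
    σ.fHel z = σ.fHel z' := by
  obtain ⟨R, hR, rfl⟩ := hs.exists_rotation h h'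
  rw [fHel_act hR]

/-! ### The reflection -/

/-- The reflection `(v₁, v₂, v₃) ↦ (v₁, -v₂, v₃)`. -/
def reflVec : Vec3 →ₗ[ℝ] Vec3 where
  toFun v := ![v 0, -v 1, v 2]
  map_add' u v := by apply vec3_ext <;> simp [add_comm]
  map_smul' c v := by apply vec3_ext <;> simp

theorem reflVec_isOrthogonal : IsOrthogonal (-1) reflVec where
  sign := by norm_num
  dot u v := by simp only [dot3]; simp [reflVec]
  cross u v := by
    apply vec3_ext <;> simp [reflVec, cross_apply] <;> ring

theorem reflect_eq_act (z : Phase (N + 1)) : reflect z = act reflVec z := rfl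

theorem nodeNu_zero_reflect (z : Phase (N + 1)) :
    σ.nodeNu (reflect z) 0 = reflVec (σ.nodeNu z 0) := by
  have h : reflVec ![0, 0, 1] = ![0, 0, 1] := by apply vec3_ext <;> simp [reflVec]
  have h1 := reflVec_isOrthogonal.cross ![0, 0, 1] (partialSum z 0)
  rw [h] at h1
  rw [nodeNu_zero, reflect_eq_act, partialSum_act reflVec_isOrthogonal, cross_smul_right, h1,
    nodeNu_zero]
  simp

theorem reflect_mem_domain (hz : z ∈ σ.domain) : reflect z ∈ σ.domain := by
  obtain ⟨h1, h2⟩ := mem_domain_iff.1 hz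
  refine mem_domain_iff.2 ⟨h1.map_act reflVec_isOrthogonal, ?_⟩
  rw [nodeNu_zero_reflect]
  exact fun h0 => h2 (reflVec_isOrthogonal.eq_zero_iff.1 h0)

theorem Theta_reflect (z : Phase (N + 1)) : σ.Theta (reflect z) = - σ.Theta z := by
  funext j
  refine Fin.cases ?_ (fun i => ?_) j
  · rw [reflect_eq_act, Theta_zero, partialSum_act reflVec_isOrthogonal, Pi.neg_apply, Theta_zero]
    simp only [dot3]; simp [reflVec]
  · rw [reflect_eq_act, Theta_succ_act reflVec_isOrthogonal]; simp

theorem kappa_reflect (z : Phase (N + 1)) : σ.kappa (reflect z) = σ.kappa z := by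
  funext j
  refine Fin.cases ?_ (fun i => ?_) j
  · rw [kappa, nodeNu_zero_reflect, reflect_eq_act, partialSum_act reflVec_isOrthogonal,
      nodeN_act reflVec_isOrthogonal, reflVec_isOrthogonal.orientedAngle_smul, kappa]
  · rw [reflect_eq_act, kappa_succ_act reflVec_isOrthogonal]

theorem vartheta_reflect (z : Phase (N + 1)) : σ.vartheta (reflect z) = - σ.vartheta z := by
  funext j
  refine Fin.cases ?_ (fun i => ?_) j
  · have h : reflVec ![0, 0, 1] = ![0, 0, 1] := by apply vec3_ext <;> simp [reflVec]
    have h' : reflVec ![1, 0, 0] = ![1, 0, 0] := by apply vec3_ext <;> simp [reflVec]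
    have h1 := reflVec_isOrthogonal.orientedAngle_neg_one ![0, 0, 1] ![1, 0, 0] (σ.nodeNu z 0)
    rw [h, h'] at h1
    rw [vartheta_zero, nodeNu_zero_reflect, h1, Pi.neg_apply, vartheta_zero]
  · rw [reflect_eq_act, vartheta_succ, nodeNu_succ_act reflVec_isOrthogonal,
      nodeN_act reflVec_isOrthogonal, peri_act reflVec_isOrthogonal,
      reflVec_isOrthogonal.orientedAngle_neg_one, Pi.neg_apply, vartheta_succ]

theorem pStar_reflect (z : Phase (N + 1)) : σ.pStar (reflect z) =
    (![σ.Lam z, chi z, - σ.Theta z], ![σ.meanAnomaly z, σ.kappa z, - σ.vartheta z]) := by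
  rw [pStar, Theta_reflect, kappa_reflect, vartheta_reflect, reflect_eq_act,
    Lam_act reflVec_isOrthogonal, chi_act reflVec_isOrthogonal,
    meanAnomaly_act reflVec_isOrthogonal]

/-! ### Planar configurations -/

/-- Both nodes are multiples of `S × P`, with factors in opposite order. The resulting sign `-c` is
why momenta of the same verse give `ϑ = π` and not `0`. -/
theorem nodes_of_parallel {i : Fin N} {c : ℝ}
    (hS : partialSum z i.succ = c • partialSum z i.castSucc) :
    σ.nodeN z i.castSucc ⨯₃ σ.nodeNu z i.succ = 0 ∧
      σ.nodeNu z i.succ = -c • σ.nodeN z i.castSucc := by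
  have h1 : σ.nodeNu z i.succ = -c • σ.nodeN z i.castSucc := by
    rw [nodeNu_succ, nodeN_castSucc, hS, cross_smul_right, ← cross_anticomm, smul_neg, neg_smul]
  refine ⟨?_, h1⟩
  rw [h1, cross_smul_right, cross_self, smul_zero]

/-- In a planar configuration all angular momenta lie on the normal `ν`, and the perihelia are
orthogonal to it. -/
theorem exists_partialSum_smul (h : σ.Regular z) {ν : Vec3} (hν : ν ≠ 0)
    (hp : ∀ i, z.1 i ⬝ᵥ ν = 0 ∧ z.2 i ⬝ᵥ ν = 0) (i : Fin N) :
    σ.Theta z i.succ = 0 ∧ ∃ c : ℝ, partialSum z i.succ = c • partialSum z i.castSucc := by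
  have hC : ∀ i, ν ⨯₃ angMom z i = 0 := fun i => by
    rw [angMom, cross_cross_right, dotProduct_comm ν, dotProduct_comm ν, (hp i).1, (hp i).2]; simp
  have hS : ∀ j, ν ⨯₃ partialSum z j = 0 := fun j => by
    rw [partialSum, map_sum]; exact Finset.sum_eq_zero fun k _ => hC k
  have hPν : σ.peri z i.castSucc ⬝ᵥ ν = 0 := by
    have h1 := eq_smul_of_cross_eq_zero hν (hC i.castSucc)
    have h2 := σ.peri_dot_angMom z i.castSucc
    have h3 := (h.elliptic i.castSucc).2.2.1
    rw [h1] at h2 h3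
    rw [dotProduct_smul, smul_eq_mul] at h2
    exact (mul_eq_zero.1 h2).resolve_left (left_ne_zero_of_smul h3)
  have h1 := eq_smul_of_cross_eq_zero hν (hS i.castSucc)
  have h2 := eq_smul_of_cross_eq_zero hν (hS i.succ)
  have h3 := h.partialSum_ne_zero i.castSucc
  constructor
  · rw [Theta_succ, h2, smul_dotProduct, dotProduct_comm ν (σ.peri _ _), hPν, smul_zero]
  · set p := (ν ⬝ᵥ partialSum z i.castSucc) / (ν ⬝ᵥ ν)
    set q := (ν ⬝ᵥ partialSum z i.succ) / (ν ⬝ᵥ ν)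
    refine ⟨q / p, ?_⟩
    have hp0 : p ≠ 0 := by rintro h0; rw [h0, zero_smul] at h1; exact h3 h1
    rw [h2, h1, smul_smul, div_mul_cancel₀ _ hp0]

theorem isPlanar_iff (h : σ.Regular z) : IsPlanar z ↔
    ∃ k : Fin N → Fin 2, ∀ j : Fin N, σ.Theta z j.succ = 0 ∧
      σ.vartheta z j.succ = ((Real.pi * ((k j : ℕ) : ℝ) : ℝ) : Real.Angle) := by
  constructor
  · rintro ⟨ν, hν, hp⟩
    have key : ∀ j : Fin N, ∃ k : Fin 2, σ.Theta z j.succ = 0 ∧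
        σ.vartheta z j.succ = ((Real.pi * ((k : ℕ) : ℝ) : ℝ) : Real.Angle) := fun j => by
      obtain ⟨h1, c, h2⟩ := exists_partialSum_smul h hν hp j
      obtain ⟨k, hk⟩ := orientedAngle_eq_coe_pi_mul (w := σ.peri z j.castSucc)
        (nodes_of_parallel h2).1
      exact ⟨k, h1, hk⟩
    choose k hk using key
    exact ⟨k, hk⟩
  · rintro ⟨k, hk⟩
    have hpar : ∀ j, ∃ c : ℝ, partialSum z j = c • partialSum z 0 := by
      intro j
      induction j using Fin.induction with
      | zero => exact ⟨1, by rw [one_smul]⟩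
      | succ i ih =>
        obtain ⟨c, hc⟩ := ih
        obtain ⟨hT, hv⟩ := hk i
        have hP := (h.elliptic i.castSucc).peri_ne_zero
        have ht := triple_eq_zero_of_orientedAngle hP hv
        have hT' := hT
        rw [Theta_succ] at hT
        rw [Theta_succ'] at hT'
        -- Both partial sums are orthogonal to `P` as `Θ = 0`, so their cross product lies along
        -- `P`; its component there is zero because `sin ϑ = 0`.
        have h0 : partialSum z i.castSucc ⨯₃ partialSum z i.succ = 0 := by
          refine eq_of_dot_cross hP ?_ ?_
          · rw [nodeN_castSucc, nodeNu_succ, cross_cross_right, cross_dot_self_right,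
              zero_smul, sub_zero, dotProduct_smul, (h.elliptic _).peri_dot_self] at ht
            rw [zero_dotProduct, dotProduct_comm, triple_rotate, triple_rotate, ← cross_anticomm,
              dotProduct_neg, neg_eq_zero, dotProduct_comm]
            simpa using ht
          · rw [cross_cross_right, dotProduct_comm _ (partialSum z i.succ), hT,
              dotProduct_comm _ (partialSum z i.castSucc), hT']
            simp
        have h1 := eq_smul_of_cross_eq_zero (h.partialSum_ne_zero i.castSucc) h0
        rw [hc, smul_smul] at h1
        exact ⟨_, h1⟩
    -- The total angular momentum is normal to the plane: every `C`, as a difference of partial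
    -- sums, is a non-zero multiple of it.
    refine ⟨partialSum z 0, h.partialSum_ne_zero 0, fun i => ?_⟩
    have hC : ∃ c : ℝ, angMom z i = c • partialSum z 0 := by
      rcases fin_cases_castSucc_or_last i with ⟨j, rfl⟩ | rfl
      · obtain ⟨c, hc⟩ := hpar j.castSucc
        obtain ⟨d, hd⟩ := hpar j.succ
        refine ⟨c - d, ?_⟩
        rw [sub_smul, ← hc, ← hd, partialSum_castSucc, add_sub_cancel_right]
      · rw [← partialSum_last]; exact hpar _
    obtain ⟨c, hc⟩ := hC
    have h1 := angMom_dot_mom z i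
    have h2 := angMom_dot_pos z i
    have h3 := (h.elliptic i).2.2.1
    rw [hc] at h1 h2 h3
    rw [dotProduct_smul, smul_eq_mul] at h1 h2
    have hc0 := left_ne_zero_of_smul h3
    exact ⟨(mul_eq_zero.1 h1).resolve_left hc0, (mul_eq_zero.1 h2).resolve_left hc0⟩

theorem theta_vartheta_of_parallel (h : σ.Regular z)
    (hC : ∀ i j, ∃ c : ℝ, 0 < c ∧ angMom z i = c • angMom z j) (j : Fin N) :
    σ.Theta z j.succ = 0 ∧ σ.vartheta z j.succ = ((Real.pi : ℝ) : Real.Angle) := by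
  have hS : ∀ j, ∃ c : ℝ, 0 < c ∧ partialSum z j = c • angMom z 0 := fun j => by
    choose c hc0 hc using fun i => hC i 0
    refine ⟨∑ k ∈ Finset.Ici j, c k, Finset.sum_pos (fun k _ => hc0 k) ⟨j, by simp⟩, ?_⟩
    rw [partialSum, Finset.sum_smul]
    exact Finset.sum_congr rfl fun k _ => hc k
  obtain ⟨p, hp0, hp⟩ := hS j.castSucc
  obtain ⟨q, hq0, hq⟩ := hS j.succ
  have hT : σ.Theta z j.succ = 0 := by
    obtain ⟨c, hc0, hc⟩ := hC 0 j.castSucc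
    rw [Theta_succ, hq, hc, smul_dotProduct, smul_dotProduct, dotProduct_comm, peri_dot_angMom]
    simp
  have hqp : partialSum z j.succ = (q / p) • partialSum z j.castSucc := by
    rw [hq, hp, smul_smul, div_mul_cancel₀ _ hp0.ne']
  obtain ⟨h1, h2⟩ := nodes_of_parallel hqp
  refine ⟨hT, orientedAngle_eq_pi h1 ?_⟩
  rw [h2, dotProduct_smul, smul_eq_mul]
  exact mul_neg_of_neg_of_pos (neg_neg_of_pos (div_pos hq0 hp0))
    (dot_self_pos (h.nodeN_ne_zero _))

end PlanetarySystem
end Planetary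

namespace Planetary

open Filter Topology

/-! ### Derivatives of curves in `ℝ³` -/

/-- The left side is `w · (f × (f × (a × g)))`, and the double product is `(f · (a × g)) f - |f|² (a
× g)`, whose first term is orthogonal to `w`. It isolates the rotation rate of each vector in
`angle_deriv`. -/
theorem triple_identity {w f : Vec3} (h : f ⬝ᵥ w = 0) (g a : Vec3) :
    (f ⬝ᵥ g) * (w ⬝ᵥ (f ⨯₃ a)) - (w ⬝ᵥ (f ⨯₃ g)) * (f ⬝ᵥ a) = (f ⬝ᵥ f) * (w ⬝ᵥ (g ⨯₃ a)) := by
  have e : (f ⬝ᵥ g) * (w ⬝ᵥ (f ⨯₃ a)) - (w ⬝ᵥ (f ⨯₃ g)) * (f ⬝ᵥ a)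
      - (f ⬝ᵥ f) * (w ⬝ᵥ (g ⨯₃ a)) = -(f ⬝ᵥ w) * ((f ⨯₃ g) ⬝ᵥ a) := by
    simp only [dot3, cross_zero, cross_one, cross_two]; ring
  rw [h] at e
  linarith

section Curves

variable {f g w : ℝ → Vec3} {f' g' w' : Vec3} {t : ℝ}

theorem hasDerivAt_dot (hf : HasDerivAt f f' t) (hg : HasDerivAt g g' t) :
    HasDerivAt (fun s => f s ⬝ᵥ g s) (f' ⬝ᵥ g t + f t ⬝ᵥ g') t := by
  rw [hasDerivAt_pi] at hf hg
  simp only [dot3]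
  exact ((((hf 0).mul (hg 0)).add ((hf 1).mul (hg 1))).add ((hf 2).mul (hg 2))).congr_deriv
    (by ring)

theorem hasDerivAt_cross (hf : HasDerivAt f f' t) (hg : HasDerivAt g g' t) :
    HasDerivAt (fun s => f s ⨯₃ g s) (f' ⨯₃ g t + f t ⨯₃ g') t := by
  rw [hasDerivAt_pi] at hf hg ⊢
  intro i
  fin_cases i
  · simp only [Fin.zero_eta, Fin.isValue, Pi.add_apply, cross_zero]
    exact (((hf 1).mul (hg 2)).sub ((hf 2).mul (hg 1))).congr_deriv (by ring)
  · simp only [Fin.mk_one, Fin.isValue, Pi.add_apply, cross_one]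
    exact (((hf 2).mul (hg 0)).sub ((hf 0).mul (hg 2))).congr_deriv (by ring)
  · simp only [Fin.reduceFinMk, Fin.isValue, Pi.add_apply, cross_two]
    exact (((hf 0).mul (hg 1)).sub ((hf 1).mul (hg 0))).congr_deriv (by ring)

theorem hasDerivAt_len (hf : HasDerivAt f f' t) (h0 : f t ≠ 0) :
    HasDerivAt (fun s => len (f s)) ((f t ⬝ᵥ f') / len (f t)) t := by
  refine ((hasDerivAt_dot hf hf).sqrt (dot_self_pos h0).ne').congr_deriv ?_
  rw [dotProduct_comm f', ← two_mul, len, mul_div_mul_left _ _ two_ne_zero]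

/-- The derivative of an oriented angle. -/
theorem angle_deriv {θ : ℝ → ℝ} {θ' : ℝ} (hf : HasDerivAt f f' t) (hg : HasDerivAt g g' t)
    (hw : HasDerivAt w w' t) (hθ : HasDerivAt θ θ' t)
    (h : ∀ᶠ s in 𝓝 t, (θ s : Real.Angle) = orientedAngle (w s) (f s) (g s))
    (hf0 : f t ≠ 0) (hg0 : g t ≠ 0) (hw0 : w t ≠ 0) (hfw : ∀ᶠ s in 𝓝 t, f s ⬝ᵥ w s = 0)
    (hgw : ∀ᶠ s in 𝓝 t, g s ⬝ᵥ w s = 0) :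
    len (w t) * θ' = (w t ⬝ᵥ (g t ⨯₃ g')) / (g t ⬝ᵥ g t) - (w t ⬝ᵥ (f t ⨯₃ f')) / (f t ⬝ᵥ f t) := by
  have hL := len_ne_zero hw0
  have dc := hasDerivAt_dot hf hg
  have ds := hasDerivAt_dot hw (hasDerivAt_cross hf hg)
  have dL := hasDerivAt_len hw hw0
  have dF := (hθ.sin.mul (dL.mul dc)).sub (hθ.cos.mul ds)
  have polar : ∀ s, (θ s : Real.Angle) = orientedAngle (w s) (f s) (g s) → f s ⬝ᵥ w s = 0 →
      g s ⬝ᵥ w s = 0 → w s ≠ 0 → f s ≠ 0 → g s ≠ 0 →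
      len (f s) * len (g s) * Real.cos (θ s) = f s ⬝ᵥ g s ∧
      len (f s) * len (g s) * Real.sin (θ s) * len (w s) = w s ⬝ᵥ (f s ⨯₃ g s) := by
    intro s h1 h2 h3 h4 h5 h6
    have e1 := cos_of_coe_eq_arg (angleNum_ne_zero h4 h2 h3 h5 h6) h1
    have e2 := sin_of_coe_eq_arg (c := angleNum _ _ _) h1
    rw [norm_angleNum h4 h2 h3] at e1 e2
    exact ⟨e1, by rw [e2]; exact div_mul_cancel₀ _ (len_ne_zero h4)⟩
  -- The vectors `(cos θ, sin θ)` and `(|w| f · g, w · (f × g))` are parallel; differentiating this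
  -- relation avoids any choice of branch.
  have h0 : (fun s => Real.sin (θ s) * (len (w s) * (f s ⬝ᵥ g s))
      - Real.cos (θ s) * (w s ⬝ᵥ (f s ⨯₃ g s))) =ᶠ[𝓝 t] fun _ => 0 := by
    filter_upwards [h, hfw, hgw, hw.continuousAt.eventually_ne hw0,
      hf.continuousAt.eventually_ne hf0, hg.continuousAt.eventually_ne hg0] with s h1 h2 h3 h4 h5 h6
    obtain ⟨e1, e2⟩ := polar s h1 h2 h3 h4 h5 h6
    rw [← e1, ← e2]
    ring
  have hz := dF.unique ((hasDerivAt_const t (0 : ℝ)).congr_of_eventuallyEq h0)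
  have h2 := hfw.self_of_nhds
  have h3 := hgw.self_of_nhds
  obtain ⟨e1, e2⟩ := polar t h.self_of_nhds h2 h3 hw0 hf0 hg0
  have k1 := sq_triple_of_orthogonal h2 h3
  -- Since `f × g` is parallel to `w`, only the component of `w'` along `w` enters, and it cancels
  -- against the derivative of `|w|`.
  have k2 : (w t ⬝ᵥ w t) * (w' ⬝ᵥ (f t ⨯₃ g t)) = (w t ⬝ᵥ (f t ⨯₃ g t)) * (w t ⬝ᵥ w') := by
    have a1 : w t ⨯₃ (f t ⨯₃ g t) = 0 := by
      rw [cross_cross_right, dotProduct_comm _ (f t), dotProduct_comm _ (g t), h2, h3]; simp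
    have a2 := dot_cross_cross (w t) (f t ⨯₃ g t) (w t) w'
    rw [a1, zero_dotProduct, dotProduct_comm _ w', dotProduct_comm (f t ⨯₃ g t) (w t)] at a2
    linarith [a2]
  have k3 := triple_identity h2 (g t) g'
  have k4 := triple_identity h3 (f t) f'
  have k5 : w t ⬝ᵥ (g t ⨯₃ f t) = -(w t ⬝ᵥ (f t ⨯₃ g t)) := by
    rw [← cross_anticomm, dotProduct_neg]
  have k6 : w t ⬝ᵥ (f' ⨯₃ g t) = -(w t ⬝ᵥ (g t ⨯₃ f')) := by
    rw [← cross_anticomm, dotProduct_neg]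
  simp only [dotProduct_add, Pi.mul_apply, k6, dotProduct_comm f' (g t)] at hz
  rw [k5, dotProduct_comm (g t) (f t)] at k4
  rw [← len_sq (w t)] at k1 k2
  have hA := (dot_self_pos hf0).ne'
  have hB := (dot_self_pos hg0).ne'
  have hAl := len_sq (f t)
  have hBl := len_sq (g t)
  have hfl := len_ne_zero hf0
  have hgl := len_ne_zero hg0
  generalize len (w t) = L at *
  generalize len (f t) = lf at *
  generalize len (g t) = lg at *
  generalize f t ⬝ᵥ f t = A at *
  generalize g t ⬝ᵥ g t = B at *
  generalize w t ⬝ᵥ (f t ⨯₃ g t) = S at *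
  generalize f t ⬝ᵥ g t = C at *
  generalize w t ⬝ᵥ w' = W at *
  generalize w' ⬝ᵥ (f t ⨯₃ g t) = V at *
  generalize w t ⬝ᵥ (g t ⨯₃ g') = Y at *
  generalize w t ⬝ᵥ (f t ⨯₃ f') = Z at *
  generalize w t ⬝ᵥ (f t ⨯₃ g') = X at *
  generalize w t ⬝ᵥ (g t ⨯₃ f') = X' at *
  generalize f t ⬝ᵥ g' = c at *
  generalize g t ⬝ᵥ f' = c' at *
  generalize Real.cos (θ t) = co at *
  generalize Real.sin (θ t) = si at *
  -- This is `hz` multiplied by `|w| |f| |g|`, with `|f| |g| cos θ` and `|f| |g| sin θ` replaced by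
  -- the dot and triple products.
  have hz' : L * (C * θ' * L * C + S / L * (W / L * C + L * (c' + c)) + S / L * θ' * S
      - C * (V + (-X' + X))) = 0 := by
    have : S / L = lf * lg * si := by rw [← e2]; field_simp
    rw [this]
    linear_combination lf * lg * L * hz - (θ' * L ^ 2 * C - L * (V - X' + X)) * e1
  field_simp at hz'
  have hr : L * θ' * (A * B) = Y * A - Z * B := by
    refine mul_left_cancel₀ (pow_ne_zero 2 hL) ?_
    linear_combination hz' - L * θ' * k1 + C * k2 - L ^ 2 * k4 + L ^ 2 * k3
  rw [div_sub_div _ _ hB hA, eq_div_iff (mul_ne_zero hB hA)]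
  linear_combination hr

end Curves

/-! ### The one-form of a planet -/

namespace PlanetarySystem

variable {N : ℕ} {σ : PlanetarySystem N}

theorem Elliptic.one_sub_ecc_mul_cos_pos {z : Phase (N + 1)} {i : Fin (N + 1)}
    (h : σ.Elliptic z i) (u : ℝ) : 0 < 1 - σ.ecc z i * Real.cos u := by
  nlinarith [h.ecc_lt_one, h.ecc_pos, Real.cos_le_one u]

section Components

variable {z : Phase (N + 1)} {i : Fin (N + 1)} (h : σ.Elliptic z i) {u : ℝ}
  (hu : (u : Real.Angle) = (Complex.arg (σ.eccNum z i) : ℝ))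
include h hu

theorem Elliptic.mom_dot_peri_eq : (z.1 i ⬝ᵥ σ.peri z i) *
    (σ.semiMajor z i * (1 - σ.ecc z i * Real.cos u)) = -(σ.Lam z i * Real.sin u) := by
  have h1 := h.mom_dot_peri
  rw [h.len_pos_eq_eccNum, h.len_angMom, h.im_eccNum, h.cos_eccNum hu, h.sin_eccNum hu] at h1
  refine mul_left_cancel₀ (mul_pos h.lam_pos h.sqrt_pos).ne' ?_
  linear_combination h1 + √(1 - σ.ecc z i ^ 2) * Real.sin u * h.lam_sq

theorem Elliptic.mom_dot_periOrth_eq : (z.1 i ⬝ᵥ σ.periOrth z i) *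
    (σ.semiMajor z i * (1 - σ.ecc z i * Real.cos u))
      = σ.Lam z i * √(1 - σ.ecc z i ^ 2) * Real.cos u := by
  have h1 := h.mom_dot_periOrth
  rw [h.len_pos_eq_eccNum, h.len_angMom, h.re_eccNum, h.cos_eccNum hu] at h1
  refine mul_left_cancel₀ (mul_pos h.lam_pos h.sqrt_pos).ne' ?_
  linear_combination h1 - (1 - σ.ecc z i ^ 2) * Real.cos u * h.lam_sq
    - σ.Lam z i ^ 2 * Real.cos u * h.sqrt_sq

/-- It supplies the exact term `d(2 x · y)` of the one-form as `d(2 Λ e sin u)`. -/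
theorem Elliptic.pos_dot_mom : z.2 i ⬝ᵥ z.1 i = σ.Lam z i * σ.ecc z i * Real.sin u := by
  have h1 := h.mom_dot_peri_eq hu
  have h2 := h.mom_dot_periOrth_eq hu
  have h3 := (mul_pos h.semiMajor_pos (h.one_sub_ecc_mul_cos_pos u)).ne'
  conv_lhs => rw [h.position_eq hu]
  rw [add_dotProduct, smul_dotProduct, smul_dotProduct, dotProduct_comm _ (z.1 i),
    dotProduct_comm _ (z.1 i), smul_eq_mul, smul_eq_mul]
  refine mul_right_cancel₀ h3 ?_
  linear_combination (σ.semiMajor z i * (Real.cos u - σ.ecc z i)) * h1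
    + (σ.semiMajor z i * √(1 - σ.ecc z i ^ 2) * Real.sin u) * h2
    + σ.semiMajor z i * Real.sin u * σ.Lam z i * Real.cos u * h.sqrt_sq

end Components

/-- The one-form `y · dx` of a planet in terms of the elements of its ellipse. -/
theorem kepler_form {Z : ℝ → Phase (N + 1)} {i : Fin (N + 1)} {t : ℝ} {x' y' P' : Vec3}
    {a' e' l' : ℝ} {u : ℝ → ℝ} (hZ : ∀ᶠ s in 𝓝 t, σ.Elliptic (Z s) i)
    (hx : HasDerivAt (fun s => (Z s).2 i) x' t) (hy : HasDerivAt (fun s => (Z s).1 i) y' t)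
    (hP : HasDerivAt (fun s => σ.peri (Z s) i) P' t)
    (ha : HasDerivAt (fun s => σ.semiMajor (Z s) i) a' t)
    (he : HasDerivAt (fun s => σ.ecc (Z s) i) e' t)
    (hu : ∀ᶠ s in 𝓝 t, (u s : Real.Angle) = (Complex.arg (σ.eccNum (Z s) i) : ℝ))
    (hud : DifferentiableAt ℝ u t)
    (hl : HasDerivAt (fun s => u s - σ.ecc (Z s) i * Real.sin (u s)) l' t) :
    (Z t).1 i ⬝ᵥ x' = σ.Lam (Z t) i * l' + 2 * (y' ⬝ᵥ (Z t).2 i + (Z t).1 i ⬝ᵥ x')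
      + angMom (Z t) i ⬝ᵥ (σ.peri (Z t) i ⨯₃ P') := by
  have h := hZ.self_of_nhds
  have hut := hu.self_of_nhds
  have hC := hasDerivAt_cross hx hy
  have hC0 := len_ne_zero h.2.2.1
  -- Only existence of `Q'` is needed; the components used later follow from orthonormality of `P,
  -- Q`.
  have hQ : ∃ Q', HasDerivAt (fun s => σ.periOrth (Z s) i) Q' t :=
    ⟨_, ((hasDerivAt_len hC h.2.2.1).inv hC0).smul (hasDerivAt_cross hC hP)⟩
  obtain ⟨Q', hQ⟩ := hQ
  have hu' := hud.hasDerivAt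
  set u' := deriv u t
  have hs : ∃ s', HasDerivAt (fun s => √(1 - σ.ecc (Z s) i ^ 2)) s' t ∧
      √(1 - σ.ecc (Z t) i ^ 2) * s' = -(σ.ecc (Z t) i * e') := by
    refine ⟨_, ((he.fun_pow 2).const_sub 1).sqrt (by linarith [h.ecc_sq_lt_one]), ?_⟩
    have := h.sqrt_pos.ne'
    field_simp
    push_cast
    ring
  obtain ⟨s', hs, hss'⟩ := hs
  have hA := ha.mul (hu'.cos.sub he)
  have hB := (ha.mul hs).mul hu'.sin
  have hx' := hx.unique (((hA.smul hP).add (hB.smul hQ)).congr_of_eventuallyEq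
    ((hZ.and hu).mono fun s hs => hs.1.position_eq hs.2))
  have hL : HasDerivAt (fun s => σ.Lam (Z s) i)
      (σ.Lam (Z t) i * a' / (2 * σ.semiMajor (Z t) i)) t := by
    have h1 := ((ha.const_mul (σ.totMass i)).sqrt
      (mul_pos (σ.totMass_pos i) h.semiMajor_pos).ne').const_mul (σ.redMass i)
    refine h1.congr_deriv ?_
    have h2 := Real.sq_sqrt (mul_pos (σ.totMass_pos i) h.semiMajor_pos).le
    have h3 := Real.sqrt_pos.2 (mul_pos (σ.totMass_pos i) h.semiMajor_pos)
    have h4 := h.semiMajor_pos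
    rw [Lam]
    field_simp
    rw [h2]
    ring
  have hll := hl.unique (hu'.sub (he.mul hu'.sin))
  -- the scalar components of position and momentum
  have dPP : P' ⬝ᵥ σ.peri (Z t) i = 0 := by
    have := (hasDerivAt_dot hP hP).unique ((hasDerivAt_const t (1 : ℝ)).congr_of_eventuallyEq
      (hZ.mono fun s hs => hs.peri_dot_self))
    rw [dotProduct_comm (σ.peri _ _)] at this
    linarith
  have dPQ : P' ⬝ᵥ σ.periOrth (Z t) i + σ.peri (Z t) i ⬝ᵥ Q' = 0 :=
    (hasDerivAt_dot hP hQ).unique ((hasDerivAt_const t (0 : ℝ)).congr_of_eventuallyEq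
      (Eventually.of_forall fun s => σ.peri_dot_periOrth (Z s) i))
  have dQQ : Q' ⬝ᵥ σ.periOrth (Z t) i = 0 := by
    have := (hasDerivAt_dot hQ hQ).unique ((hasDerivAt_const t (1 : ℝ)).congr_of_eventuallyEq
      (hZ.mono fun s hs => hs.periOrth_dot_self))
    rw [dotProduct_comm (σ.periOrth _ _)] at this
    linarith
  -- The motion of the frame enters only through `P' · Q`, the rotation rate of the perihelion
  -- within the orbital plane.
  have hCPP : angMom (Z t) i ⬝ᵥ (σ.peri (Z t) i ⨯₃ P')
      = len (angMom (Z t) i) * (P' ⬝ᵥ σ.periOrth (Z t) i) := by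
    rw [triple_rotate, triple_rotate, angMom_cross_peri h, dotProduct_smul, smul_eq_mul]
  have hyP : (Z t).1 i ⬝ᵥ P' = ((Z t).1 i ⬝ᵥ σ.periOrth (Z t) i) * (P' ⬝ᵥ σ.periOrth (Z t) i) := by
    conv_lhs => rw [h.expansion (angMom_dot_mom (Z t) i)]
    rw [add_dotProduct, smul_dotProduct, smul_dotProduct, dotProduct_comm _ P', dPP,
      dotProduct_comm _ P']
    simp
  have hyQ : (Z t).1 i ⬝ᵥ Q' = -((Z t).1 i ⬝ᵥ σ.peri (Z t) i) * (P' ⬝ᵥ σ.periOrth (Z t) i) := by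
    conv_lhs => rw [h.expansion (angMom_dot_mom (Z t) i)]
    rw [add_dotProduct, smul_dotProduct, smul_dotProduct, dotProduct_comm (σ.periOrth _ _) Q', dQQ,
      eq_neg_of_add_eq_zero_right dPQ]
    simp
  have hxy := (hasDerivAt_dot hx hy).unique (((hL.mul he).mul hu'.sin).congr_of_eventuallyEq
    ((hZ.and hu).mono fun s hs => hs.1.pos_dot_mom hs.2))
  have hp := h.mom_dot_peri_eq hut
  have hq := h.mom_dot_periOrth_eq hut
  have hD := (mul_pos h.semiMajor_pos (h.one_sub_ecc_mul_cos_pos (u t))).ne'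
  have hsq := h.sqrt_sq
  have hT := Real.sin_sq_add_cos_sq (u t)
  have hyx : (Z t).1 i ⬝ᵥ x' = _ := congrArg ((Z t).1 i ⬝ᵥ ·) hx'
  rw [dotProduct_comm y', add_comm ((Z t).2 i ⬝ᵥ y'), dotProduct_comm ((Z t).1 i) x', hxy, hCPP,
    h.len_angMom, dotProduct_comm x', hyx, hll]
  have hLd : 2 * σ.semiMajor (Z t) i * (σ.Lam (Z t) i * a' / (2 * σ.semiMajor (Z t) i))
      = σ.Lam (Z t) i * a' := by
    have := h.semiMajor_pos.ne'
    field_simp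
  simp only [dotProduct_add, dotProduct_smul, smul_eq_mul, hyP, hyQ, Pi.mul_apply, Pi.sub_apply]
  generalize σ.Lam (Z t) i * a' / (2 * σ.semiMajor (Z t) i) = Ld at *
  refine mul_right_cancel₀ hD ?_
  generalize (Z t).1 i ⬝ᵥ σ.peri (Z t) i = p at *
  generalize (Z t).1 i ⬝ᵥ σ.periOrth (Z t) i = q at *
  generalize P' ⬝ᵥ σ.periOrth (Z t) i = om at *
  generalize √(1 - σ.ecc (Z t) i ^ 2) = s at *
  generalize σ.semiMajor (Z t) i = a at *
  generalize σ.ecc (Z t) i = e at *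
  generalize σ.Lam (Z t) i = L at *
  generalize Real.cos (u t) = c at *
  generalize Real.sin (u t) = S at *
  -- After multiplication by `a (1 - e cos u)` the claim is polynomial. The coefficients of `hp` and
  -- `hq` are the components of `x'` along `P` and `Q`.
  linear_combination
    (a' * (c - e) + a * (-S * u' - e') - a * s * S * om) * hp
    + ((a' * s + a * s') * S + a * s * (c * u') + a * (c - e) * om) * hq
    - (1 - e * c) * e * S * hLd + L * c * (a' * S + a * c * u') * hsq + L * c * a * S * hss'
    + (L * a * u' + a * L * s * om) * hT

end PlanetarySystem
end Planetary

namespace Planetary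

open Filter Topology

/-! ### Smoothness -/

section Smooth

variable {E : Type*} [NormedAddCommGroup E] [NormedSpace ℝ E] {n : ℕ∞ω} {f g w : E → Vec3} {x : E}

theorem contDiffAt_dot (hf : ContDiffAt ℝ n f x) (hg : ContDiffAt ℝ n g x) :
    ContDiffAt ℝ n (fun z => f z ⬝ᵥ g z) x := by
  rw [contDiffAt_pi] at hf hg
  simp only [dot3]
  exact (((hf 0).mul (hg 0)).add ((hf 1).mul (hg 1))).add ((hf 2).mul (hg 2))

theorem contDiffAt_cross (hf : ContDiffAt ℝ n f x) (hg : ContDiffAt ℝ n g x) :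
    ContDiffAt ℝ n (fun z => f z ⨯₃ g z) x := by
  rw [contDiffAt_pi] at hf hg ⊢
  intro i
  fin_cases i
  · simp only [Fin.zero_eta, Fin.isValue, cross_zero]
    exact ((hf 1).mul (hg 2)).sub ((hf 2).mul (hg 1))
  · simp only [Fin.mk_one, Fin.isValue, cross_one]
    exact ((hf 2).mul (hg 0)).sub ((hf 0).mul (hg 2))
  · simp only [Fin.reduceFinMk, Fin.isValue, cross_two]
    exact ((hf 0).mul (hg 1)).sub ((hf 1).mul (hg 0))

theorem contDiffAt_len (hf : ContDiffAt ℝ n f x) (h0 : f x ≠ 0) :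
    ContDiffAt ℝ n (fun z => len (f z)) x :=
  (contDiffAt_dot hf hf).sqrt (dot_self_pos h0).ne'

theorem contDiffAt_complex_mk {a b : E → ℝ} (ha : ContDiffAt ℝ n a x) (hb : ContDiffAt ℝ n b x) :
    ContDiffAt ℝ n (fun z => (⟨a z, b z⟩ : ℂ)) x :=
  Complex.equivRealProdCLM.symm.contDiff.contDiffAt.comp x (ha.prodMk hb)

theorem contDiffAt_angleNum (hw : ContDiffAt ℝ n w x) (hf : ContDiffAt ℝ n f x)
    (hg : ContDiffAt ℝ n g x) (h0 : w x ≠ 0) :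
    ContDiffAt ℝ n (fun z => angleNum (w z) (f z) (g z)) x :=
  contDiffAt_complex_mk (contDiffAt_dot hf hg)
    ((contDiffAt_dot hw (contDiffAt_cross hf hg)).div (contDiffAt_len hw h0) (len_ne_zero h0))

/-- The argument of a smooth non-vanishing complex function has a smooth local lift to `ℝ`. -/
theorem exists_smooth_arg_lift {c : E → ℂ} (hc : ContDiffAt ℝ n c x) (h0 : c x ≠ 0) {θ₀ : ℝ}
    (hθ : (θ₀ : Real.Angle) = (Complex.arg (c x) : ℝ)) :
    ∃ θ : E → ℝ, ContDiffAt ℝ n θ x ∧ θ x = θ₀ ∧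
      ∀ᶠ z in 𝓝 x, (θ z : Real.Angle) = (Complex.arg (c z) : ℝ) := by
  -- Dividing by `c x` moves the base value to `1`, where the logarithm is smooth, whatever the
  -- argument of `c x` is.
  have hq : ContDiffAt ℝ n (fun z => c z / c x) x := by
    simp only [div_eq_mul_inv]
    exact hc.mul contDiffAt_const
  have hlog : ContDiffAt ℝ n (fun z => Complex.log (c z / c x)) x := by
    have hl : ContDiffAt ℝ n Complex.log (c x / c x) :=
      (Complex.contDiffAt_log (by
        rw [div_self h0]; exact Complex.one_mem_slitPlane)).restrict_scalars ℝ
    exact ContDiffAt.comp x hl hq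
  refine ⟨fun z => θ₀ + (Complex.log (c z / c x)).im,
    contDiffAt_const.add (Complex.imCLM.contDiff.contDiffAt.comp x hlog), ?_, ?_⟩
  · simp [div_self h0]
  · filter_upwards [hc.continuousAt.eventually_ne h0] with z hz
    rw [Complex.log_im, Real.Angle.coe_add, hθ,
      ← Complex.arg_mul_coe_angle h0 (div_ne_zero hz h0), mul_div_cancel₀ _ h0]

end Smooth

namespace PlanetarySystem

variable {N : ℕ} {σ : PlanetarySystem N} {z : Phase (N + 1)} {n : ℕ∞ω}

theorem contDiffAt_mom (i : Fin (N + 1)) : ContDiffAt ℝ n (fun z : Phase (N + 1) => z.1 i) z := by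
  fun_prop

theorem contDiffAt_pos (i : Fin (N + 1)) : ContDiffAt ℝ n (fun z : Phase (N + 1) => z.2 i) z := by
  fun_prop

theorem contDiffAt_angMom (i : Fin (N + 1)) :
    ContDiffAt ℝ n (fun z : Phase (N + 1) => angMom z i) z :=
  contDiffAt_cross (contDiffAt_pos i) (contDiffAt_mom i)

theorem contDiffAt_partialSum (j : Fin (N + 1)) :
    ContDiffAt ℝ n (fun z : Phase (N + 1) => partialSum z j) z :=
  ContDiffAt.sum fun k _ => contDiffAt_angMom k

theorem contDiffAt_twoBody {i : Fin (N + 1)} (h : z.2 i ≠ 0) :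
    ContDiffAt ℝ n (fun z => σ.twoBody i z) z :=
  ((contDiffAt_dot (contDiffAt_mom i) (contDiffAt_mom i)).div_const _).sub
    (contDiffAt_const.div (contDiffAt_len (contDiffAt_pos i) h) (len_ne_zero h))

theorem contDiffAt_eccVec {i : Fin (N + 1)} (h : z.2 i ≠ 0) :
    ContDiffAt ℝ n (fun z => σ.eccVec z i) z :=
  ((contDiffAt_cross (contDiffAt_mom i) (contDiffAt_angMom i)).const_smul _).sub
    (((contDiffAt_len (contDiffAt_pos i) h).inv (len_ne_zero h)).smul (contDiffAt_pos i))

theorem Elliptic.eventually {i : Fin (N + 1)} (h : σ.Elliptic z i) :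
    ∀ᶠ z' in 𝓝 z, σ.Elliptic z' i :=
  ((contDiffAt_pos (n := 0) i).continuousAt.eventually_ne h.1).and
    (((contDiffAt_twoBody (n := 0) h.1).continuousAt.eventually_lt continuousAt_const h.2.1).and
      (((contDiffAt_angMom (n := 0) i).continuousAt.eventually_ne h.2.2.1).and
        ((contDiffAt_eccVec (n := 0) h.1).continuousAt.eventually_ne h.2.2.2)))

section Planet

variable {i : Fin (N + 1)} (h : σ.Elliptic z i)
include h

theorem Elliptic.contDiffAt_semiMajor : ContDiffAt ℝ n (fun z => σ.semiMajor z i) z :=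
  contDiffAt_const.div (contDiffAt_const.mul (contDiffAt_twoBody h.1))
    (mul_ne_zero two_ne_zero h.2.1.ne)

theorem Elliptic.contDiffAt_ecc : ContDiffAt ℝ n (fun z => σ.ecc z i) z :=
  contDiffAt_len (contDiffAt_eccVec h.1) h.2.2.2

theorem Elliptic.contDiffAt_peri : ContDiffAt ℝ n (fun z => σ.peri z i) z :=
  (h.contDiffAt_ecc.inv h.ecc_pos.ne').smul (contDiffAt_eccVec h.1)

theorem Elliptic.contDiffAt_lam : ContDiffAt ℝ n (fun z => σ.Lam z i) z :=
  contDiffAt_const.mul ((contDiffAt_const.mul h.contDiffAt_semiMajor).sqrt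
    (mul_pos (σ.totMass_pos i) h.semiMajor_pos).ne')

theorem Elliptic.contDiffAt_eccNum : ContDiffAt ℝ n (fun z => σ.eccNum z i) z := by
  refine contDiffAt_complex_mk
    (((contDiffAt_dot (contDiffAt_pos i) h.contDiffAt_peri).div h.contDiffAt_semiMajor
      h.semiMajor_pos.ne').add h.contDiffAt_ecc)
    ((contDiffAt_dot (contDiffAt_pos i) ?_).div (h.contDiffAt_semiMajor.mul
      ((contDiffAt_const.sub (h.contDiffAt_ecc.pow 2)).sqrt ?_))
      (mul_pos h.semiMajor_pos h.sqrt_pos).ne')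
  · exact ((contDiffAt_len (contDiffAt_angMom i) h.2.2.1).inv (len_ne_zero h.2.2.1)).smul
      (contDiffAt_cross (contDiffAt_angMom i) h.contDiffAt_peri)
  · linarith [h.ecc_sq_lt_one]

end Planet

theorem Regular.contDiffAt_nodeN (h : σ.Regular z) (j : Fin (N + 1)) :
    ContDiffAt ℝ n (fun z => σ.nodeN z j) z := by
  rcases fin_cases_castSucc_or_last j with ⟨i, rfl⟩ | rfl
  · simp only [nodeN_castSucc]
    exact contDiffAt_cross (contDiffAt_partialSum _) (h.elliptic _).contDiffAt_peri
  · simp only [nodeN_last]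
    exact (h.elliptic _).contDiffAt_peri

theorem Regular.contDiffAt_nodeNu (h : σ.Regular z) (j : Fin (N + 1)) :
    ContDiffAt ℝ n (fun z => σ.nodeNu z j) z := by
  refine Fin.cases ?_ (fun i => ?_) j
  · simp only [nodeNu_zero]
    exact contDiffAt_cross contDiffAt_const (contDiffAt_partialSum _)
  · simp only [nodeNu_succ]
    exact contDiffAt_cross (h.elliptic _).contDiffAt_peri (contDiffAt_partialSum _)

theorem isOpen_domain (σ : PlanetarySystem N) : IsOpen σ.domain := by
  rw [isOpen_iff_mem_nhds]
  intro z hz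
  have h := (mem_domain_iff.1 hz).1
  have h1 : ∀ᶠ z' in 𝓝 z, ∀ i, σ.Elliptic z' i := eventually_all.2 fun i => (h.elliptic i).eventually
  have h2 : ∀ᶠ z' in 𝓝 z, ∀ j, σ.nodeNu z' j ≠ 0 ∧ σ.nodeN z' j ≠ 0 :=
    eventually_all.2 fun j =>
      ((h.contDiffAt_nodeNu (n := 0) j).continuousAt.eventually_ne (hz.2 j).1).and
        ((h.contDiffAt_nodeN (n := 0) j).continuousAt.eventually_ne (hz.2 j).2)
  exact h1.and h2

theorem Regular.contDiffAt_Theta (h : σ.Regular z) (j : Fin (N + 1)) :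
    ContDiffAt ℝ n (fun z => σ.Theta z j) z := by
  refine Fin.cases ?_ (fun i => ?_) j
  · exact contDiffAt_dot (contDiffAt_partialSum _) contDiffAt_const
  · exact contDiffAt_dot (contDiffAt_partialSum _) (h.elliptic _).contDiffAt_peri

theorem Elliptic.exists_lift_meanAnomaly {i : Fin (N + 1)} (h : σ.Elliptic z i) {θ₀ : ℝ}
    (h₀ : (θ₀ : Real.Angle) = σ.meanAnomaly z i) :
    ∃ θ : Phase (N + 1) → ℝ, ContDiffAt ℝ n θ z ∧ θ z = θ₀ ∧
      ∀ᶠ z' in 𝓝 z, (θ z' : Real.Angle) = σ.meanAnomaly z' i := by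
  obtain ⟨u, hu, -, hu'⟩ := exists_smooth_arg_lift (n := n) h.contDiffAt_eccNum h.eccNum_ne_zero rfl
  have hz := h.meanAnomaly_eq hu'.self_of_nhds
  -- The added constant is a multiple of `2π`; it gives the lift the prescribed value `θ₀` at `z`.
  refine ⟨fun z' => (u z' - σ.ecc z' i * Real.sin (u z')) +
      (θ₀ - (u z - σ.ecc z i * Real.sin (u z))),
    (hu.sub (h.contDiffAt_ecc.mul hu.sin)).add contDiffAt_const, by ring, ?_⟩
  filter_upwards [hu', h.eventually] with z' h1 h2
  rw [Real.Angle.coe_add, ← h2.meanAnomaly_eq h1, Real.Angle.coe_sub θ₀, h₀, hz, sub_self, add_zero]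

theorem exists_lift_vartheta (hz : z ∈ σ.domain) (j : Fin (N + 1)) {θ₀ : ℝ}
    (h₀ : (θ₀ : Real.Angle) = σ.vartheta z j) :
    ∃ θ : Phase (N + 1) → ℝ, ContDiffAt ℝ n θ z ∧ θ z = θ₀ ∧
      ∀ᶠ z' in 𝓝 z, (θ z' : Real.Angle) = σ.vartheta z' j := by
  have h := (mem_domain_iff.1 hz).1
  have hk : (![0, 0, 1] : Vec3) ≠ 0 := fun h => by simpa using congrFun h 2
  have hk1 : (![1, 0, 0] : Vec3) ≠ 0 := fun h => by simpa using congrFun h 0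
  induction j using Fin.cases with
  | zero =>
    exact exists_smooth_arg_lift
      (contDiffAt_angleNum contDiffAt_const contDiffAt_const (h.contDiffAt_nodeNu 0) hk)
      (angleNum_ne_zero hk (by simp) (cross_dot_self_left _ _) hk1 (hz.2 0).1) h₀
  | succ i =>
    have hP := (h.elliptic i.castSucc).peri_ne_zero
    exact exists_smooth_arg_lift
      (contDiffAt_angleNum (h.elliptic _).contDiffAt_peri (h.contDiffAt_nodeN _)
        (h.contDiffAt_nodeNu _) hP)
      (angleNum_ne_zero hP (nodeN_castSucc_dot_peri σ z i) (nodeNu_succ_dot_peri σ z i)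
        (hz.2 _).2 (hz.2 _).1) h₀

theorem exists_lift_kappa (hz : z ∈ σ.domain) (j : Fin (N + 1)) {θ₀ : ℝ}
    (h₀ : (θ₀ : Real.Angle) = σ.kappa z j) :
    ∃ θ : Phase (N + 1) → ℝ, ContDiffAt ℝ n θ z ∧ θ z = θ₀ ∧
      ∀ᶠ z' in 𝓝 z, (θ z' : Real.Angle) = σ.kappa z' j := by
  have h := (mem_domain_iff.1 hz).1
  have hS := h.partialSum_ne_zero j
  exact exists_smooth_arg_lift
    (contDiffAt_angleNum (contDiffAt_partialSum j) (h.contDiffAt_nodeNu j) (h.contDiffAt_nodeN j) hS)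
    (angleNum_ne_zero hS (nodeNu_dot_partialSum σ z j) (nodeN_dot_partialSum σ z j)
      (hz.2 _).1 (hz.2 _).2) h₀

/-- Smooth local lifts of the coordinates to `ℝ`. -/
theorem exists_smooth_lift (hz : z ∈ σ.domain) {w : Coord (N + 1)} (hw : toTorus w = σ.pStar z) :
    ∃ F : Phase (N + 1) → Coord (N + 1), ContDiffAt ℝ n F z ∧ F z = w ∧
      ∀ᶠ z' in 𝓝 z, toTorus (F z') = σ.pStar z' := by
  have h := (mem_domain_iff.1 hz).1
  have hw2 : ∀ a i, (w.2 a i : Real.Angle) = (σ.pStar z).2 a i := fun a i =>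
    congrFun (congrFun (congrArg Prod.snd hw) a) i
  have key : ∀ a i, ∃ θ : Phase (N + 1) → ℝ, ContDiffAt ℝ n θ z ∧ θ z = w.2 a i ∧
      ∀ᶠ z' in 𝓝 z, (θ z' : Real.Angle) = (σ.pStar z').2 a i := by
    intro a i
    fin_cases a
    · exact (h.elliptic i).exists_lift_meanAnomaly (hw2 0 i)
    · exact exists_lift_kappa hz i (hw2 1 i)
    · exact exists_lift_vartheta hz i (hw2 2 i)
  choose θ hθ h0 hev using key
  refine ⟨fun z' => ((σ.pStar z').1, fun a i => θ a i z'), ContDiffAt.prodMk ?_ ?_, ?_, ?_⟩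
  · refine contDiffAt_pi.2 fun a => contDiffAt_pi.2 fun i => ?_
    fin_cases a
    · exact (h.elliptic i).contDiffAt_lam
    · exact contDiffAt_len (contDiffAt_partialSum i) (h.partialSum_ne_zero i)
    · exact h.contDiffAt_Theta i
  · exact contDiffAt_pi.2 fun a => contDiffAt_pi.2 fun i => hθ a i
  · exact Prod.ext (congrArg Prod.fst hw).symm (funext fun a => funext fun i => h0 a i)
  · filter_upwards [eventually_all.2 fun a => eventually_all.2 fun i => hev a i] with z' hz'
    exact Prod.ext rfl (funext fun a => funext fun i => hz' a i)

end PlanetarySystem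
end Planetary

namespace Planetary

open Filter Topology

/-! ### The Liouville one-form in the coordinates `P_*` -/

/-- Functions with the same reduction mod `2π` have the same derivative. -/
theorem deriv_eq_of_coe_angle_eq {f g : ℝ → ℝ} {f' g' t : ℝ} (hf : HasDerivAt f f' t)
    (hg : HasDerivAt g g' t) (h : ∀ᶠ s in 𝓝 t, (f s : Real.Angle) = (g s : Real.Angle)) :
    f' = g' := by
  have hc := hf.cos.unique (hg.cos.congr_of_eventuallyEq (h.mono fun s hs => by
    simpa using congrArg Real.Angle.cos hs))
  have hs := hf.sin.unique (hg.sin.congr_of_eventuallyEq (h.mono fun s hs => by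
    simpa using congrArg Real.Angle.sin hs))
  have h1 : Real.cos (f t) = Real.cos (g t) := by
    simpa using congrArg Real.Angle.cos h.self_of_nhds
  have h2 : Real.sin (f t) = Real.sin (g t) := by
    simpa using congrArg Real.Angle.sin h.self_of_nhds
  have h3 := Real.sin_sq_add_cos_sq (g t)
  rw [h1] at hs
  rw [h2] at hc
  linear_combination (-Real.sin (g t)) * hc + Real.cos (g t) * hs - (f' - g') * h3

theorem angle_deriv_const {g : ℝ → Vec3} {θ : ℝ → ℝ} {w f g' : Vec3} {θ' t : ℝ}
    (hg : HasDerivAt g g' t) (hθ : HasDerivAt θ θ' t)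
    (h : ∀ᶠ s in 𝓝 t, (θ s : Real.Angle) = orientedAngle w f (g s))
    (hf0 : f ≠ 0) (hg0 : g t ≠ 0) (hw0 : w ≠ 0) (hfw : f ⬝ᵥ w = 0)
    (hgw : ∀ᶠ s in 𝓝 t, g s ⬝ᵥ w = 0) :
    len w * θ' = (w ⬝ᵥ (g t ⨯₃ g')) / (g t ⬝ᵥ g t) := by
  have e := angle_deriv (hasDerivAt_const t f) hg (hasDerivAt_const t w) hθ h hf0 hg0 hw0
    (Eventually.of_forall fun _ => hfw) hgw
  have e0 : f ⨯₃ (0 : Vec3) = 0 := LinearMap.map_zero _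
  rwa [e0, dotProduct_zero, zero_div, sub_zero] at e

/-- With `n = S × P` and `n'` its derivative, the difference of the rotation terms of `n` about `S`
and, weighted by `S · P`, about `P` does not involve `S'`. It is used at two consecutive partial
sums with the same perihelion. -/
theorem node_identity {S P : Vec3} (hP : P ⬝ᵥ P = 1) (S' P' : Vec3) :
    S ⬝ᵥ ((S ⨯₃ P) ⨯₃ (S' ⨯₃ P + S ⨯₃ P')) - (S ⬝ᵥ P) * (P ⬝ᵥ ((S ⨯₃ P) ⨯₃ (S' ⨯₃ P + S ⨯₃ P')))
      = ((S ⨯₃ P) ⬝ᵥ (S ⨯₃ P)) * (S ⬝ᵥ (P ⨯₃ P')) := by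
  generalize hn : S' ⨯₃ P + S ⨯₃ P' = n'
  have h1 : P ⬝ᵥ n' = -(S ⬝ᵥ (P ⨯₃ P')) := by
    rw [← hn, dotProduct_add, dot_cross_self_right, zero_add, triple_rotate, ← cross_anticomm,
      dotProduct_neg]
  have h2 : ∀ v : Vec3, v ⬝ᵥ ((S ⨯₃ P) ⨯₃ n') =
      (v ⬝ᵥ P) * (S ⬝ᵥ n') - (v ⬝ᵥ S) * (P ⬝ᵥ n') := fun v => by
    simp only [dot3, cross_zero, cross_one, cross_two]; ring
  rw [h2, h2, h1, dot_cross_cross, hP, dotProduct_comm P S]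
  ring

namespace PlanetarySystem

variable {N : ℕ} {σ : PlanetarySystem N}

theorem exists_nodeNu_deriv (σ : PlanetarySystem N) {Z : ℝ → Phase (N + 1)} {t : ℝ}
    {S' P' : Fin (N + 1) → Vec3}
    (hS : ∀ j, HasDerivAt (fun s => partialSum (Z s) j) (S' j) t)
    (hP : ∀ j, HasDerivAt (fun s => σ.peri (Z s) j) (P' j) t) :
    ∃ ν' : Fin (N + 1) → Vec3, (∀ j, HasDerivAt (fun s => σ.nodeNu (Z s) j) (ν' j) t) ∧
      ν' 0 = ![0, 0, 1] ⨯₃ S' 0 ∧ ∀ i : Fin N, ν' i.succ =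
        P' i.castSucc ⨯₃ partialSum (Z t) i.succ + σ.peri (Z t) i.castSucc ⨯₃ S' i.succ := by
  let ν' : Fin (N + 1) → Vec3 := Fin.cons (α := fun _ => Vec3) (![0, 0, 1] ⨯₃ S' 0) fun i =>
    P' i.castSucc ⨯₃ partialSum (Z t) i.succ + σ.peri (Z t) i.castSucc ⨯₃ S' i.succ
  have h0 : ν' 0 = ![0, 0, 1] ⨯₃ S' 0 := Fin.cons_zero _ _
  have hs : ∀ i : Fin N, ν' i.succ =
      P' i.castSucc ⨯₃ partialSum (Z t) i.succ + σ.peri (Z t) i.castSucc ⨯₃ S' i.succ :=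
    fun i => Fin.cons_succ _ _ _
  refine ⟨ν', fun j => ?_, h0, hs⟩
  induction j using Fin.cases with
  | zero =>
    rw [h0]
    have e := hasDerivAt_cross (hasDerivAt_const t (![0, 0, 1] : Vec3)) (hS 0)
    rwa [LinearMap.map_zero, LinearMap.zero_apply, zero_add] at e
  | succ i =>
    rw [hs]
    exact hasDerivAt_cross (hP _) (hS _)

theorem exists_nodeN_deriv (σ : PlanetarySystem N) {Z : ℝ → Phase (N + 1)} {t : ℝ}
    {S' P' : Fin (N + 1) → Vec3}
    (hS : ∀ j, HasDerivAt (fun s => partialSum (Z s) j) (S' j) t)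
    (hP : ∀ j, HasDerivAt (fun s => σ.peri (Z s) j) (P' j) t) :
    ∃ n' : Fin (N + 1) → Vec3, (∀ j, HasDerivAt (fun s => σ.nodeN (Z s) j) (n' j) t) ∧
      n' (Fin.last N) = P' (Fin.last N) ∧ ∀ i : Fin N, n' i.castSucc =
        S' i.castSucc ⨯₃ σ.peri (Z t) i.castSucc + partialSum (Z t) i.castSucc ⨯₃ P' i.castSucc := by
  let n' : Fin (N + 1) → Vec3 := Fin.snoc (α := fun _ => Vec3)
    (fun i : Fin N => S' i.castSucc ⨯₃ σ.peri (Z t) i.castSucc +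
      partialSum (Z t) i.castSucc ⨯₃ P' i.castSucc) (P' (Fin.last N))
  have hl : n' (Fin.last N) = P' (Fin.last N) := Fin.snoc_last _ _
  have hs : ∀ i : Fin N, n' i.castSucc =
      S' i.castSucc ⨯₃ σ.peri (Z t) i.castSucc + partialSum (Z t) i.castSucc ⨯₃ P' i.castSucc :=
    fun i => Fin.snoc_castSucc _ _ _
  refine ⟨n', fun j => ?_, hl, hs⟩
  rcases fin_cases_castSucc_or_last j with ⟨i, rfl⟩ | rfl
  · rw [hs]
    simp only [nodeN_castSucc]
    exact hasDerivAt_cross (hS _) (hP _)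
  · rw [hl]
    simp only [nodeN_last]
    exact hP _

/-- Pairing `κ` of a planet with `ϑ` of the next one produces `C · (P × P')` plus a difference of
rotation terms of consecutive nodes `ν̃`, and these differences telescope. -/
theorem node_form {Z : ℝ → Phase (N + 1)} {t : ℝ} (hdom : Z t ∈ σ.domain)
    {S' P' : Fin (N + 1) → Vec3} {k' v' : Fin (N + 1) → ℝ} {k v : Fin (N + 1) → ℝ → ℝ}
    (hS : ∀ j, HasDerivAt (fun s => partialSum (Z s) j) (S' j) t)
    (hP : ∀ j, HasDerivAt (fun s => σ.peri (Z s) j) (P' j) t)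
    (hk : ∀ j, HasDerivAt (k j) (k' j) t) (hv : ∀ j, HasDerivAt (v j) (v' j) t)
    (hkap : ∀ j, ∀ᶠ s in 𝓝 t, (k j s : Real.Angle) = σ.kappa (Z s) j)
    (hvar : ∀ j, ∀ᶠ s in 𝓝 t, (v j s : Real.Angle) = σ.vartheta (Z s) j) :
    ∑ j, chi (Z t) j * k' j + ∑ j, σ.Theta (Z t) j * v' j
      = ∑ j, angMom (Z t) j ⬝ᵥ (σ.peri (Z t) j ⨯₃ P' j) := by
  have h := (mem_domain_iff.1 hdom).1
  have hk3 : (![0, 0, 1] : Vec3) ≠ 0 := fun h => by simpa using congrFun h 2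
  have hk1 : (![1, 0, 0] : Vec3) ≠ 0 := fun h => by simpa using congrFun h 0
  have hlen3 : len ![0, 0, 1] = 1 := by simp [len]
  have hlenP : ∀ j, len (σ.peri (Z t) j) = 1 := fun j => by
    rw [len, (h.elliptic j).peri_dot_self, Real.sqrt_one]
  -- derivatives of the nodes
  obtain ⟨ν', hν, hν0', hνs⟩ := exists_nodeNu_deriv σ hS hP
  obtain ⟨n', hn, hnl, hns⟩ := exists_nodeN_deriv σ hS hP
  have hkd : ∀ j, chi (Z t) j * k' j =
      (partialSum (Z t) j ⬝ᵥ (σ.nodeN (Z t) j ⨯₃ n' j)) / (σ.nodeN (Z t) j ⬝ᵥ σ.nodeN (Z t) j) -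
      (partialSum (Z t) j ⬝ᵥ (σ.nodeNu (Z t) j ⨯₃ ν' j)) /
        (σ.nodeNu (Z t) j ⬝ᵥ σ.nodeNu (Z t) j) := fun j => by
    have e := angle_deriv (hν j) (hn j) (hS j) (hk j) (hkap j) (hdom.2 j).1 (hdom.2 j).2
      (h.partialSum_ne_zero j) (Eventually.of_forall fun s => nodeNu_dot_partialSum σ (Z s) j)
      (Eventually.of_forall fun s => nodeN_dot_partialSum σ (Z s) j)
    exact e
  have hv0 : v' 0 = (![0, 0, 1] ⬝ᵥ (σ.nodeNu (Z t) 0 ⨯₃ ν' 0)) /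
      (σ.nodeNu (Z t) 0 ⬝ᵥ σ.nodeNu (Z t) 0) := by
    have := angle_deriv_const (hν 0) (hv 0) (hvar 0) hk1 (hdom.2 0).1 hk3 (by simp)
      (Eventually.of_forall fun s => cross_dot_self_left _ _)
    rwa [hlen3, one_mul] at this
  have hvs : ∀ i : Fin N, v' i.succ =
      (σ.peri (Z t) i.castSucc ⬝ᵥ (σ.nodeNu (Z t) i.succ ⨯₃ ν' i.succ)) /
        (σ.nodeNu (Z t) i.succ ⬝ᵥ σ.nodeNu (Z t) i.succ) -
      (σ.peri (Z t) i.castSucc ⬝ᵥ (σ.nodeN (Z t) i.castSucc ⨯₃ n' i.castSucc)) /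
        (σ.nodeN (Z t) i.castSucc ⬝ᵥ σ.nodeN (Z t) i.castSucc) := fun i => by
    have := angle_deriv (hn i.castSucc) (hν i.succ) (hP i.castSucc) (hv i.succ) (hvar i.succ)
      (hdom.2 _).2 (hdom.2 _).1 (h.elliptic _).peri_ne_zero
      (Eventually.of_forall fun s => nodeN_castSucc_dot_peri σ (Z s) i)
      (Eventually.of_forall fun s => nodeNu_succ_dot_peri σ (Z s) i)
    rwa [hlenP, one_mul] at this
  set A : Fin (N + 1) → ℝ := fun j => (partialSum (Z t) j ⬝ᵥ (σ.nodeNu (Z t) j ⨯₃ ν' j)) /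
        (σ.nodeNu (Z t) j ⬝ᵥ σ.nodeNu (Z t) j) with hA
  -- The first node stays horizontal, so `ν × ν'` is vertical and only the third component of the
  -- total angular momentum matters.
  have hzero : σ.Theta (Z t) 0 * v' 0 = A 0 := by
    have h1 := (dot_self_pos (hdom.2 0).1).ne'
    have h2 : partialSum (Z t) 0 ⬝ᵥ (σ.nodeNu (Z t) 0 ⨯₃ ν' 0) =
        σ.Theta (Z t) 0 * (![0, 0, 1] ⬝ᵥ (σ.nodeNu (Z t) 0 ⨯₃ ν' 0)) := by
      rw [hν0', nodeNu_zero, Theta_zero]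
      simp only [dot3, cross_zero, cross_one, cross_two]
      simp
    simp only [hA]
    rw [hv0, h2]
    ring
  have hlast : chi (Z t) (Fin.last N) * k' (Fin.last N) =
      angMom (Z t) (Fin.last N) ⬝ᵥ (σ.peri (Z t) (Fin.last N) ⨯₃ P' (Fin.last N))
        - A (Fin.last N) := by
    rw [hkd, hnl, nodeN_last, (h.elliptic _).peri_dot_self, div_one, partialSum_last]
    simp only [hA, partialSum_last]
  -- Both instances of `node_identity` carry the same `Θ`, so subtracting them leaves the difference
  -- of the two partial sums, which is `C`.
  have hmid : ∀ i : Fin N, chi (Z t) i.castSucc * k' i.castSucc + σ.Theta (Z t) i.succ * v' i.succ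
      = angMom (Z t) i.castSucc ⬝ᵥ (σ.peri (Z t) i.castSucc ⨯₃ P' i.castSucc)
        + A i.succ - A i.castSucc := fun i => by
    have e1 := node_identity (S := partialSum (Z t) i.castSucc)
      (h.elliptic i.castSucc).peri_dot_self (S' i.castSucc) (P' i.castSucc)
    have e2 := node_identity (S := partialSum (Z t) i.succ)
      (h.elliptic i.castSucc).peri_dot_self (S' i.succ) (P' i.castSucc)
    rw [← hns, ← nodeN_castSucc, ← Theta_succ'] at e1
    have e3 : partialSum (Z t) i.succ ⨯₃ σ.peri (Z t) i.castSucc = -σ.nodeNu (Z t) i.succ := by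
      rw [nodeNu_succ, cross_anticomm]
    have e4 : S' i.succ ⨯₃ σ.peri (Z t) i.castSucc + partialSum (Z t) i.succ ⨯₃ P' i.castSucc
        = -ν' i.succ := by
      rw [hνs, neg_add, cross_anticomm, cross_anticomm, add_comm]
    rw [e3, e4, ← Theta_succ] at e2
    simp only [map_neg, LinearMap.neg_apply, neg_neg, neg_dotProduct, dotProduct_neg] at e2
    have h1 := (dot_self_pos (hdom.2 i.castSucc).2).ne'
    have h2 := (dot_self_pos (hdom.2 i.succ).1).ne'
    have e5 : angMom (Z t) i.castSucc = partialSum (Z t) i.castSucc - partialSum (Z t) i.succ := by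
      rw [partialSum_castSucc, add_sub_cancel_right]
    rw [hkd, hvs, e5, sub_dotProduct]
    simp only [hA]
    have q1 := congrArg (· / (σ.nodeN (Z t) i.castSucc ⬝ᵥ σ.nodeN (Z t) i.castSucc)) e1
    have q2 := congrArg (· / (σ.nodeNu (Z t) i.succ ⬝ᵥ σ.nodeNu (Z t) i.succ)) e2
    rw [mul_div_cancel_left₀ _ h1] at q1
    rw [mul_div_cancel_left₀ _ h2] at q2
    linear_combination q1 - q2
  rw [Fin.sum_univ_castSucc (fun j => chi (Z t) j * k' j),
    Fin.sum_univ_succ (fun j => σ.Theta (Z t) j * v' j), hlast, hzero,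
    Fin.sum_univ_castSucc (fun j => angMom (Z t) j ⬝ᵥ (σ.peri (Z t) j ⨯₃ P' j))]
  have e1 := Finset.sum_congr (s₁ := Finset.univ) rfl fun i _ => hmid i
  have e2 : A 0 + ∑ i : Fin N, A i.succ = ∑ i : Fin N, A i.castSucc + A (Fin.last N) := by
    rw [← Fin.sum_univ_succ, Fin.sum_univ_castSucc]
  rw [Finset.sum_add_distrib, Finset.sum_sub_distrib, Finset.sum_add_distrib] at e1
  linarith

/-- The one-form `y · dx` is `Λ dℓ + χ dκ + Θ dϑ + d(2 x · y)`. -/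
theorem liouville_form {Z : ℝ → Phase (N + 1)} {t : ℝ} {Z' : Phase (N + 1)}
    (hZ : HasDerivAt Z Z' t) (hdom : Z t ∈ σ.domain) {Φ : ℝ → Coord (N + 1)} {Φ' : Coord (N + 1)}
    (hΦ : HasDerivAt Φ Φ' t) (h : ∀ᶠ s in 𝓝 t, toTorus (Φ s) = σ.pStar (Z s)) :
    ∑ i, (Z t).1 i ⬝ᵥ Z'.2 i = ∑ a, ∑ i, (Φ t).1 a i * Φ'.2 a i +
      2 * ∑ i, (Z'.1 i ⬝ᵥ (Z t).2 i + (Z t).1 i ⬝ᵥ Z'.2 i) := by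
  have hreg := (mem_domain_iff.1 hdom).1
  have hcomp : ∀ {F : Type} [NormedAddCommGroup F] [NormedSpace ℝ F] {G : Phase (N + 1) → F},
      ContDiffAt ℝ 1 G (Z t) → HasDerivAt (fun s => G (Z s)) (fderiv ℝ G (Z t) Z') t :=
    fun hG => (hG.differentiableAt one_ne_zero).hasFDerivAt.comp_hasDerivAt t hZ
  have hx : ∀ i, HasDerivAt (fun s => (Z s).2 i) (Z'.2 i) t := fun i =>
    (hasDerivAt_pi.1 hZ.snd i)
  have hy : ∀ i, HasDerivAt (fun s => (Z s).1 i) (Z'.1 i) t := fun i =>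
    (hasDerivAt_pi.1 hZ.fst i)
  have hang : ∀ a i, HasDerivAt (fun s => (Φ s).2 a i) (Φ'.2 a i) t := fun a i =>
    hasDerivAt_pi.1 (hasDerivAt_pi.1 hΦ.snd a) i
  have hco : ∀ a i, ∀ᶠ s in 𝓝 t, ((Φ s).2 a i : Real.Angle) = (σ.pStar (Z s)).2 a i := fun a i =>
    h.mono fun s hs => congrFun (congrFun (congrArg Prod.snd hs) a) i
  have hact : (Φ t).1 = (σ.pStar (Z t)).1 := congrArg Prod.fst h.self_of_nhds
  have hP := fun j => hcomp (hreg.elliptic j).contDiffAt_peri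
  have hnode := node_form hdom (fun j => hcomp (contDiffAt_partialSum j)) hP (fun j => hang 1 j)
    (fun j => hang 2 j) (fun j => hco 1 j) (fun j => hco 2 j)
  have hplanet : ∀ i, (Z t).1 i ⬝ᵥ Z'.2 i = σ.Lam (Z t) i * Φ'.2 0 i
      + 2 * (Z'.1 i ⬝ᵥ (Z t).2 i + (Z t).1 i ⬝ᵥ Z'.2 i)
      + angMom (Z t) i ⬝ᵥ (σ.peri (Z t) i ⨯₃ fderiv ℝ (fun z => σ.peri z i) (Z t) Z') := fun i => by
    have hE := hreg.elliptic i
    have hEv : ∀ᶠ s in 𝓝 t, σ.Elliptic (Z s) i := hZ.continuousAt.eventually hE.eventually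
    obtain ⟨u, hu, -, hu'⟩ := exists_smooth_arg_lift (n := 1) hE.contDiffAt_eccNum
      hE.eccNum_ne_zero rfl
    have hu'' := hZ.continuousAt.eventually hu'
    have hud := hcomp hu
    have hl := hud.sub ((hcomp hE.contDiffAt_ecc).mul hud.sin)
    -- The given lift of `ℓ` and the one from Kepler's equation agree mod `2π`, hence have the same
    -- derivative.
    have hll := deriv_eq_of_coe_angle_eq (hang 0 i) hl (by
      filter_upwards [hco 0 i, hEv, hu''] with s h1 h2 h3
      rw [h1]
      exact h2.meanAnomaly_eq h3)
    have := kepler_form hEv (hx i) (hy i) (hP i) (hcomp hE.contDiffAt_semiMajor)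
      (hcomp hE.contDiffAt_ecc) hu'' hud.differentiableAt hl
    rw [hll]
    exact this
  rw [Finset.sum_congr rfl fun i _ => hplanet i, Finset.sum_add_distrib, Finset.sum_add_distrib,
    ← hnode, Fin.sum_univ_three, hact, Finset.mul_sum]
  simp only [pStar, Matrix.cons_val_zero, Matrix.cons_val_one, Matrix.cons_val]
  ring

end PlanetarySystem

/-! ### Exterior derivative of the one-form -/

section Exterior

variable {E : Type*} [NormedAddCommGroup E] [NormedSpace ℝ E]

theorem fderiv_fderiv_sum_mul {ι : Type*} [Fintype ι] {p q : ι → E → ℝ} {x : E}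
    (hp : ∀ a, ContDiffAt ℝ 2 (p a) x) (hq : ∀ a, ContDiffAt ℝ 2 (q a) x) :
    HasFDerivAt (fun z => ∑ a, p a z • fderiv ℝ (q a) z)
      (∑ a, (p a x • fderiv ℝ (fderiv ℝ (q a)) x + (fderiv ℝ (p a) x).smulRight (fderiv ℝ (q a) x)))
      x := by
  refine HasFDerivAt.fun_sum fun a _ => ?_
  have h1 : DifferentiableAt ℝ (fderiv ℝ (q a)) x :=
    ((hq a).fderiv_right (m := 1) le_rfl).differentiableAt one_ne_zero
  exact ((hp a).differentiableAt two_ne_zero).hasFDerivAt.smul h1.hasFDerivAt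

/-- If the one-forms `∑ p dq` and `∑ p' dq' + dg` coincide near a point, so do the two-forms
`∑ dp ∧ dq` and `∑ dp' ∧ dq'` at that point. -/
theorem sum_wedge_eq_of_one_form_eq {ι κ : Type*} [Fintype ι] [Fintype κ] {p q : ι → E → ℝ}
    {p' q' : κ → E → ℝ} {g : E → ℝ} {x : E}
    (hp : ∀ a, ContDiffAt ℝ 2 (p a) x) (hq : ∀ a, ContDiffAt ℝ 2 (q a) x)
    (hp' : ∀ a, ContDiffAt ℝ 2 (p' a) x) (hq' : ∀ a, ContDiffAt ℝ 2 (q' a) x)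
    (hg : ContDiffAt ℝ 2 g x)
    (h : ∀ᶠ z in 𝓝 x, ∑ a, p a z • fderiv ℝ (q a) z =
      ∑ b, p' b z • fderiv ℝ (q' b) z + fderiv ℝ g z) (u v : E) :
    ∑ a, (fderiv ℝ (p a) x u * fderiv ℝ (q a) x v - fderiv ℝ (p a) x v * fderiv ℝ (q a) x u) =
    ∑ b, (fderiv ℝ (p' b) x u * fderiv ℝ (q' b) x v
      - fderiv ℝ (p' b) x v * fderiv ℝ (q' b) x u) := by
  have d1 := fderiv_fderiv_sum_mul hp hq
  have d2 := fderiv_fderiv_sum_mul hp' hq'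
  have d3 : DifferentiableAt ℝ (fderiv ℝ g) x :=
    (hg.fderiv_right (m := 1) le_rfl).differentiableAt one_ne_zero
  have e := d1.unique ((d2.add d3.hasFDerivAt).congr_of_eventuallyEq h)
  -- Antisymmetrisation is the exterior derivative: the symmetric second derivatives of `q`, `q'`
  -- and `g` drop out.
  have e1 := congrArg (fun L => L u v - L v u) e
  have sy : ∀ {r : E → ℝ}, ContDiffAt ℝ 2 r x → fderiv ℝ (fderiv ℝ r) x u v =
      fderiv ℝ (fderiv ℝ r) x v u := fun hr =>
    (hr.isSymmSndFDerivAt (by simp)) u v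
  simp only [_root_.add_apply, _root_.sum_apply,
    _root_.smul_apply, ContinuousLinearMap.smulRight_apply, smul_eq_mul, sy hg,
    sy (hq _), sy (hq' _)] at e1
  simp only [Finset.sum_add_distrib, Finset.sum_sub_distrib] at e1 ⊢
  linarith

end Exterior
end Planetary

namespace Planetary

open Filter Topology

namespace PlanetarySystem

variable {N : ℕ} {σ : PlanetarySystem N} {z : Phase (N + 1)}

/-! ### The coordinates are canonical -/

theorem fderiv_fst_apply {E α β : Type} [NormedAddCommGroup E] [NormedSpace ℝ E] [Fintype α]
    [Fintype β] {F : E → (α → β → ℝ) × (α → β → ℝ)} {x : E} (hF : DifferentiableAt ℝ F x)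
    (a : α) (b : β) (v : E) :
    fderiv ℝ (fun z => (F z).1 a b) x v = (fderiv ℝ F x v).1 a b := by
  have h := hasFDerivAt_pi'.1 (hasFDerivAt_pi'.1 hF.hasFDerivAt.fst a) b
  rw [h.fderiv]
  rfl

theorem fderiv_snd_apply {E α β : Type} [NormedAddCommGroup E] [NormedSpace ℝ E] [Fintype α]
    [Fintype β] {F : E → (α → β → ℝ) × (α → β → ℝ)} {x : E} (hF : DifferentiableAt ℝ F x)
    (a : α) (b : β) (v : E) :
    fderiv ℝ (fun z => (F z).2 a b) x v = (fderiv ℝ F x v).2 a b := by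
  have h := hasFDerivAt_pi'.1 (hasFDerivAt_pi'.1 hF.hasFDerivAt.snd a) b
  rw [h.fderiv]
  rfl

/-- The exterior derivative of `liouville_form`, whose hypotheses are met along the straight lines
`z' + s v` through all nearby points. -/
theorem stdForm_fderiv_lift (hz : z ∈ σ.domain) {F : Phase (N + 1) → Coord (N + 1)}
    (hF : ContDiffAt ℝ 2 F z) (h : ∀ᶠ z' in 𝓝 z, toTorus (F z') = σ.pStar z')
    (u v : Phase (N + 1)) : stdForm (fderiv ℝ F z u) (fderiv ℝ F z v) = stdForm u v := by
  have hF' : ∀ᶠ z' in 𝓝 z, DifferentiableAt ℝ F z' := by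
    filter_upwards [hF.eventually (by simp)] with z' hz' using hz'.differentiableAt two_ne_zero
  have hg : ∀ z' : Phase (N + 1),
      ContDiffAt ℝ 2 (fun z' : Phase (N + 1) => 2 * ∑ i, z'.1 i ⬝ᵥ z'.2 i) z' := fun z' =>
    contDiffAt_const.mul (ContDiffAt.sum fun i _ =>
      contDiffAt_dot (contDiffAt_mom i) (contDiffAt_pos i))
  have hid : ∀ z' : Phase (N + 1), DifferentiableAt ℝ (fun z : Phase (N + 1) => z) z' :=
    fun z' => differentiableAt_id
  have hfid : ∀ (z' v : Phase (N + 1)), fderiv ℝ (fun z : Phase (N + 1) => z) z' v = v :=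
    fun z' v => by rw [fderiv_fun_id]; rfl
  have key := sum_wedge_eq_of_one_form_eq (x := z)
    (p := fun a : Fin (N + 1) × Fin 3 => fun z' : Phase (N + 1) => z'.1 a.1 a.2)
    (q := fun a : Fin (N + 1) × Fin 3 => fun z' : Phase (N + 1) => z'.2 a.1 a.2)
    (p' := fun a : Fin 3 × Fin (N + 1) => fun z' => (F z').1 a.1 a.2)
    (q' := fun a : Fin 3 × Fin (N + 1) => fun z' => (F z').2 a.1 a.2)
    (fun a => by fun_prop) (fun a => by fun_prop)
    (fun a => contDiffAt_pi.1 (contDiffAt_pi.1 hF.fst a.1) a.2)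
    (fun a => contDiffAt_pi.1 (contDiffAt_pi.1 hF.snd a.1) a.2) (hg z) ?_ u v
  · have hd := hF'.self_of_nhds
    simp only [fderiv_fst_apply hd, fderiv_snd_apply hd, fderiv_fst_apply (hid z),
      fderiv_snd_apply (hid z), hfid, Fintype.sum_prod_type] at key
    simp only [stdForm]
    exact key.symm
  · filter_upwards [hF', h.eventually_nhds, (isOpen_domain σ).mem_nhds hz] with z' h1 h2 h3
    refine ContinuousLinearMap.ext fun v => ?_
    have hZ : HasDerivAt (fun s : ℝ => z' + s • v) v 0 := by
      simpa using ((hasDerivAt_id (0 : ℝ)).smul_const v).const_add z'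
    have hz0 : z' + (0 : ℝ) • v = z' := by simp
    have hΦ : HasDerivAt (fun s : ℝ => F (z' + s • v)) (fderiv ℝ F z' v) 0 :=
      h1.hasFDerivAt.hasLineDerivAt v
    have hG : HasDerivAt (fun s : ℝ => 2 * ∑ i, (z' + s • v).1 i ⬝ᵥ (z' + s • v).2 i)
        (fderiv ℝ (fun z' : Phase (N + 1) => 2 * ∑ i, z'.1 i ⬝ᵥ z'.2 i) z' v) 0 :=
      ((hg z').differentiableAt two_ne_zero).hasFDerivAt.hasLineDerivAt v
    have hx : ∀ i, HasDerivAt (fun s : ℝ => (z' + s • v).2 i) (v.2 i) 0 := fun i =>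
      (hasDerivAt_pi.1 hZ.snd i)
    have hy : ∀ i, HasDerivAt (fun s : ℝ => (z' + s • v).1 i) (v.1 i) 0 := fun i =>
      (hasDerivAt_pi.1 hZ.fst i)
    have hG' := hG.unique ((HasDerivAt.fun_sum fun i (_ : i ∈ Finset.univ) =>
      hasDerivAt_dot (hy i) (hx i)).const_mul 2)
    have hev : ∀ᶠ s in 𝓝 (0 : ℝ), toTorus (F (z' + s • v)) = σ.pStar (z' + s • v) := by
      refine hZ.continuousAt.eventually (p := fun z => toTorus (F z) = σ.pStar z) ?_
      beta_reduce; rw [hz0]; exact h2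
    have hL := liouville_form hZ (by rw [hz0]; exact h3) hΦ hev
    simp only [hz0] at hL hG'
    simp only [_root_.add_apply, _root_.sum_apply, _root_.smul_apply, smul_eq_mul, hG',
      fderiv_snd_apply h1, fderiv_snd_apply (hid z'), hfid,
      Fintype.sum_prod_type]
    simpa only [dotProduct] using hL

theorem stdForm_nondegenerate {α β : Type} [Fintype α] [Fintype β] [DecidableEq α] [DecidableEq β]
    {u : (α → β → ℝ) × (α → β → ℝ)} (h : ∀ v, stdForm u v = 0) : u = 0 := by
  -- Against this vector the form is the sum of the squares of the components of `u`.
  have h1 := h (-u.2, u.1)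
  simp only [stdForm, Pi.neg_apply] at h1
  have h2 : ∑ a, ∑ b, (u.1 a b * u.1 a b + u.2 a b * u.2 a b) = 0 := by
    rw [← h1]
    exact Finset.sum_congr rfl fun a _ => Finset.sum_congr rfl fun b _ => by ring
  have h3 : ∀ a b, u.1 a b * u.1 a b + u.2 a b * u.2 a b = 0 := fun a b => by
    have h4 := (Finset.sum_eq_zero_iff_of_nonneg fun a _ => Finset.sum_nonneg fun b _ =>
      add_nonneg (mul_self_nonneg (u.1 a b)) (mul_self_nonneg (u.2 a b))).1 h2 a (Finset.mem_univ a)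
    exact (Finset.sum_eq_zero_iff_of_nonneg fun b _ =>
      add_nonneg (mul_self_nonneg (u.1 a b)) (mul_self_nonneg (u.2 a b))).1 h4 b (Finset.mem_univ b)
  refine Prod.ext (funext fun a => funext fun b => ?_) (funext fun a => funext fun b => ?_)
  · have := h3 a b
    exact mul_self_eq_zero.1 (by nlinarith [mul_self_nonneg (u.1 a b), mul_self_nonneg (u.2 a b)])
  · have := h3 a b
    exact mul_self_eq_zero.1 (by nlinarith [mul_self_nonneg (u.1 a b), mul_self_nonneg (u.2 a b)])

theorem phi_mem {w : Coord (N + 1)} (hw : w ∈ σ.range) : σ.phi w ∈ σ.domain :=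
  Function.invFunOn_mem hw

theorem pStar_phi {w : Coord (N + 1)} (hw : w ∈ σ.range) : σ.pStar (σ.phi w) = toTorus w :=
  Function.invFunOn_eq hw

theorem mem_range {w : Coord (N + 1)} (hz : z ∈ σ.domain) (h : toTorus w = σ.pStar z) :
    w ∈ σ.range := ⟨z, hz, h.symm⟩

theorem phi_eq {w : Coord (N + 1)} (hz : z ∈ σ.domain) (h : toTorus w = σ.pStar z) :
    σ.phi w = z :=
  pStar_injOn σ (phi_mem (mem_range hz h)) hz ((pStar_phi (mem_range hz h)).trans h)

/-- A map preserving a non-degenerate form has injective differential, and the dimensions agree, so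
a smooth lift has a smooth local inverse. -/
theorem phi_local {w : Coord (N + 1)} (hw : w ∈ σ.range) :
    σ.range ∈ 𝓝 w ∧ ContDiffAt ℝ ∞ σ.phi w ∧ ∀ u v : Coord (N + 1),
      stdForm (fderiv ℝ σ.phi w u) (fderiv ℝ σ.phi w v) = stdForm u v := by
  have hz := phi_mem hw
  obtain ⟨F, hF, hFz, hev⟩ := exists_smooth_lift (n := ∞) hz (pStar_phi hw).symm
  have hsymp := stdForm_fderiv_lift hz (contDiffAt_infty.1 hF 2) hev
  have hinj : Function.Injective (fderiv ℝ F (σ.phi w) : Phase (N + 1) →ₗ[ℝ] Coord (N + 1)) := by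
    rw [← LinearMap.ker_eq_bot, LinearMap.ker_eq_bot']
    intro u hu
    refine stdForm_nondegenerate fun v => ?_
    rw [← hsymp u v]
    have : fderiv ℝ F (σ.phi w) u = 0 := hu
    simp [this, stdForm]
  have hdim : Module.finrank ℝ (Phase (N + 1)) = Module.finrank ℝ (Coord (N + 1)) := by
    simp [Phase, Coord, Vec3, Module.finrank_pi_fintype, Module.finrank_prod, mul_comm]
  let e : Phase (N + 1) ≃L[ℝ] Coord (N + 1) :=
    (LinearMap.linearEquivOfInjective _ hinj hdim).toContinuousLinearEquiv
  have he : HasFDerivAt F (e : Phase (N + 1) →L[ℝ] Coord (N + 1)) (σ.phi w) := by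
    have h1 := (hF.differentiableAt (by simp)).hasFDerivAt
    have h2 : (e : Phase (N + 1) →L[ℝ] Coord (N + 1)) = fderiv ℝ F (σ.phi w) := by
      exact ContinuousLinearMap.ext fun v => rfl
    rw [h2]; exact h1
  have hn : (∞ : ℕ∞ω) ≠ 0 := by simp
  set G := hF.localInverse he hn with hGdef
  have hGc : ContDiffAt ℝ ∞ G w := by
    have := hF.to_localInverse he hn
    rwa [hFz] at this
  have hGw : G w = σ.phi w := by
    have := hF.localInverse_apply_image he hn
    rwa [hFz] at this
  have hright : ∀ᶠ w' in 𝓝 w, F (G w') = w' := by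
    have := (hF.hasStrictFDerivAt' he hn).eventually_right_inverse
    rw [hFz] at this
    exact this
  have hdom : ∀ᶠ w' in 𝓝 w, G w' ∈ σ.domain ∧ toTorus (F (G w')) = σ.pStar (G w') := by
    have h : ∀ᶠ z in 𝓝 (G w), z ∈ σ.domain ∧ toTorus (F z) = σ.pStar z := by
      rw [hGw]
      exact Filter.Eventually.and ((isOpen_domain σ).mem_nhds hz) hev
    exact hGc.continuousAt.eventually h
  -- Global injectivity of the coordinates forces the chosen inverse `phi` to coincide with the
  -- local one.
  have hphi : σ.phi =ᶠ[𝓝 w] G := by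
    filter_upwards [hright, hdom] with w' h1 h2
    rw [h1] at h2
    exact phi_eq h2.1 h2.2
  refine ⟨?_, hGc.congr_of_eventuallyEq hphi, fun u v => ?_⟩
  · filter_upwards [hright, hdom] with w' h1 h2
    rw [h1] at h2
    exact mem_range h2.1 h2.2
  · have hGd := (hGc.differentiableAt hn).hasFDerivAt
    have hFd : HasFDerivAt F (fderiv ℝ F (σ.phi w)) (G w) := by
      rw [hGw]; exact (hF.differentiableAt hn).hasFDerivAt
    have hcomp := (hFd.comp w hGd).unique ((hasFDerivAt_id w).congr_of_eventuallyEq hright)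
    have hc : ∀ u, fderiv ℝ F (σ.phi w) (fderiv ℝ G w u) = u := fun u =>
      congrArg (fun L : Coord (N + 1) →L[ℝ] Coord (N + 1) => L u) hcomp
    rw [hphi.fderiv_eq, ← hsymp, hc, hc]

theorem isOpen_range (σ : PlanetarySystem N) : IsOpen σ.range :=
  isOpen_iff_mem_nhds.2 fun _ hw => (phi_local hw).1

theorem isOpen_freeRange (σ : PlanetarySystem N) : IsOpen σ.freeRange := by
  rw [isOpen_iff_mem_nhds]
  rintro w ⟨hw, hc⟩
  have h1 := (phi_local hw).2.1.continuousAt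
  have h2 : ∀ᶠ w' in 𝓝 w, ∀ i j, i ≠ j → (σ.phi w').2 i ≠ (σ.phi w').2 j := by
    refine eventually_all.2 fun i => eventually_all.2 fun j => ?_
    by_cases hij : i = j
    · exact Eventually.of_forall fun _ h => absurd hij h
    · have hi : ∀ i, ContinuousAt (fun w' => (σ.phi w').2 i) w := fun i =>
        (continuousAt_pi.1 h1.snd i)
      filter_upwards [((hi i).sub (hi j)).eventually_ne (sub_ne_zero.2 (hc i j hij))] with w' h _ h'
      exact h (sub_eq_zero.2 h')
  exact Filter.inter_mem ((isOpen_range σ).mem_nhds hw) h2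

/-! ### The reduced perturbing function -/

theorem sameShape_iff {w : Coord (N + 1)} (hw : w ∈ σ.range) : σ.SameShape z (σ.phi w) ↔
    σ.Lam z = w.1 0 ∧ chi z = w.1 1 ∧ (∀ i : Fin N, σ.Theta z i.succ = w.1 2 i.succ) ∧
    (∀ i, σ.meanAnomaly z i = (w.2 0 i : Real.Angle)) ∧
    (∀ i : Fin N, σ.kappa z i.succ = (w.2 1 i.succ : Real.Angle)) ∧
    ∀ i : Fin N, σ.vartheta z i.succ = (w.2 2 i.succ : Real.Angle) := by
  have h := pStar_phi hw
  have h1 := congrArg Prod.fst h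
  have h2 := congrArg Prod.snd h
  have a0 : σ.Lam (σ.phi w) = w.1 0 := congrFun h1 0
  have a1 : chi (σ.phi w) = w.1 1 := congrFun h1 1
  have a2 : σ.Theta (σ.phi w) = w.1 2 := congrFun h1 2
  have b0 : σ.meanAnomaly (σ.phi w) = fun i => (w.2 0 i : Real.Angle) := congrFun h2 0
  have b1 : σ.kappa (σ.phi w) = fun i => (w.2 1 i : Real.Angle) := congrFun h2 1
  have b2 : σ.vartheta (σ.phi w) = fun i => (w.2 2 i : Real.Angle) := congrFun h2 2
  constructor
  · rintro ⟨c1, c2, c3, c4, c5, c6⟩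
    rw [a0] at c1; rw [b0] at c2; rw [a1] at c3; rw [a2] at c4; rw [b1] at c5; rw [b2] at c6
    exact ⟨c1, c3, c4, fun i => congrFun c2 i, c5, c6⟩
  · rintro ⟨c1, c3, c4, c2, c5, c6⟩
    refine ⟨c1.trans a0.symm, (funext c2).trans b0.symm, c3.trans a1.symm, ?_, ?_, ?_⟩
    · rw [a2]; exact c4
    · rw [b1]; exact c5
    · rw [b2]; exact c6

theorem regular_phi {w : Coord (N + 1)} (hw : w ∈ σ.range) : σ.Regular (σ.phi w) :=
  (mem_domain_iff.1 (phi_mem hw)).1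

theorem sameShape_refl (z : Phase (N + 1)) : σ.SameShape z z :=
  ⟨rfl, rfl, rfl, fun _ => rfl, fun _ => rfl, fun _ => rfl⟩

theorem sameShape_phi {w w' : Coord (N + 1)} (hw : w ∈ σ.range) (hw' : w' ∈ σ.range)
    (h0 : w.1 0 = w'.1 0) (h1 : w.1 1 = w'.1 1) (h2 : ∀ i : Fin N, w.1 2 i.succ = w'.1 2 i.succ)
    (h3 : w.2 0 = w'.2 0) (h4 : ∀ i : Fin N, w.2 1 i.succ = w'.2 1 i.succ)
    (h5 : ∀ i : Fin N, w.2 2 i.succ = w'.2 2 i.succ) : σ.SameShape (σ.phi w) (σ.phi w') := by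
  obtain ⟨c1, c2, c3, c4, c5, c6⟩ := (sameShape_iff hw).1 (sameShape_refl (σ.phi w))
  rw [sameShape_iff hw', ← h0, ← h1, ← h3]
  refine ⟨c1, c2, fun i => ?_, c4, fun i => ?_, fun i => ?_⟩
  · rw [← h2, c3]
  · rw [← h4, c5]
  · rw [← h5, c6]

theorem sum_twoBody_phi {w : Coord (N + 1)} (hw : w ∈ σ.range) :
    ∑ i, σ.twoBody i (σ.phi w) = σ.hKep (w.1 0) := by
  rw [hKep]
  refine Finset.sum_congr rfl fun i _ => ?_
  rw [((regular_phi hw).elliptic i).twoBody_eq]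
  have := ((sameShape_iff hw).1 (sameShape_refl (σ.phi w))).1
  rw [this]

theorem hStar_eq {w : Coord (N + 1)} (hw : w ∈ σ.range) :
    σ.hStar w = σ.hKep (w.1 0) + σ.μ * σ.fHel (σ.phi w) := by
  rw [hStar, hHel, sum_twoBody_phi hw]

theorem hStar_eq_of_eq {w w' : Coord (N + 1)} (hw : w ∈ σ.range) (hw' : w' ∈ σ.range)
    (h0 : w.1 0 = w'.1 0) (h1 : w.1 1 = w'.1 1) (h2 : ∀ i : Fin N, w.1 2 i.succ = w'.1 2 i.succ)
    (h3 : w.2 0 = w'.2 0) (h4 : ∀ i : Fin N, w.2 1 i.succ = w'.2 1 i.succ)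
    (h5 : ∀ i : Fin N, w.2 2 i.succ = w'.2 2 i.succ) : σ.hStar w = σ.hStar w' := by
  rw [hStar_eq hw, hStar_eq hw', h0,
    (sameShape_phi hw hw' h0 h1 h2 h3 h4 h5).fHel_eq (regular_phi hw) (regular_phi hw')]

/-! ### Cyclic variables and integrals of motion. -/

/-- `H` has zero derivative along the cyclic directions `Θ₀`, `κ₀`, `ϑ₀`. -/
theorem fderiv_hStar_cyclic {w e : Coord (N + 1)} (hw : w ∈ σ.range)
    (h0 : e.1 0 = 0) (h1 : e.1 1 = 0) (h2 : ∀ i : Fin N, e.1 2 i.succ = 0) (h3 : e.2 0 = 0)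
    (h4 : ∀ i : Fin N, e.2 1 i.succ = 0) (h5 : ∀ i : Fin N, e.2 2 i.succ = 0) :
    fderiv ℝ σ.hStar w e = 0 := by
  by_cases hd : DifferentiableAt ℝ σ.hStar w
  · have hl : HasDerivAt (fun s : ℝ => σ.hStar (w + s • e)) (fderiv ℝ σ.hStar w e) 0 :=
      hd.hasFDerivAt.hasLineDerivAt e
    have hc : ContinuousAt (fun s : ℝ => w + s • e) 0 := by fun_prop
    have hev : ∀ᶠ s in 𝓝 (0 : ℝ), w + s • e ∈ σ.range := by
      refine hc.eventually ?_
      simpa using (isOpen_range σ).mem_nhds hw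
    refine hl.unique ((hasDerivAt_const (0 : ℝ) (σ.hStar w)).congr_of_eventuallyEq ?_)
    filter_upwards [hev] with s hs
    apply hStar_eq_of_eq hs hw <;> simp [h0, h1, h2, h3, h4, h5]
  -- Where the derivative does not exist `fderiv` is zero by convention, so collisions need no
  -- separate treatment here.
  · rw [fderiv_zero_of_not_differentiableAt hd]; rfl

theorem eq_of_hasDerivAt_zero {f : ℝ → ℝ} {s₀ s₁ : ℝ}
    (h : ∀ t ∈ Set.Ioo s₀ s₁, HasDerivAt f 0 t) {t t' : ℝ} (ht : t ∈ Set.Ioo s₀ s₁)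
    (ht' : t' ∈ Set.Ioo s₀ s₁) : f t = f t' :=
  isOpen_Ioo.is_const_of_deriv_eq_zero isPreconnected_Ioo
    (fun s hs => (h s hs).differentiableAt.differentiableWithinAt) (fun s hs => (h s hs).deriv)
    ht ht'

/-- The variables conjugate to `Θ₀, ϑ₀, χ₀` are `ϑ₀, Θ₀, κ₀`, and all three of the latter are
cyclic. -/
theorem integrals {γ : ℝ → Coord (N + 1)} {s₀ s₁ : ℝ}
    (hγ : ∀ t ∈ Set.Ioo s₀ s₁, γ t ∈ σ.range) (hm : IsHamiltonianMotion σ.hStar γ s₀ s₁)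
    {t t' : ℝ} (ht : t ∈ Set.Ioo s₀ s₁) (ht' : t' ∈ Set.Ioo s₀ s₁) :
    (γ t).1 2 0 = (γ t').1 2 0 ∧ (γ t).2 2 0 = (γ t').2 2 0 ∧ (γ t).1 1 0 = (γ t').1 1 0 := by
  refine ⟨eq_of_hasDerivAt_zero (f := fun s => (γ s).1 2 0) (fun s hs => ?_) ht ht',
    eq_of_hasDerivAt_zero (f := fun s => (γ s).2 2 0) (fun s hs => ?_) ht ht',
    eq_of_hasDerivAt_zero (f := fun s => (γ s).1 1 0) (fun s hs => ?_) ht ht'⟩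
  · have h1 := hasDerivAt_pi.1 (hasDerivAt_pi.1 (hm s hs).fst 2) 0
    refine h1.congr_deriv ?_
    simp only [neg_eq_zero]
    apply fderiv_hStar_cyclic (hγ s hs) <;> simp
  · have h1 := hasDerivAt_pi.1 (hasDerivAt_pi.1 (hm s hs).snd 2) 0
    refine h1.congr_deriv ?_
    apply fderiv_hStar_cyclic (hγ s hs) <;> simp
  · have h1 := hasDerivAt_pi.1 (hasDerivAt_pi.1 (hm s hs).fst 1) 0
    refine h1.congr_deriv ?_
    simp only [neg_eq_zero]
    apply fderiv_hStar_cyclic (hγ s hs) <;> simp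

/-- The perturbing function as a function of the coordinates that are invariant under rotations:
its value at any configuration without collisions with those coordinates. -/
noncomputable def reducedPert (σ : PlanetarySystem N) (c : ℝ) (Λ : Fin (N + 1) → ℝ)
    (χ Θ : Fin N → ℝ) (ℓ : Fin (N + 1) → ℝ) (κ ϑ : Fin N → ℝ) : ℝ :=
  σ.fHel (σ.phi (Classical.epsilon fun w : Coord (N + 1) => w ∈ σ.freeRange ∧ w.1 1 0 = c ∧
    w.1 0 = Λ ∧ Fin.tail (w.1 1) = χ ∧ Fin.tail (w.1 2) = Θ ∧ w.2 0 = ℓ ∧ Fin.tail (w.2 1) = κ ∧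
    Fin.tail (w.2 2) = ϑ))

/-- Whichever point is chosen has the same shape as `phi w`, hence differs from it by a rotation,
which leaves `f_hel` unchanged. -/
theorem fHel_phi_eq {w : Coord (N + 1)} (hw : w ∈ σ.freeRange) :
    σ.fHel (σ.phi w) = σ.reducedPert (w.1 1 0) (w.1 0) (Fin.tail (w.1 1)) (Fin.tail (w.1 2))
      (w.2 0) (Fin.tail (w.2 1)) (Fin.tail (w.2 2)) := by
  rw [reducedPert]
  generalize hP : (fun w' : Coord (N + 1) => w' ∈ σ.freeRange ∧ w'.1 1 0 = w.1 1 0 ∧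
    w'.1 0 = w.1 0 ∧ Fin.tail (w'.1 1) = Fin.tail (w.1 1) ∧ Fin.tail (w'.1 2) = Fin.tail (w.1 2) ∧
    w'.2 0 = w.2 0 ∧ Fin.tail (w'.2 1) = Fin.tail (w.2 1) ∧
    Fin.tail (w'.2 2) = Fin.tail (w.2 2)) = P
  have hex : ∃ w', P w' := ⟨w, by rw [← hP]; exact ⟨hw, rfl, rfl, rfl, rfl, rfl, rfl, rfl⟩⟩
  have hs := Classical.epsilon_spec hex
  generalize Classical.epsilon P = w' at hs
  rw [← hP] at hs
  obtain ⟨h0, h1, h2, h3, h4, h5, h6, h7⟩ := hs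
  refine (sameShape_phi hw.1 h0.1 h2.symm ?_ (fun i => (congrFun h4 i).symm) h5.symm
    (fun i => (congrFun h6 i).symm) (fun i => (congrFun h7 i).symm)).fHel_eq (regular_phi hw.1)
    (regular_phi h0.1)
  exact funext fun j => Fin.cases h1.symm (fun i => (congrFun h3 i).symm) j

theorem contDiffAt_fHel (hz : CollisionFree z) : ContDiffAt ℝ 1 σ.fHel z := by
  refine ContDiffAt.sum fun i _ => ContDiffAt.sum fun j hj => ?_
  have hij : z.2 i - z.2 j ≠ 0 := sub_ne_zero.2 (hz i j (Finset.mem_Ioi.1 hj).ne)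
  exact ((contDiffAt_dot (contDiffAt_mom i) (contDiffAt_mom j)).div_const _).sub
    (contDiffAt_const.div (contDiffAt_len ((contDiffAt_pos i).sub (contDiffAt_pos j)) hij)
      (len_ne_zero hij))

/-! ### Equilibria -/

/-- Replacement of the components of `Θ` and `ϑ` of positive index. -/
def insertTails (w : Coord (N + 1)) (p : (Fin N → ℝ) × (Fin N → ℝ)) : Coord (N + 1) :=
  (![w.1 0, w.1 1, Fin.cons (w.1 2 0) p.1], ![w.2 0, w.2 1, Fin.cons (w.2 2 0) p.2])

theorem insertTails_tail (w : Coord (N + 1)) :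
    insertTails w (Fin.tail (w.1 2), Fin.tail (w.2 2)) = w := by
  refine Prod.ext (funext fun a => ?_) (funext fun a => ?_) <;> fin_cases a <;>
    simp [insertTails]

theorem differentiable_insertTails (w : Coord (N + 1)) : Differentiable ℝ (insertTails w) := by
  refine Differentiable.prodMk (differentiable_pi.2 fun a => ?_) (differentiable_pi.2 fun a => ?_)
  · fin_cases a
    · exact differentiable_const _
    · exact differentiable_const _
    · refine differentiable_pi.2 fun i => ?_
      induction i using Fin.cases with
      | zero => simp
      | succ i => simp; fun_prop
  · fin_cases a
    · exact differentiable_const _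
    · exact differentiable_const _
    · refine differentiable_pi.2 fun i => ?_
      induction i using Fin.cases with
      | zero => simp
      | succ i => simp; fun_prop

/-- Evenness equates the first-order expansions along `q` and `-q`, so the differential is its own
opposite. -/
theorem hasFDerivAt_zero_of_even {E : Type*} [NormedAddCommGroup E] [NormedSpace ℝ E] {h : E → ℝ}
    {p : E} (hd : DifferentiableAt ℝ h p) (he : ∀ᶠ q in 𝓝 (0 : E), h (p + q) = h (p - q)) :
    HasFDerivAt h (0 : E →L[ℝ] ℝ) p := by
  have h1 : HasFDerivAt (fun q => h (p + q)) (fderiv ℝ h p) 0 := by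
    have e : HasFDerivAt (fun q : E => p + q) (ContinuousLinearMap.id ℝ E) 0 :=
      (hasFDerivAt_id (0 : E)).const_add p
    have := HasFDerivAt.comp (0 : E) (g := h) (g' := fderiv ℝ h p) (by
      simpa using hd.hasFDerivAt) e
    rwa [ContinuousLinearMap.comp_id] at this
  have h2 : HasFDerivAt (fun q => h (p - q)) (-fderiv ℝ h p) 0 := by
    have e : HasFDerivAt (fun q : E => p - q) (-ContinuousLinearMap.id ℝ E) 0 :=
      (hasFDerivAt_id (0 : E)).const_sub p
    have := HasFDerivAt.comp (0 : E) (g := h) (g' := fderiv ℝ h p) (by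
      simpa using hd.hasFDerivAt) e
    rwa [ContinuousLinearMap.comp_neg, ContinuousLinearMap.comp_id] at this
  have h3 := h1.unique (h2.congr_of_eventuallyEq he)
  have h4 : fderiv ℝ h p = 0 := by
    ext v
    have := congrArg (fun L : E →L[ℝ] ℝ => L v) h3
    simp only [_root_.neg_apply] at this
    have : fderiv ℝ h p v = 0 := by linarith
    simpa using this
  rw [← h4]
  exact hd.hasFDerivAt

theorem equilibrium {w : Coord (N + 1)} (hw : w ∈ σ.freeRange)
    (hk : ∃ k : Fin N → Fin 2, ∀ j : Fin N, w.1 2 j.succ = 0 ∧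
      (w.2 2 j.succ : Real.Angle) = ((Real.pi * ((k j : ℕ) : ℝ) : ℝ) : Real.Angle)) :
    HasFDerivAt (fun p : (Fin N → ℝ) × (Fin N → ℝ) =>
      σ.reducedPert (w.1 1 0) (w.1 0) (Fin.tail (w.1 1)) p.1 (w.2 0) (Fin.tail (w.2 1)) p.2)
      (0 : (Fin N → ℝ) × (Fin N → ℝ) →L[ℝ] ℝ) (Fin.tail (w.1 2), Fin.tail (w.2 2)) := by
  obtain ⟨k, hk⟩ := hk
  set p₀ : (Fin N → ℝ) × (Fin N → ℝ) := (Fin.tail (w.1 2), Fin.tail (w.2 2)) with hp₀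
  have hi0 : insertTails w p₀ = w := insertTails_tail w
  have hic := (differentiable_insertTails w).continuous
  have hev : ∀ᶠ p in 𝓝 p₀, insertTails w p ∈ σ.freeRange := by
    refine hic.continuousAt.eventually ?_
    rw [hi0]; exact (isOpen_freeRange σ).mem_nhds hw
  have heq : ∀ p, insertTails w p ∈ σ.freeRange →
      σ.reducedPert (w.1 1 0) (w.1 0) (Fin.tail (w.1 1)) p.1 (w.2 0) (Fin.tail (w.2 1)) p.2
        = σ.fHel (σ.phi (insertTails w p)) := fun p hp => by
    rw [fHel_phi_eq hp]
    simp [insertTails]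
  refine hasFDerivAt_zero_of_even ?_ ?_
  · have h1 : DifferentiableAt ℝ (fun w' => σ.fHel (σ.phi w')) (insertTails w p₀) := by
      rw [hi0]
      exact ((contDiffAt_fHel hw.2).differentiableAt one_ne_zero).comp w
        ((phi_local hw.1).2.1.differentiableAt (by simp))
    exact (h1.comp p₀ (differentiable_insertTails w p₀)).congr_of_eventuallyEq
      (hev.mono fun p hp => heq p hp)
  · have c1 : ContinuousAt (fun q : (Fin N → ℝ) × (Fin N → ℝ) => p₀ + q) 0 := by fun_prop
    have c2 : ContinuousAt (fun q : (Fin N → ℝ) × (Fin N → ℝ) => p₀ - q) 0 := by fun_prop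
    have e1 := c1.eventually (p := fun p => insertTails w p ∈ σ.freeRange) (by simpa using hev)
    have e2 := c2.eventually (p := fun p => insertTails w p ∈ σ.freeRange) (by simpa using hev)
    filter_upwards [e1, e2] with q h1 h2
    rw [heq _ h1, heq _ h2]
    have hz := phi_mem h1.1
    obtain ⟨d1, d2, d3, d4, d5, d6⟩ := (sameShape_iff h1.1).1 (sameShape_refl _)
    -- The reflection realises `p₀ + q ↦ p₀ - q`. It also changes the sign of `Θ₀, ϑ₀`, which the
    -- shape ignores.
    have hs : σ.SameShape (reflect (σ.phi (insertTails w (p₀ + q))))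
        (σ.phi (insertTails w (p₀ - q))) := by
      rw [sameShape_iff h2.1]
      refine ⟨?_, ?_, fun i => ?_, fun i => ?_, fun i => ?_, fun i => ?_⟩
      · rw [reflect_eq_act, Lam_act reflVec_isOrthogonal, d1]; rfl
      · rw [reflect_eq_act, chi_act reflVec_isOrthogonal, d2]; rfl
      · rw [Theta_reflect, Pi.neg_apply, d3]
        simp [insertTails, hp₀, Fin.tail, (hk i).1]
      · rw [reflect_eq_act, meanAnomaly_act reflVec_isOrthogonal, d4]; rfl
      · rw [kappa_reflect, d5]; rfl
      · rw [vartheta_reflect, Pi.neg_apply, d6]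
        -- The values `0` and `π` are their own opposites mod `2π`, so negation fixes the base point
        -- of `ϑ`.
        have hπ : -(w.2 2 i.succ : Real.Angle) = (w.2 2 i.succ : Real.Angle) := by
          rw [(hk i).2]
          generalize k i = m
          fin_cases m <;> simp
        simp only [insertTails, hp₀, Fin.tail, Matrix.cons_val, Fin.cons_succ, Prod.snd_add,
          Prod.snd_sub, Pi.add_apply, Pi.sub_apply, Real.Angle.coe_add, Real.Angle.coe_sub, neg_add,
          hπ]
        rw [sub_eq_add_neg]
    rw [← hs.fHel_eq ((regular_phi h1.1).map_act reflVec_isOrthogonal) (regular_phi h2.1),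
      reflect_eq_act, fHel_act reflVec_isOrthogonal]

end PlanetarySystem
end Planetary

/-! ### Assembly of the proposition. -/

theorem proposition3p1 {N : ℕ} (σ : Planetary.PlanetarySystem N) :
    -- the coordinates are canonical
    (IsOpen σ.domain ∧ Set.InjOn σ.pStar σ.domain ∧ IsOpen σ.range ∧
      ContDiffOn ℝ ∞ σ.phi σ.range ∧
      ∀ w ∈ σ.range, ∀ u v : Planetary.Coord (N + 1),
        Planetary.stdForm (fderiv ℝ σ.phi w u) (fderiv ℝ σ.phi w v) = Planetary.stdForm u v) ∧
    -- `Θ₀`, `ϑ₀`, `χ₀` are integrals of motion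
    (∀ (γ : ℝ → Planetary.Coord (N + 1)) (s₀ s₁ : ℝ),
      (∀ t ∈ Set.Ioo s₀ s₁, γ t ∈ σ.freeRange) →
      Planetary.IsHamiltonianMotion σ.hStar γ s₀ s₁ →
      ∀ t ∈ Set.Ioo s₀ s₁, ∀ t' ∈ Set.Ioo s₀ s₁,
        (γ t).1 2 0 = (γ t').1 2 0 ∧ (γ t).2 2 0 = (γ t').2 2 0 ∧
          (γ t).1 1 0 = (γ t').1 1 0) ∧
    -- the reflection changes the sign of `(Θ, ϑ)` and nothing else
    (∀ z ∈ σ.domain, Planetary.reflect z ∈ σ.domain ∧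
      σ.pStar (Planetary.reflect z) =
        (![σ.Lam z, Planetary.PlanetarySystem.chi z, - σ.Theta z], ![σ.meanAnomaly z, σ.kappa z, - σ.vartheta z])) ∧
    -- the configurations with `(Θ, ϑ) = (0, π k)` for the indices `1, ..., N` are the planar ones
    (∀ z ∈ σ.domain, Planetary.IsPlanar z ↔
      ∃ k : Fin N → Fin 2, ∀ j : Fin N, σ.Theta z j.succ = 0 ∧
        σ.vartheta z j.succ = ((Real.pi * ((k j : ℕ) : ℝ) : ℝ) : Real.Angle)) ∧
    -- angular momenta all parallel and in the same verse: `Θ = 0` and `ϑ = π`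
    (∀ z ∈ σ.domain,
      (∀ i j, ∃ c : ℝ, 0 < c ∧ Planetary.PlanetarySystem.angMom z i =
        c • Planetary.PlanetarySystem.angMom z j) →
      ∀ j : Fin N, σ.Theta z j.succ = 0 ∧ σ.vartheta z j.succ = ((Real.pi : ℝ) : Real.Angle)) ∧
    -- the reduced Hamiltonian; `f χ₀ Λ χ Θ ℓ κ ϑ` has the entry `0` of `χ, Θ, κ, ϑ` removed
    ∃ f : ℝ → (Fin (N + 1) → ℝ) → (Fin N → ℝ) → (Fin N → ℝ) →
        (Fin (N + 1) → ℝ) → (Fin N → ℝ) → (Fin N → ℝ) → ℝ,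
      (∀ w ∈ σ.freeRange,
        σ.fHel (σ.phi w) =
          f (w.1 1 0) (w.1 0) (Fin.tail (w.1 1)) (Fin.tail (w.1 2))
            (w.2 0) (Fin.tail (w.2 1)) (Fin.tail (w.2 2)) ∧
        σ.hStar w = σ.hKep (w.1 0) +
          σ.μ * f (w.1 1 0) (w.1 0) (Fin.tail (w.1 1)) (Fin.tail (w.1 2))
            (w.2 0) (Fin.tail (w.2 1)) (Fin.tail (w.2 2))) ∧
      -- the points `(Θ, ϑ) = (0, π k)` are equilibria of the reduced perturbation
      ∀ w ∈ σ.freeRange,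
        (∃ k : Fin N → Fin 2, ∀ j : Fin N, w.1 2 j.succ = 0 ∧
          (w.2 2 j.succ : Real.Angle) = ((Real.pi * ((k j : ℕ) : ℝ) : ℝ) : Real.Angle)) →
        HasFDerivAt
          (fun p : (Fin N → ℝ) × (Fin N → ℝ) =>
            f (w.1 1 0) (w.1 0) (Fin.tail (w.1 1)) p.1 (w.2 0) (Fin.tail (w.2 1)) p.2)
          (0 : (Fin N → ℝ) × (Fin N → ℝ) →L[ℝ] ℝ)
          (Fin.tail (w.1 2), Fin.tail (w.2 2)) := by
  open Planetary.PlanetarySystem in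
  exact ⟨⟨isOpen_domain σ, pStar_injOn σ, isOpen_range σ,
      fun w hw => (phi_local hw).2.1.contDiffWithinAt, fun w hw => (phi_local hw).2.2⟩,
    fun γ s₀ s₁ hγ hm t ht t' ht' => integrals (fun s hs => (hγ s hs).1) hm ht ht',
    fun z hz => ⟨reflect_mem_domain hz, pStar_reflect z⟩,
    fun z hz => isPlanar_iff (mem_domain_iff.1 hz).1,
    fun z hz hC j => theta_vartheta_of_parallel (mem_domain_iff.1 hz).1 hC j,
    σ.reducedPert, fun w hw => ⟨fHel_phi_eq hw, by rw [hStar_eq hw.1, fHel_phi_eq hw]⟩,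
    fun w hw hk => equilibrium hw hk⟩
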